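/- Let $k$ be a field and let $\mathfrak g=\operatorname{Spec}(H)$ be a finite group scheme over $k$, where $H$ is a finite-dimensional commutative Hopf algebra over $k$ with comultiplication $\mu$ and counit $\pi$. Fix a $k$-basis $b_0,\dots,b_{e-1}$ of $H$ with $\pi(b_0)=1$ and $\pi(b_i)=0$ for $i>0$. A $\mathfrak g$-field is a field $K\supseteq k$ together with a $k$-algebra homomorphism $\partial:K\to K\otimes_k H$ satisfying $(\mathrm{id}\otimes\pi)\circ\partial=\mathrm{id}_K$ and $(\partial\otimes\mathrm{id})\circ\partial=(\mathrm{id}\otimes\mu)\circ\partial$. Write $\partial(r)=\sum_{i<e}\partial_i(r)\otimes b_i$, so $\partial_0=\mathrm{id}$. Let $L_{\mathfrak g}$ be the language of rings expanded by unary function symbols for $\partial_1,\dots,\partial_{e-1}$ and by constants for the elements of $k$; each $\mathfrak g$-field is an $L_{\mathfrak g}$-structure. Let $\mathfrak g$-DF be the $L_{\mathfrak g}$-theory of all $\mathfrak g$-fields. A $\mathfrak g$-field $(K,\partial)$ is existentially closed if every quantifier-free $L_{\mathfrak g}$-formula with parameters from $K$ that has a realisation in some $\mathfrak g$-field extension of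 $(K,\partial)$ has a realisation in $K$. For a $\mathfrak g$-field $(K,\partial)$ and a $K$-algebra $R$, let $R\otimes^{\partial}_k H$ be the ring $R\otimes_k H$ with the $K$-algebra structure $K\xrightarrow{\partial}K\otimes_k H\to R\otimes_k H$. A $K$-variety is a reduced, $K$-irreducible closed subscheme of an affine space $\mathbb A^n_K$, $n>0$. For a closed subscheme $V\subseteq\mathbb A^n_K$, let $\nabla(V)\subseteq\nabla(\mathbb A^n_K)=\mathbb A^{ne}_K$ be the closed subscheme with $\nabla(V)(R)=V(R\otimes^{\partial}_k H)$ for all $K$-algebras $R$ (where $(r_j)_{j<e}\in R^e$ is identified with $\sum_j r_j\otimes b_j$), let $\partial_V=V(\partial):V(K)\to V(K\otimes^{\partial}_kH)=\nabla(V)(K)$, and let $c_V:\nabla(V)\to\nabla(\nabla(V))$ be the morphism given on $R$-points by $V(\mathrm{id}\otimes\mu):V(R\otimes^{\partial}_k H)\to V((R\otimes^{\partial}_k H)\otimes^{\partial}_k H)$. We say that $(K,\partial)$ satisfies the geometric axioms if for every $n>0$ and all $K$-varieties $V\subseteq\mathbb A^n_K$ and $W\subseteq\nabla(V)$ with $c_V(W)\subseteq\nabla(W)$,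 there is $a\in V(K)$ such that $\partial_V(a)\in W(K)$. Then: 1. A $\mathfrak g$-field $(K,\partial)$ is existentially closed if and only if it satisfies the geometric axioms. 2. There is an $L_{\mathfrak g}$-theory, denoted $\mathfrak g$-DCF, whose models are exactly the $\mathfrak g$-fields satisfying the geometric axioms, and $\mathfrak g$-DCF is a model companion of $\mathfrak g$-DF: every model of either theory embeds into a model of the other, and every embedding between models of $\mathfrak g$-DCF is elementary. -/

import Mathlib

open scoped TensorProduct FirstOrder

universe u v w

namespace GroupSchemeAction

noncomputable section

/-! ### Actions of a finite group scheme

The finite group scheme `𝔤 = Spec H` over the field `k` is given by a commutative Hopf algebra `H`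
over `k` with a finite `k`-basis. -/

/-- A `𝔤`-ring structure on the commutative `k`-algebra `R`, that is, an action of `𝔤 = Spec H` on
`Spec R`, given as a `k`-algebra map `∂ : R → R ⊗ H` which satisfies the counit condition and the
coassociativity condition. A `𝔤`-field is a field with such a structure. -/
structure GAction (k : Type u) (H : Type v) (R : Type w) [Field k] [CommRing H] [HopfAlgebra k H]
    [CommRing R] [Algebra k R] where
  /-- The coaction. -/
  toAlgHom : R →ₐ[k] R ⊗[k] H
  /-- `(id ⊗ π) ∘ ∂ = id`, after the identification of `R ⊗ k` with `R`. -/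
  counit_comp : ((Algebra.TensorProduct.rid k k R).toAlgHom.comp
      (Algebra.TensorProduct.map (AlgHom.id k R) (Bialgebra.counitAlgHom k H))).comp toAlgHom =
    AlgHom.id k R
  /-- `(∂ ⊗ id) ∘ ∂ = (id ⊗ μ) ∘ ∂`, after the identification of `(R ⊗ H) ⊗ H` with
  `R ⊗ (H ⊗ H)`. -/
  coassoc : ((Algebra.TensorProduct.assoc k k k R H H).toAlgHom.comp
      (Algebra.TensorProduct.map toAlgHom (AlgHom.id k H))).comp toAlgHom =
    (Algebra.TensorProduct.map (AlgHom.id k R) (Bialgebra.comulAlgHom k H)).comp toAlgHom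

section Algebra

variable {k : Type u} {H : Type v} [Field k] [CommRing H] [HopfAlgebra k H]

/-- The `k`-algebra map `φ : R → S` is a morphism of `𝔤`-rings `(R, ∂) → (S, ∂')`. -/
def IsGHom {R S : Type*} [CommRing R] [Algebra k R] [CommRing S] [Algebra k S]
    (d : GAction k H R) (d' : GAction k H S) (φ : R →ₐ[k] S) : Prop :=
  d'.toAlgHom.comp φ = (Algebra.TensorProduct.map φ (AlgHom.id k H)).comp d.toAlgHom

/-- The map `id ⊗ μ : R ⊗ H → (R ⊗ H) ⊗ H`. -/
def idComul (k : Type u) (H : Type v) [Field k] [CommRing H] [HopfAlgebra k H]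
    (R : Type*) [CommRing R] [Algebra k R] : R ⊗[k] H →ₐ[k] (R ⊗[k] H) ⊗[k] H :=
  (Algebra.TensorProduct.assoc k k k R H H).symm.toAlgHom.comp
    (Algebra.TensorProduct.map (AlgHom.id k R) (Bialgebra.comulAlgHom k H))

/-! ### Varieties, prolongations and the iterativity morphism

A `K`-algebra is given by a `k`-algebra `R` together with its structure map `φ : K → R`
(a `k`-algebra homomorphism). -/

/-- The set `V(R)` of points of the closed subscheme `V` of affine space over `K` which is cut out by
the ideal `P`, with coordinates in the `K`-algebra `R` with structure map `φ`. -/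
def points {K R σ : Type*} [Field K] [Algebra k K] [CommRing R] [Algebra k R]
    (P : Ideal (MvPolynomial σ K)) (φ : K →ₐ[k] R) : Set (σ → R) :=
  {x | ∀ f ∈ P, f.eval₂ (φ : K →+* R) x = 0}

/-- The `∂`-twisted `K`-algebra structure `K → K ⊗ H → R ⊗ H` on `R ⊗ H`, where `R` is a `K`-algebra
with structure map `φ`. -/
def twist {K R : Type*} [Field K] [Algebra k K] [CommRing R] [Algebra k R]
    (d : GAction k H K) (φ : K →ₐ[k] R) : K →ₐ[k] R ⊗[k] H :=
  (Algebra.TensorProduct.map φ (AlgHom.id k H)).comp d.toAlgHom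

/-- The identification `(R ⊗ H)^σ = R^(σ × ι)` given by the basis `b` of `H`: the element
`∑ j, r_j ⊗ b_j` of `R ⊗ H` has the coordinates `r_j`. -/
def coords {ι : Type*} [Fintype ι] (b : Module.Basis ι k H) (σ : Type*) (R : Type*) [CommRing R]
    [Algebra k R] : (σ → R ⊗[k] H) ≃ (σ × ι → R) where
  toFun y p := (Algebra.TensorProduct.basis R b).repr (y p.1) p.2
  invFun x i := ∑ j, x (i, j) ⊗ₜ[k] b j
  left_inv y := by
    funext i
    have h := (Algebra.TensorProduct.basis R b).sum_repr (y i)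
    simpa [TensorProduct.smul_tmul'] using h
  right_inv x := by
    classical
    funext p
    obtain ⟨i, j⟩ := p
    have h := (Algebra.TensorProduct.basis R b).repr_sum_self (fun j => x (i, j))
    simpa [TensorProduct.smul_tmul'] using congrFun h j

/-- The set `∇(V)(R)` of points of the `∂`-prolongation of `V`, which is `V(R ⊗^∂ H)` written in the
coordinates given by the basis `b`, so that `∇(𝔸^σ) = 𝔸^(σ × ι)`. -/
def prolongationPoints {K R σ ι : Type*} [Fintype ι] [Field K] [Algebra k K] [CommRing R]
    [Algebra k R] (b : Module.Basis ι k H) (d : GAction k H K) (P : Ideal (MvPolynomial σ K))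
    (φ : K →ₐ[k] R) : Set (σ × ι → R) :=
  {x | (coords b σ R).symm x ∈ points P (twist d φ)}

/-- The morphism `c` from `∇(𝔸^σ)` to `∇(∇(𝔸^σ))` on `R`-points, which is `id ⊗ μ` in the coordinates
given by the basis `b`: it is the map
`R^(σ × ι) = (R ⊗ H)^σ → ((R ⊗ H) ⊗ H)^σ = (R ⊗ H)^(σ × ι) = R^((σ × ι) × ι)`.
For every `V`, the morphism `c_V` is its restriction to `∇(V)`. -/
def cMap {ι : Type*} [Fintype ι] (b : Module.Basis ι k H) (σ : Type*) (R : Type*) [CommRing R]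
    [Algebra k R] (x : σ × ι → R) : (σ × ι) × ι → R :=
  coords b (σ × ι) R
    (coords b σ (R ⊗[k] H) (fun i => idComul k H R ((coords b σ R).symm x i)))

/-- The map `∂_V : V(K) → ∇(V)(K)`, in coordinates. -/
def gPoint {K σ ι : Type*} [Fintype ι] [Field K] [Algebra k K] (b : Module.Basis ι k H)
    (d : GAction k H K) (a : σ → K) : σ × ι → K :=
  coords b σ K (fun i => d.toAlgHom (a i))

/-- The geometric axioms. A `K`-variety is an integral closed subscheme of an affine space over `K`,
that is, a prime ideal of the polynomial ring. The inclusions `W ⊆ ∇(V)` and `c_V(W) ⊆ ∇(W)` of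
closed subschemes are stated on `R`-points, for all `K`-algebras `R`. -/
def GeometricAxioms {ι : Type*} [Fintype ι] {K : Type w} [Field K] [Algebra k K]
    (b : Module.Basis ι k H) (d : GAction k H K) : Prop :=
  ∀ n : ℕ, 0 < n → ∀ (V : Ideal (MvPolynomial (Fin n) K))
    (W : Ideal (MvPolynomial (Fin n × ι) K)), V.IsPrime → W.IsPrime →
    (∀ (R : Type w) [CommRing R] [Algebra k R] (φ : K →ₐ[k] R),
      points W φ ⊆ prolongationPoints b d V φ) →
    (∀ (R : Type w) [CommRing R] [Algebra k R] (φ : K →ₐ[k] R),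
      ∀ x ∈ points W φ, cMap b (Fin n) R x ∈ prolongationPoints b d W φ) →
    ∃ a ∈ points V (AlgHom.id k K), gPoint b d a ∈ points W (AlgHom.id k K)

end Algebra

/-! ### The first-order language of `𝔤`-fields -/

/-- The function symbols of the language of `𝔤`-fields, where `𝔤` has order `e = m + 1`: the symbols
of the language of rings, the unary symbols `∂_1, …, ∂_m` and the constants from `k`. -/
inductive GFunc (k : Type u) (m : ℕ) : ℕ → Type u
  | add : GFunc k m 2
  | mul : GFunc k m 2
  | neg : GFunc k m 1
  | zero : GFunc k m 0
  | one : GFunc k m 0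
  | op (i : Fin m) : GFunc k m 1
  | const (a : k) : GFunc k m 0

/-- The language `L_𝔤`. -/
def gLanguage (k : Type u) (m : ℕ) : FirstOrder.Language.{u, 0} :=
  ⟨GFunc k m, fun _ => Empty⟩

section Structures

variable {k : Type u} {H : Type v} [Field k] [CommRing H] [HopfAlgebra k H] {m : ℕ}

/-- The basis `b_0, …, b_m` of `H` satisfies `π(b_0) = 1` and `π(b_i) = 0` for `i > 0`. -/
def IsAdapted (b : Module.Basis (Fin (m + 1)) k H) : Prop :=
  Coalgebra.counit (R := k) (b 0) = 1 ∧ ∀ i : Fin m, Coalgebra.counit (R := k) (b i.succ) = 0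

/-- The operator `∂_i`, so that `∂(r) = ∑ i, ∂_i(r) ⊗ b_i`. -/
def gOperator {ι R : Type*} [CommRing R] [Algebra k R] (b : Module.Basis ι k H) (d : GAction k H R)
    (i : ι) (r : R) : R :=
  (Algebra.TensorProduct.basis R b).repr (d.toAlgHom r) i

/-- A `𝔤`-ring as a structure for the language `L_𝔤`. -/
@[reducible]
def gStructure {R : Type*} [CommRing R] [Algebra k R] (b : Module.Basis (Fin (m + 1)) k H)
    (d : GAction k H R) : (gLanguage k m).Structure R where
  funMap {n} (f : GFunc k m n) := match f with
    | .add => fun x => x 0 + x 1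
    | .mul => fun x => x 0 * x 1
    | .neg => fun x => -x 0
    | .zero => fun _ => 0
    | .one => fun _ => 1
    | .op i => fun x => gOperator b d i.succ (x 0)
    | .const a => fun _ => algebraMap k R a
  RelMap r := r.elim

/-- The `𝔤`-field `(K, ∂)` is existentially closed: every quantifier-free `L_𝔤`-formula with
parameters from `K` which has a realisation in some `𝔤`-field extension of `K` has a realisation
in `K`. -/
def IsExistentiallyClosed {K : Type w} [Field K] [Algebra k K]
    (b : Module.Basis (Fin (m + 1)) k H) (d : GAction k H K) : Prop :=
  ∀ (L : Type w) [Field L] [Algebra k L] (d' : GAction k H L) (φ : K →ₐ[k] L), IsGHom d d' φ →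
    ∀ (n : ℕ) (ψ : (gLanguage k m).Formula (K ⊕ Fin n)), ψ.IsQF →
      (∃ x : Fin n → L,
        @FirstOrder.Language.Formula.Realize _ L (gStructure b d') _ ψ (Sum.elim φ x)) →
      ∃ a : Fin n → K,
        @FirstOrder.Language.Formula.Realize _ K (gStructure b d) _ ψ (Sum.elim id a)

/-- The theory `𝔤`-DF of `𝔤`-fields: all `L_𝔤`-sentences which hold in every `𝔤`-field. -/
def gDF (b : Module.Basis (Fin (m + 1)) k H) : (gLanguage k m).Theory :=
  {φ | ∀ (K : Type (max u w)) [Field K] [Algebra k K] (d : GAction k H K),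
    @FirstOrder.Language.Sentence.Realize _ K (gStructure b d) φ}

end Structures

/-! ### Model companions -/

/-- The theory `T` is model complete: every embedding between models of `T` is elementary. -/
def IsModelComplete {L : FirstOrder.Language.{u, 0}} (T : L.Theory) : Prop :=
  ∀ (M N : Type (max u w)) [L.Structure M] [L.Structure N], M ⊨ T → N ⊨ T →
    ∀ (f : M ↪[L] N) (n : ℕ) (φ : L.Formula (Fin n)) (x : Fin n → M),
      φ.Realize (f ∘ x) ↔ φ.Realize x

/-- The theory `T'` is a model companion of the theory `T`: every model of either theory embeds into
a model of the other one, and `T'` is model complete. -/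
def IsModelCompanion {L : FirstOrder.Language.{u, 0}} (T T' : L.Theory) : Prop :=
  (∀ (M : Type (max u w)) [L.Structure M], M ⊨ T →
    ∃ (N : Type (max u w)) (_ : L.Structure N), N ⊨ T' ∧ Nonempty (M ↪[L] N)) ∧
  (∀ (M : Type (max u w)) [L.Structure M], M ⊨ T' →
    ∃ (N : Type (max u w)) (_ : L.Structure N), N ⊨ T ∧ Nonempty (M ↪[L] N)) ∧
  IsModelComplete.{u, w} T'

end

end GroupSchemeAction

/-!
Existential closedness of a `𝔤`-field `K` is a statement about polynomials: a quantifier-free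
formula in `x` depends on the vanishing of finitely many polynomials over `K` at `∂(x)`, so `K` is
existentially closed if and only if, for `x` in a `𝔤`-field extension, finitely many polynomials
always have the same vanishing pattern at `∂(x)` and at `∂(a)` for some `a` in `K` (`PolyClosed`).

This is equivalent to the geometric axioms. The polynomial ring in the variables `∂_j(x_i)` carries
an action of `𝔤` (`polyAction`), and an ideal of it defines a subscheme `W` with `c(W) ⊆ ∇(W)` if and
only if it is stable under the coaction. Residue rings by such ideals, and fraction fields of
`𝔤`-rings without zero divisors, are again `𝔤`-rings. For fraction fields this uses the antipode,
which shows that the coaction maps nonzero elements to elements which are not zero divisors. So the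
varieties `W` of the axioms are exactly the loci of tuples `∂(x)` (`PolyClosed.geometricAxioms`,
`GeometricAxioms.polyClosed`).

The geometric axioms quantify over prime ideals, and are not of first order as they stand. Instead
of bounds for primality in polynomial rings, the axiomatization goes through the field of constants
`C` of `K` (`ConstantAxioms`). If `K` is existentially closed, then there are elements
`a_0, …, a_m` of `K` with `det (∂_j(a_i)) ≠ 0`, which form a basis of `K` over `C` and remain a basis
over the constants in every `𝔤`-field extension. In this basis all conditions on `∂(x)` become
conditions over `C` on a tuple of constants of the extension. The field generated over `C` by such a
tuple is linearly disjoint from `K`, hence separably generated, hence the function field of a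
hypersurface over `C` whose equation is irreducible over `K`. So it suffices that all hypersurfaces
of this kind have enough points in `C` (`polyClosed_iff_constantAxioms`), and this is of first order
because factors of a polynomial have bounded degree (`exists_theory_constantAxioms`).

That a structure is a `𝔤`-field can be read off from the identities of all `𝔤`-fields together with
the existence of inverses (`SatisfiesIdentities.isGFieldStructure`), so that the models of the
theory of `𝔤`-fields are the `𝔤`-fields, and the class of `𝔤`-fields is closed under ultraproducts
and unions of chains. In such a class every structure has an existentially closed extension
(`exists_isECIn_extension`), and if the existentially closed structures are the models of a theory,
then this theory is model complete by Robinson's criterion (`isModelComplete_of_isECIn`).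
-/

namespace GroupSchemeAction

noncomputable section

section Algebra

/-! ### Base change and the laws of a coaction -/

variable {k : Type u} {H : Type v} [Field k] [CommRing H] [HopfAlgebra k H]

/-- The base change `f ⊗ id : R ⊗ H → S ⊗ H` of a `k`-algebra map `f : R → S`. -/
abbrev mapH (H : Type v) [CommRing H] [HopfAlgebra k H] {R S : Type*} [CommRing R] [Algebra k R]
    [CommRing S] [Algebra k S] (f : R →ₐ[k] S) : R ⊗[k] H →ₐ[k] S ⊗[k] H :=
  Algebra.TensorProduct.map f (AlgHom.id k H)

/-- The map `id ⊗ π : R ⊗ H → R`. -/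
def counitH (k : Type u) (H : Type v) [Field k] [CommRing H] [HopfAlgebra k H] (R : Type*)
    [CommRing R] [Algebra k R] : R ⊗[k] H →ₐ[k] R :=
  (Algebra.TensorProduct.rid k k R).toAlgHom.comp
    (Algebra.TensorProduct.map (AlgHom.id k R) (Bialgebra.counitAlgHom k H))

section General

variable {R S T : Type*} [CommRing R] [Algebra k R] [CommRing S] [Algebra k S] [CommRing T]
  [Algebra k T]

@[simp]
theorem counitH_tmul (r : R) (h : H) :
    counitH k H R (r ⊗ₜ h) = Coalgebra.counit (R := k) h • r := by
  simp [counitH]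

theorem counitH_mapH (f : R →ₐ[k] S) (y : R ⊗[k] H) :
    counitH k H S (mapH H f y) = f (counitH k H R y) := by
  induction y with
  | zero => simp
  | tmul r h => simp
  | add x y hx hy => simp only [map_add, hx, hy]

theorem mapH_comp_apply (g : S →ₐ[k] T) (f : R →ₐ[k] S) (y : R ⊗[k] H) :
    mapH H (g.comp f) y = mapH H g (mapH H f y) := by
  induction y with
  | zero => simp
  | tmul r h => simp
  | add x y hx hy => simp only [map_add, hx, hy]

theorem mapH_id_apply (y : R ⊗[k] H) : mapH H (AlgHom.id k R) y = y := by
  simp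

theorem mapH_injective {f : R →ₐ[k] S} (hf : Function.Injective f) :
    Function.Injective (mapH H f) := by
  have := Module.Flat.rTensor_preserves_injective_linearMap (M := H) f.toLinearMap hf
  intro x y hxy
  exact this hxy

theorem idComul_tmul (r : R) (h : H) :
    idComul k H R (r ⊗ₜ h) =
      (Algebra.TensorProduct.assoc k k k R H H).symm (r ⊗ₜ Coalgebra.comul (R := k) h) := by
  simp [idComul]

theorem mapH_mapH_idComul (f : R →ₐ[k] S) (y : R ⊗[k] H) :
    mapH H (mapH H f) (idComul k H R y) = idComul k H S (mapH H f y) := by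
  induction y with
  | zero => simp
  | add x y hx hy => simp only [map_add, hx, hy]
  | tmul r h =>
    simp only [idComul_tmul, Algebra.TensorProduct.map_tmul, AlgHom.id_apply]
    generalize Coalgebra.comul (R := k) h = z
    induction z with
    | zero => simp
    | add x y hx hy => simp only [map_add, TensorProduct.tmul_add, hx, hy]
    | tmul h₁ h₂ => simp

theorem mapH_counitH_idComul (y : R ⊗[k] H) :
    mapH H (counitH k H R) (idComul k H R y) = y := by
  induction y with
  | zero => simp
  | add x y hx hy => simp only [map_add, hx, hy]
  | tmul r h =>
    have h1 : ∀ z : H ⊗[k] H, mapH H (counitH k H R)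
        ((Algebra.TensorProduct.assoc k k k R H H).symm (r ⊗ₜ z)) =
        r ⊗ₜ (TensorProduct.lid k H (Coalgebra.counit.rTensor H z)) := by
      intro z
      induction z with
      | zero => simp
      | add x y hx hy => simp only [map_add, TensorProduct.tmul_add, hx, hy]
      | tmul h₁ h₂ => simp [TensorProduct.smul_tmul]
    rw [idComul_tmul, h1, Coalgebra.rTensor_counit_comul]
    simp

theorem counitH_idComul (y : R ⊗[k] H) :
    counitH k H (R ⊗[k] H) (idComul k H R y) = y := by
  induction y with
  | zero => simp
  | add x y hx hy => simp only [map_add, hx, hy]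
  | tmul r h =>
    have h1 : ∀ z : H ⊗[k] H, counitH k H (R ⊗[k] H)
        ((Algebra.TensorProduct.assoc k k k R H H).symm (r ⊗ₜ z)) =
        r ⊗ₜ (TensorProduct.rid k H (Coalgebra.counit.lTensor H z)) := by
      intro z
      induction z with
      | zero => simp
      | add x y hx hy => simp only [map_add, TensorProduct.tmul_add, hx, hy]
      | tmul h₁ h₂ => simp
    rw [idComul_tmul, h1, Coalgebra.lTensor_counit_comul]
    simp

theorem idComul_idComul (y : R ⊗[k] H) :
    mapH H (idComul k H R) (idComul k H R y) = idComul k H (R ⊗[k] H) (idComul k H R y) := by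
  induction y with
  | zero => simp
  | add x y hx hy => simp only [map_add, hx, hy]
  | tmul r h =>
    have h1 : ∀ z : H ⊗[k] H, mapH H (idComul k H R)
        ((Algebra.TensorProduct.assoc k k k R H H).symm (r ⊗ₜ z)) =
        mapH H (Algebra.TensorProduct.assoc k k k R H H).symm.toAlgHom
        ((Algebra.TensorProduct.assoc k k k R (H ⊗[k] H) H).symm
          (r ⊗ₜ (Coalgebra.comul.rTensor H z))) := by
      intro z
      induction z with
      | zero => simp
      | add x y hx hy => simp only [map_add, TensorProduct.tmul_add, hx, hy]
      | tmul h₁ h₂ => simp [idComul_tmul]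
    have h2 : ∀ z : H ⊗[k] H, idComul k H (R ⊗[k] H)
        ((Algebra.TensorProduct.assoc k k k R H H).symm (r ⊗ₜ z)) =
        mapH H (Algebra.TensorProduct.assoc k k k R H H).symm.toAlgHom
        ((Algebra.TensorProduct.assoc k k k R (H ⊗[k] H) H).symm
          (r ⊗ₜ ((TensorProduct.assoc k H H H).symm (Coalgebra.comul.lTensor H z)))) := by
      intro z
      induction z with
      | zero => simp
      | add x y hx hy => simp only [map_add, TensorProduct.tmul_add, hx, hy]
      | tmul h₁ h₂ =>
        simp only [Algebra.TensorProduct.assoc_symm_tmul, idComul_tmul, LinearMap.lTensor_tmul]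
        generalize Coalgebra.comul (R := k) h₂ = z'
        induction z' with
        | zero => simp
        | add x y hx hy => simp only [map_add, TensorProduct.tmul_add, hx, hy]
        | tmul h₁ h₂ => simp
    rw [idComul_tmul, h1, h2, Coalgebra.coassoc_symm_apply]

end General

namespace GAction

variable {R S : Type*} [CommRing R] [Algebra k R] [CommRing S] [Algebra k S]

@[simp]
theorem counitH_apply (d : GAction k H R) (r : R) : counitH k H R (d.toAlgHom r) = r :=
  DFunLike.congr_fun d.counit_comp r

theorem mapH_apply_apply (d : GAction k H R) (r : R) :
    mapH H d.toAlgHom (d.toAlgHom r) = idComul k H R (d.toAlgHom r) := by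
  have h := DFunLike.congr_fun d.coassoc r
  have h' := congrArg (Algebra.TensorProduct.assoc k k k R H H).symm h
  simpa [idComul] using h'

/-- A coaction from the two laws, stated on elements. -/
def ofLaws (D : R →ₐ[k] R ⊗[k] H) (h₁ : ∀ r, counitH k H R (D r) = r)
    (h₂ : ∀ r, mapH H D (D r) = idComul k H R (D r)) : GAction k H R where
  toAlgHom := D
  counit_comp := AlgHom.ext h₁
  coassoc := by
    ext r
    have h' := congrArg (Algebra.TensorProduct.assoc k k k R H H) (h₂ r)
    simpa [idComul] using h'

end GAction

theorem IsGHom.apply {R S : Type*} [CommRing R] [Algebra k R] [CommRing S] [Algebra k S]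
    {d : GAction k H R} {d' : GAction k H S} {φ : R →ₐ[k] S} (h : IsGHom d d' φ) (r : R) :
    d'.toAlgHom (φ r) = mapH H φ (d.toAlgHom r) :=
  DFunLike.congr_fun h r

theorem IsGHom.comp {R S T : Type*} [CommRing R] [Algebra k R] [CommRing S] [Algebra k S]
    [CommRing T] [Algebra k T]
    {d : GAction k H R} {d' : GAction k H S} {d'' : GAction k H T} {φ : R →ₐ[k] S} {ψ : S →ₐ[k] T}
    (hψ : IsGHom d' d'' ψ) (hφ : IsGHom d d' φ) : IsGHom d d'' (ψ.comp φ) := by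
  refine AlgHom.ext fun r => ?_
  change d''.toAlgHom (ψ (φ r)) = mapH H (ψ.comp φ) (d.toAlgHom r)
  rw [hψ.apply, hφ.apply, mapH_comp_apply]

end Algebra

section Polynomial

variable {k : Type u} {H : Type v} [Field k] [CommRing H] [HopfAlgebra k H]

/-! ### Evaluation maps and the action on polynomial rings -/

section Eval

variable {K : Type*} [Field K] [Algebra k K] {R S σ : Type*} [CommRing R] [Algebra k R]
  [CommRing S] [Algebra k S]

/-- The structure map `K → K[X_σ]` as a map of `k`-algebras. -/
def constHom (k : Type u) (K : Type*) [Field k] [Field K] [Algebra k K] (σ : Type*) :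
    K →ₐ[k] MvPolynomial σ K :=
  IsScalarTower.toAlgHom k K (MvPolynomial σ K)

@[simp]
theorem constHom_apply (c : K) : constHom k K σ c = MvPolynomial.C c := rfl

/-- Evaluation of polynomials over `K` at a tuple `x` in a `K`-algebra `R` with structure
map `φ`, as a map of `k`-algebras. -/
def evalHom (φ : K →ₐ[k] R) (x : σ → R) : MvPolynomial σ K →ₐ[k] R :=
  { MvPolynomial.eval₂Hom (φ : K →+* R) x with
    commutes' := fun c => by
      change MvPolynomial.eval₂ (φ : K →+* R) x (algebraMap k (MvPolynomial σ K) c) = _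
      rw [IsScalarTower.algebraMap_apply k K (MvPolynomial σ K), MvPolynomial.algebraMap_eq,
        MvPolynomial.eval₂_C]
      simp }

theorem evalHom_apply (φ : K →ₐ[k] R) (x : σ → R) (f : MvPolynomial σ K) :
    evalHom φ x f = f.eval₂ (φ : K →+* R) x := rfl

@[simp]
theorem evalHom_C (φ : K →ₐ[k] R) (x : σ → R) (c : K) :
    evalHom φ x (MvPolynomial.C c) = φ c := by
  simp [evalHom_apply]

@[simp]
theorem evalHom_X (φ : K →ₐ[k] R) (x : σ → R) (i : σ) :
    evalHom φ x (MvPolynomial.X i) = x i := by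
  simp [evalHom_apply]

theorem mvPolynomial_hom_ext {f g : MvPolynomial σ K →ₐ[k] R}
    (hC : ∀ c, f (MvPolynomial.C c) = g (MvPolynomial.C c))
    (hX : ∀ i, f (MvPolynomial.X i) = g (MvPolynomial.X i)) : f = g := by
  have h : (f : MvPolynomial σ K →+* R) = (g : MvPolynomial σ K →+* R) :=
    MvPolynomial.ringHom_ext hC hX
  exact AlgHom.ext fun p => RingHom.congr_fun h p

theorem eq_evalHom (f : MvPolynomial σ K →ₐ[k] R) :
    f = evalHom (f.comp (constHom k K σ)) (fun i => f (MvPolynomial.X i)) :=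
  mvPolynomial_hom_ext (by simp) (by simp)

theorem comp_evalHom (g : R →ₐ[k] S) (φ : K →ₐ[k] R) (x : σ → R) :
    g.comp (evalHom φ x) = evalHom (g.comp φ) (fun i => g (x i)) :=
  mvPolynomial_hom_ext (by simp) (by simp)

theorem mem_points_iff {P : Ideal (MvPolynomial σ K)} {φ : K →ₐ[k] R} {x : σ → R} :
    x ∈ points P φ ↔ P ≤ RingHom.ker (evalHom φ x) := Iff.rfl

end Eval

section Coords

variable {ι : Type*} [Fintype ι] (b : Module.Basis ι k H) {R S σ : Type*} [CommRing R]
  [Algebra k R] [CommRing S] [Algebra k S]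

theorem coords_symm_apply (x : σ × ι → R) (i : σ) :
    (coords b σ R).symm x i = ∑ j, x (i, j) ⊗ₜ[k] b j := rfl

theorem mapH_coords_symm (f : R →ₐ[k] S) (x : σ × ι → R) (i : σ) :
    mapH H f ((coords b σ R).symm x i) = (coords b σ S).symm (fun p => f (x p)) i := by
  simp [coords_symm_apply]

theorem coords_mapH (f : R →ₐ[k] S) (y : σ → R ⊗[k] H) (p : σ × ι) :
    coords b σ S (fun i => mapH H f (y i)) p = f (coords b σ R y p) := by
  have : (fun i => mapH H f (y i)) = (coords b σ S).symm (fun p => f (coords b σ R y p)) := by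
    funext i
    rw [← mapH_coords_symm, Equiv.symm_apply_apply]
  rw [this, Equiv.apply_symm_apply]

theorem gPoint_apply {K : Type*} [Field K] [Algebra k K] (d : GAction k H K) (a : σ → K)
    (i : σ) (j : ι) : gPoint b d a (i, j) = gOperator b d j (a i) := rfl

theorem coords_symm_gPoint {K : Type*} [Field K] [Algebra k K] (d : GAction k H K) (a : σ → K)
    (i : σ) : (coords b σ K).symm (gPoint b d a) i = d.toAlgHom (a i) :=
  congrFun ((coords b σ K).symm_apply_apply (fun i => d.toAlgHom (a i))) i

theorem sum_gOperator (d : GAction k H R) (r : R) :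
    ∑ j, gOperator b d j r ⊗ₜ[k] b j = d.toAlgHom r :=
  congrFun ((coords b Unit R).symm_apply_apply (fun _ => d.toAlgHom r)) ()

theorem eq_of_sum_tmul_basis_eq {r s : ι → R}
    (h : ∑ j, r j ⊗ₜ[k] b j = ∑ j, s j ⊗ₜ[k] b j) (j : ι) : r j = s j :=
  congrFun ((coords b Unit R).symm.injective (a₁ := fun p => r p.2) (a₂ := fun p => s p.2)
    (funext fun _ => h)) ((), j)

theorem tmul_eq_sum_basis (r : R) (h : H) : r ⊗ₜ h = ∑ j, (b.repr h j • r) ⊗ₜ[k] b j := by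
  conv_lhs => rw [← b.sum_repr h]
  rw [TensorProduct.tmul_sum]
  exact Finset.sum_congr rfl fun j _ => (TensorProduct.smul_tmul _ _ _).symm

theorem coords_symm_cMap (x : σ × ι → R) :
    (coords b (σ × ι) R).symm (cMap b σ R x) =
      coords b σ (R ⊗[k] H) (fun i => idComul k H R ((coords b σ R).symm x i)) :=
  (coords b (σ × ι) R).symm_apply_apply _

theorem coords_symm_coords_symm_cMap (x : σ × ι → R) (i : σ) :
    (coords b σ (R ⊗[k] H)).symm ((coords b (σ × ι) R).symm (cMap b σ R x)) i =
      idComul k H R ((coords b σ R).symm x i) := by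
  rw [coords_symm_cMap, Equiv.symm_apply_apply]

end Coords

section PolyAction

variable {ι : Type*} [Fintype ι] (b : Module.Basis ι k H) {K : Type*} [Field K] [Algebra k K]
  (d : GAction k H K) {R S σ : Type*} [CommRing R] [Algebra k R] [CommRing S] [Algebra k S]

/-- Two maps on the polynomial ring in the variables `X_(i,j)` agree if they agree on the
coefficients and on the elements `∑ j, X_(i,j) ⊗ b_j`. -/
theorem mvPolynomial_hom_ext_coords {f g : MvPolynomial (σ × ι) K →ₐ[k] R}
    (hC : ∀ c, f (MvPolynomial.C c) = g (MvPolynomial.C c))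
    (hX : ∀ i, mapH H f ((coords b σ _).symm MvPolynomial.X i) =
      mapH H g ((coords b σ _).symm MvPolynomial.X i)) : f = g := by
  refine mvPolynomial_hom_ext hC fun p => ?_
  have h : (coords b σ R).symm (fun p => f (MvPolynomial.X p)) =
      (coords b σ R).symm (fun p => g (MvPolynomial.X p)) := by
    funext i
    rw [← mapH_coords_symm, ← mapH_coords_symm]
    exact hX i
  exact congrFun ((coords b σ R).symm.injective h) p

theorem mapH_twist (f : R →ₐ[k] S) (φ : K →ₐ[k] R) (c : K) :
    mapH H f (twist d φ c) = twist d (f.comp φ) c :=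
  (mapH_comp_apply f φ (d.toAlgHom c)).symm

/-- The `K`-algebra map `K[∇𝔸^σ] → R ⊗^∂ H` which corresponds to the point `c(x)`. -/
def cHom (φ : K →ₐ[k] R) (x : σ × ι → R) : MvPolynomial (σ × ι) K →ₐ[k] R ⊗[k] H :=
  evalHom (twist d φ) ((coords b (σ × ι) R).symm (cMap b σ R x))

/-- On the tuple of the elements `∑ j, X_(i,j) ⊗ b_j` the map `cHom` is given by the
comultiplication. -/
theorem mapH_cHom_gen (φ : K →ₐ[k] R) (x : σ × ι → R) (i : σ) :
    mapH H (cHom b d φ x) ((coords b σ _).symm MvPolynomial.X i) =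
      idComul k H R ((coords b σ R).symm x i) := by
  rw [mapH_coords_symm, ← coords_symm_coords_symm_cMap]
  simp [cHom]

theorem mapH_evalHom_gen {φ : K →ₐ[k] R} {x : σ × ι → R} (i : σ) :
    mapH H (evalHom φ x) ((coords b σ _).symm MvPolynomial.X i) = (coords b σ R).symm x i := by
  rw [mapH_coords_symm]
  simp

/-- The ring `K{x}` of polynomials in the variables `X_(i,j) = ∂_j(x_i)`, with its action. The
coaction maps the element `∑ j, X_(i,j) ⊗ b_j`, which stands for `∂(x_i)`, as coassociativity
requires, and extends the coaction of `K`. -/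
def polyAction (σ : Type*) : GAction k H (MvPolynomial (σ × ι) K) :=
  GAction.ofLaws (cHom b d (constHom k K (σ × ι)) MvPolynomial.X)
    (by
      have h : (counitH k H _).comp (cHom b d (constHom k K (σ × ι)) MvPolynomial.X) =
          AlgHom.id k _ := by
        refine mvPolynomial_hom_ext_coords b (fun c => ?_) fun i => ?_
        · change counitH k H _ (cHom b d _ _ _) = _
          rw [cHom, evalHom_C, twist, AlgHom.comp_apply, counitH_mapH, d.counitH_apply]
          rfl
        · rw [mapH_comp_apply, mapH_cHom_gen, mapH_counitH_idComul, mapH_id_apply]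
      exact fun r => DFunLike.congr_fun h r)
    (by
      set D := cHom b d (constHom k K (σ × ι)) MvPolynomial.X with hD
      have hDC : D.comp (constHom k K (σ × ι)) = twist d (constHom k K (σ × ι)) := by
        ext c
        simp [hD, cHom]
      have h : (mapH H D).comp D = (idComul k H _).comp D := by
        refine mvPolynomial_hom_ext_coords b (fun c => ?_) fun i => ?_
        · have h0 : D (MvPolynomial.C c) = twist d (constHom k K (σ × ι)) c :=
            DFunLike.congr_fun hDC c
          rw [AlgHom.comp_apply, AlgHom.comp_apply, h0, mapH_twist, hDC, twist, twist,
            AlgHom.comp_apply, AlgHom.comp_apply, ← mapH_mapH_idComul, ← d.mapH_apply_apply,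
            ← mapH_comp_apply]
        · rw [mapH_comp_apply, mapH_comp_apply, mapH_cHom_gen, mapH_mapH_idComul, mapH_cHom_gen,
            idComul_idComul]
      exact fun r => DFunLike.congr_fun h r)

theorem polyAction_toAlgHom :
    (polyAction b d σ).toAlgHom = cHom b d (constHom k K (σ × ι)) MvPolynomial.X := rfl

theorem isGHom_constHom : IsGHom d (polyAction b d σ) (constHom k K (σ × ι)) := by
  refine AlgHom.ext fun c => ?_
  rw [polyAction_toAlgHom]
  simp [cHom, twist]

/-- Evaluation at `x` carries the coaction of `K{x}` to the map which describes the point `c(x)`.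
Hence an ideal of `K{x}` defines a subscheme `W` with `c(W) ⊆ ∇(W)` exactly if it is stable under
the coaction. -/
theorem mapH_evalHom_comp_polyAction (φ : K →ₐ[k] R) (x : σ × ι → R) :
    (mapH H (evalHom φ x)).comp (polyAction b d σ).toAlgHom = cHom b d φ x := by
  refine mvPolynomial_hom_ext_coords b (fun c => ?_) fun i => ?_
  · rw [AlgHom.comp_apply, polyAction_toAlgHom, cHom, evalHom_C, cHom, evalHom_C, mapH_twist]
    congr 2
    ext c
    simp
  · rw [mapH_comp_apply, polyAction_toAlgHom, mapH_cHom_gen, mapH_mapH_idComul, mapH_evalHom_gen,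
      mapH_cHom_gen]

/-- Evaluation at the point `∂(x)` is a morphism of `𝔤`-rings. -/
theorem isGHom_evalHom_gPoint {L : Type*} [Field L] [Algebra k L] {d' : GAction k H L}
    {φ : K →ₐ[k] L} (hφ : IsGHom d d' φ) (x : σ → L) :
    IsGHom (polyAction b d σ) d' (evalHom φ (gPoint b d' x)) := by
  rw [IsGHom, mapH_evalHom_comp_polyAction]
  refine mvPolynomial_hom_ext_coords b (fun c => ?_) fun i => ?_
  · rw [AlgHom.comp_apply, evalHom_C, cHom, evalHom_C, hφ.apply]
    rfl
  · rw [mapH_comp_apply, mapH_evalHom_gen, mapH_cHom_gen, coords_symm_gPoint, d'.mapH_apply_apply]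

end PolyAction

section Constants

variable {K : Type*} [Field K] [Algebra k K] (d : GAction k H K)

/-- The action on `K[X_σ]` which extends the action on `K` and fixes the variables. -/
def constPolyAction (σ : Type*) : GAction k H (MvPolynomial σ K) :=
  GAction.ofLaws (evalHom (twist d (constHom k K σ)) (fun i => MvPolynomial.X i ⊗ₜ 1))
    (by
      have h : (counitH k H _).comp (evalHom (twist d (constHom k K σ))
          (fun i => MvPolynomial.X i ⊗ₜ 1)) = AlgHom.id k _ := by
        refine mvPolynomial_hom_ext (fun c => ?_) fun i => ?_
        · rw [AlgHom.comp_apply, evalHom_C, twist, AlgHom.comp_apply, counitH_mapH,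
            d.counitH_apply]
          rfl
        · simp
      exact fun r => DFunLike.congr_fun h r)
    (by
      set D := evalHom (twist d (constHom k K σ))
        (fun i => MvPolynomial.X (R := K) i ⊗ₜ[k] (1 : H)) with hD
      have hDC : D.comp (constHom k K σ) = twist d (constHom k K σ) := by
        ext c
        simp [hD]
      have h : (mapH H D).comp D = (idComul k H _).comp D := by
        refine mvPolynomial_hom_ext (fun c => ?_) fun i => ?_
        · have h0 : D (MvPolynomial.C c) = twist d (constHom k K σ) c :=
            DFunLike.congr_fun hDC c
          rw [AlgHom.comp_apply, AlgHom.comp_apply, h0, mapH_twist, hDC, twist, twist,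
            AlgHom.comp_apply, AlgHom.comp_apply, ← mapH_mapH_idComul, ← d.mapH_apply_apply,
            ← mapH_comp_apply]
        · have h0 : D (MvPolynomial.X i) = MvPolynomial.X i ⊗ₜ 1 := by simp [hD]
          rw [AlgHom.comp_apply, AlgHom.comp_apply, h0, idComul_tmul]
          simp [h0, Algebra.TensorProduct.one_def]
      exact fun r => DFunLike.congr_fun h r)

theorem constPolyAction_C {σ : Type*} (c : K) :
    (constPolyAction d σ).toAlgHom (MvPolynomial.C c) = mapH H (constHom k K σ) (d.toAlgHom c) :=
  evalHom_C _ _ c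

theorem constPolyAction_X {σ : Type*} (i : σ) :
    (constPolyAction d σ).toAlgHom (MvPolynomial.X i) = MvPolynomial.X i ⊗ₜ 1 :=
  evalHom_X _ _ i

theorem isGHom_constHom_constPolyAction (σ : Type*) :
    IsGHom d (constPolyAction d σ) (constHom k K σ) :=
  AlgHom.ext fun c => constPolyAction_C d c

end Constants

/-! ### Quotients and fraction fields of `𝔤`-rings -/

section Quotient

variable {R : Type*} [CommRing R] [Algebra k R] (d : GAction k H R)

/-- An ideal is a `𝔤`-ideal if it is mapped by the coaction into the kernel of
`R ⊗ H → (R ⧸ I) ⊗ H`. -/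
def IsGIdeal (I : Ideal R) : Prop :=
  ∀ f ∈ I, mapH H (Ideal.Quotient.mkₐ k I) (d.toAlgHom f) = 0

/-- The quotient of a `𝔤`-ring by a `𝔤`-ideal. -/
def quotientAction (I : Ideal R) (hI : IsGIdeal d I) : GAction k H (R ⧸ I) :=
  GAction.ofLaws
    (Ideal.Quotient.liftₐ I ((mapH H (Ideal.Quotient.mkₐ k I)).comp d.toAlgHom) hI)
    (fun r => by
      obtain ⟨r, rfl⟩ := Ideal.Quotient.mk_surjective r
      change counitH k H _ (mapH H (Ideal.Quotient.mkₐ k I) (d.toAlgHom r)) = _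
      rw [counitH_mapH, d.counitH_apply]
      rfl)
    (fun r => by
      obtain ⟨r, rfl⟩ := Ideal.Quotient.mk_surjective r
      set D := Ideal.Quotient.liftₐ I ((mapH H (Ideal.Quotient.mkₐ k I)).comp d.toAlgHom) hI
      have hD : D.comp (Ideal.Quotient.mkₐ k I) =
        (mapH H (Ideal.Quotient.mkₐ k I)).comp d.toAlgHom := rfl
      have h0 : D (Ideal.Quotient.mk I r) = mapH H (Ideal.Quotient.mkₐ k I) (d.toAlgHom r) := rfl
      rw [h0, ← mapH_comp_apply, hD, mapH_comp_apply, d.mapH_apply_apply, mapH_mapH_idComul])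

theorem isGHom_quotientMk (I : Ideal R) (hI : IsGIdeal d I) :
    IsGHom d (quotientAction d I hI) (Ideal.Quotient.mkₐ k I) := rfl

end Quotient

section Fraction

variable {R : Type*} [CommRing R] [Algebra k R] (d : GAction k H R)

/-- The map `R ⊗ H → R ⊗ H`, `r ⊗ h ↦ (id ⊗ f)(∂ r) * (1 ⊗ h)`. For `f = id` it corresponds to the
automorphism `(x, g) ↦ (x g, g)` of `Spec R × 𝔤`, and for `f` the antipode to the inverse of this
automorphism. -/
def shear (f : H →ₐ[k] H) : R ⊗[k] H →ₐ[k] R ⊗[k] H :=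
  Algebra.TensorProduct.lift ((Algebra.TensorProduct.map (AlgHom.id k R) f).comp d.toAlgHom)
    Algebra.TensorProduct.includeRight (fun _ _ => Commute.all _ _)

theorem shear_tmul (f : H →ₐ[k] H) (r : R) (h : H) :
    shear d f (r ⊗ₜ h) =
      Algebra.TensorProduct.map (AlgHom.id k R) f (d.toAlgHom r) * (1 ⊗ₜ h) := by
  simp [shear]

/-- If `f` and `g` are inverse to each other for the convolution product, then the shear by `f`
takes `(id ⊗ g)(∂ r)` to `r ⊗ 1`. -/
theorem shear_map (f g : H →ₐ[k] H)
    (hfg : ∀ h : H, Algebra.TensorProduct.lift f g (fun _ _ => Commute.all _ _)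
      (Coalgebra.comul (R := k) h) = algebraMap k H (Coalgebra.counit h)) (r : R) :
    shear d f (Algebra.TensorProduct.map (AlgHom.id k R) g (d.toAlgHom r)) = r ⊗ₜ 1 := by
  set F : (R ⊗[k] H) ⊗[k] H →ₐ[k] R ⊗[k] H :=
    Algebra.TensorProduct.lift (Algebra.TensorProduct.map (AlgHom.id k R) f)
      (Algebra.TensorProduct.includeRight.comp g) (fun _ _ => Commute.all _ _) with hF
  have h1 : ∀ y : R ⊗[k] H, shear d f (Algebra.TensorProduct.map (AlgHom.id k R) g y) =
      F (mapH H d.toAlgHom y) := by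
    intro y
    induction y with
    | zero => simp
    | add x y hx hy => simp only [map_add, hx, hy]
    | tmul r h => simp [shear_tmul, hF]
  have h2 : ∀ y : R ⊗[k] H, F (idComul k H R y) = counitH k H R y ⊗ₜ 1 := by
    intro y
    induction y with
    | zero => simp
    | add x y hx hy => simp only [map_add, hx, hy, TensorProduct.add_tmul]
    | tmul r h =>
      have h3 : ∀ z : H ⊗[k] H, F ((Algebra.TensorProduct.assoc k k k R H H).symm (r ⊗ₜ z)) =
          r ⊗ₜ (Algebra.TensorProduct.lift f g (fun _ _ => Commute.all _ _) z) := by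
        intro z
        induction z with
        | zero => simp
        | add x y hx hy => simp only [map_add, TensorProduct.tmul_add, hx, hy]
        | tmul h₁ h₂ => simp [hF]
      rw [idComul_tmul, h3, hfg, counitH_tmul, Algebra.algebraMap_eq_smul_one,
        TensorProduct.tmul_smul, TensorProduct.smul_tmul']
  rw [h1, d.mapH_apply_apply, h2, d.counitH_apply]

theorem shear_antipode_apply (r : R) :
    shear d (HopfAlgebra.antipodeAlgHom k H) (d.toAlgHom r) = r ⊗ₜ 1 := by
  have := shear_map d (HopfAlgebra.antipodeAlgHom k H) (AlgHom.id k H) (fun h => by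
    rw [← HopfAlgebra.mul_antipode_rTensor_comul_apply (R := k) h]
    generalize Coalgebra.comul (R := k) h = z
    induction z with
    | zero => simp
    | add x y hx hy => simp only [map_add, hx, hy]
    | tmul h₁ h₂ => simp) r
  simpa using this

theorem shear_antipode_injective :
    Function.Injective (shear d (HopfAlgebra.antipodeAlgHom k H)) := by
  have h : ∀ y, shear d (AlgHom.id k H) (shear d (HopfAlgebra.antipodeAlgHom k H) y) = y := by
    intro y
    induction y with
    | zero => simp
    | add x y hx hy => simp only [map_add, hx, hy]
    | tmul r h =>
      rw [shear_tmul, map_mul, shear_map d (AlgHom.id k H), shear_tmul]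
      · simp
      · intro h
        rw [← HopfAlgebra.mul_antipode_lTensor_comul_apply (R := k) h]
        generalize Coalgebra.comul (R := k) h = z
        induction z with
        | zero => simp
        | add x y hx hy => simp only [map_add, hx, hy]
        | tmul h₁ h₂ => simp
  exact Function.LeftInverse.injective h

/-- The image of a nonzero element under the coaction is not a zero divisor. The map
`r ⊗ h ↦ (id ⊗ S)(∂ r) * (1 ⊗ h)` is injective and takes `∂ r` to `r ⊗ 1`. -/
theorem coaction_mul_injective [IsDomain R] {r : R} (hr : r ≠ 0) {z : R ⊗[k] H}
    (hz : d.toAlgHom r * z = 0) : z = 0 := by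
  have h1 := congrArg (shear d (HopfAlgebra.antipodeAlgHom k H)) hz
  rw [map_mul, shear_antipode_apply, map_zero] at h1
  have h2 : r • shear d (HopfAlgebra.antipodeAlgHom k H) z = 0 := by
    rw [← h1, Algebra.smul_def]
    rfl
  have h3 := (smul_eq_zero_iff_right hr).1 h2
  exact shear_antipode_injective d (by rw [h3, map_zero])

variable (F : Type*) [Field F] [Algebra R F] [IsFractionRing R F] [Algebra k F]
  [IsScalarTower k R F]

theorem exists_smul_eq_mapH (z : F ⊗[k] H) : ∃ s : R, s ≠ 0 ∧ ∃ z' : R ⊗[k] H,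
    mapH H (IsScalarTower.toAlgHom k R F) z' = algebraMap R F s • z := by
  have : Nontrivial R := (algebraMap R F).domain_nontrivial
  have : IsDomain R := (IsFractionRing.injective R F).isDomain (algebraMap R F)
  induction z with
  | zero => exact ⟨1, one_ne_zero, 0, by simp⟩
  | tmul a h =>
    obtain ⟨⟨r, s⟩, hs⟩ := IsLocalization.surj (nonZeroDivisors R) a
    refine ⟨s, nonZeroDivisors.coe_ne_zero s, r ⊗ₜ h, ?_⟩
    simp only [Algebra.TensorProduct.map_tmul, IsScalarTower.coe_toAlgHom', AlgHom.id_apply,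
      TensorProduct.smul_tmul', smul_eq_mul]
    rw [← hs, mul_comm]
  | add x y hx hy =>
    obtain ⟨s, hs, x', hx⟩ := hx
    obtain ⟨t, ht, y', hy⟩ := hy
    refine ⟨s * t, mul_ne_zero hs ht, (t ⊗ₜ 1) * x' + (s ⊗ₜ 1) * y', ?_⟩
    have h1 : ∀ (c : F) (y : F ⊗[k] H), (c ⊗ₜ[k] (1 : H)) * y = c • y := fun c y =>
      (Algebra.smul_def c y).symm
    simp only [map_add, map_mul, hx, hy, Algebra.TensorProduct.map_tmul,
      IsScalarTower.coe_toAlgHom', AlgHom.id_apply, h1, smul_smul, smul_add]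
    rw [mul_comm (algebraMap R F t)]

/-- The image of a nonzero element under the coaction becomes invertible over the fraction field
`F`, since multiplication by it is an injective endomorphism of the finite-dimensional `F`-vector
space `F ⊗ H`. -/
theorem isUnit_mapH_coaction [Module.Finite k H] {r : R} (hr : r ≠ 0) :
    IsUnit (mapH H (IsScalarTower.toAlgHom k R F) (d.toAlgHom r)) := by
  have : Nontrivial R := (algebraMap R F).domain_nontrivial
  have : IsDomain R := (IsFractionRing.injective R F).isDomain (algebraMap R F)
  set y := mapH H (IsScalarTower.toAlgHom k R F) (d.toAlgHom r) with hy
  have hinj : Function.Injective (LinearMap.mulLeft F y) := by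
    rw [injective_iff_map_eq_zero]
    intro z hz
    obtain ⟨s, hs, z', hz'⟩ := exists_smul_eq_mapH (k := k) (H := H) (R := R) F z
    have hs' : algebraMap R F s ≠ 0 := by
      simpa using hs
    have h1 : mapH H (IsScalarTower.toAlgHom k R F) (d.toAlgHom r * z') = 0 := by
      rw [map_mul, hz', ← hy, mul_smul_comm]
      rw [LinearMap.mulLeft_apply] at hz
      rw [hz, smul_zero]
    have h2 : d.toAlgHom r * z' = 0 :=
      mapH_injective (f := IsScalarTower.toAlgHom k R F) (IsFractionRing.injective R F)
        (by rw [h1, map_zero])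
    have h3 := coaction_mul_injective d hr h2
    rw [h3, map_zero] at hz'
    exact (smul_eq_zero_iff_right hs').1 hz'.symm
  have hsurj := LinearMap.surjective_of_injective hinj
  obtain ⟨z, hz⟩ := hsurj 1
  exact IsUnit.of_mul_eq_one z hz

/-- The action on the fraction field of a `𝔤`-ring which is an integral domain. -/
def fractionAction [Module.Finite k H] [IsDomain R] : GAction k H F :=
  let D : F →ₐ[k] F ⊗[k] H := IsLocalization.liftAlgHom (M := nonZeroDivisors R)
    (f := (mapH H (IsScalarTower.toAlgHom k R F)).comp d.toAlgHom)
    (fun s => isUnit_mapH_coaction d F (nonZeroDivisors.coe_ne_zero s))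
  have hD : ∀ r : R, D (algebraMap R F r) =
      mapH H (IsScalarTower.toAlgHom k R F) (d.toAlgHom r) := fun r =>
    IsLocalization.lift_eq (M := nonZeroDivisors R) _ r
  have hDc : D.comp (IsScalarTower.toAlgHom k R F) =
      (mapH H (IsScalarTower.toAlgHom k R F)).comp d.toAlgHom := AlgHom.ext hD
  GAction.ofLaws D
    (by
      have h : ((counitH k H F).comp D : F →+* F) = AlgHom.id k F := by
        refine IsLocalization.ringHom_ext (nonZeroDivisors R) (RingHom.ext fun r => ?_)
        change counitH k H F (D (algebraMap R F r)) = algebraMap R F r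
        rw [hD, counitH_mapH, d.counitH_apply]
        rfl
      exact fun r => RingHom.congr_fun h r)
    (by
      have h : ((mapH H D).comp D : F →+* (F ⊗[k] H) ⊗[k] H) = (idComul k H F).comp D := by
        refine IsLocalization.ringHom_ext (nonZeroDivisors R) (RingHom.ext fun r => ?_)
        change mapH H D (D (algebraMap R F r)) = idComul k H F (D (algebraMap R F r))
        rw [hD, ← mapH_comp_apply, hDc, mapH_comp_apply, d.mapH_apply_apply, mapH_mapH_idComul]
      exact fun r => RingHom.congr_fun h r)

theorem isGHom_fractionAction [Module.Finite k H] [IsDomain R] :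
    IsGHom d (fractionAction d F) (IsScalarTower.toAlgHom k R F) :=
  AlgHom.ext fun r => IsLocalization.lift_eq (M := nonZeroDivisors R) _ r

end Fraction

end Polynomial

section Geometric

/-! ### The geometric axioms and polynomial conditions -/

variable {k : Type u} {H : Type v} [Field k] [CommRing H] [HopfAlgebra k H]

/-- A prime `𝔤`-ideal is the kernel of a morphism of `𝔤`-rings into a `𝔤`-field. -/
theorem exists_gField_of_isPrime [Module.Finite k H] {A : Type w} [CommRing A] [Algebra k A]
    (d : GAction k H A) (P : Ideal A) [P.IsPrime] (hP : IsGIdeal d P) :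
    ∃ (L : Type w) (_ : Field L) (_ : Algebra k L) (d' : GAction k H L) (π : A →ₐ[k] L),
      IsGHom d d' π ∧ RingHom.ker π = P := by
  refine ⟨FractionRing (A ⧸ P), inferInstance, inferInstance,
    fractionAction (quotientAction d P hP) (FractionRing (A ⧸ P)),
    (IsScalarTower.toAlgHom k (A ⧸ P) (FractionRing (A ⧸ P))).comp (Ideal.Quotient.mkₐ k P),
    (isGHom_fractionAction _ _).comp (isGHom_quotientMk d P hP), ?_⟩
  ext a
  rw [RingHom.mem_ker, AlgHom.comp_apply, IsScalarTower.coe_toAlgHom',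
    map_eq_zero_iff _ (IsFractionRing.injective (A ⧸ P) (FractionRing (A ⧸ P))),
    Ideal.Quotient.mkₐ_eq_mk, Ideal.Quotient.eq_zero_iff_mem]

/-- An element of `A ⊗ H` which vanishes under `f` has its coordinates in the kernel of `f`. -/
theorem mapH_eq_zero_of_ker_le {A S T : Type*} [CommRing A] [Algebra k A] [CommRing S]
    [Algebra k S] [CommRing T] [Algebra k T] {f : A →ₐ[k] S} {g : A →ₐ[k] T}
    (h : RingHom.ker f ≤ RingHom.ker g) {y : A ⊗[k] H} (hy : mapH H f y = 0) :
    mapH H g y = 0 := by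
  have h1 : mapH H (Ideal.Quotient.mkₐ k (RingHom.ker f)) y = 0 := by
    apply mapH_injective (f := Ideal.kerLiftAlg f) (Ideal.kerLiftAlg_injective f)
    rw [← mapH_comp_apply, map_zero, ← hy]
    congr 2
  have h2 : g = (Ideal.Quotient.liftₐ (RingHom.ker f) g h).comp
      (Ideal.Quotient.mkₐ k (RingHom.ker f)) := rfl
  rw [h2, mapH_comp_apply, h1, map_zero]

section

variable {ι : Type} [Fintype ι] (b : Module.Basis ι k H)

/-- Existential closedness of a `𝔤`-field `K` expressed by polynomials: for every tuple `x` in a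
`𝔤`-field extension and every finite set of polynomials over `K` there is a tuple `a` in `K` such
that the same polynomials of this set vanish at `∂(a)` and at `∂(x)`. -/
def PolyClosed {K : Type w} [Field K] [Algebra k K] (d : GAction k H K) : Prop :=
  ∀ (L : Type w) [Field L] [Algebra k L] (d' : GAction k H L) (φ : K →ₐ[k] L), IsGHom d d' φ →
    ∀ (n : ℕ) (x : Fin n → L) (S : Finset (MvPolynomial (Fin n × ι) K)),
      ∃ a : Fin n → K, ∀ p ∈ S, evalHom (AlgHom.id k K) (gPoint b d a) p = 0 ↔
        evalHom φ (gPoint b d' x) p = 0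

/-- The differential polynomial `x_i`, written in the variables `X_(i,j) = ∂_j(x_i)`. -/
def baseVar (K : Type*) [Field K] [Algebra k K] {σ : Type*} (i : σ) : MvPolynomial (σ × ι) K :=
  counitH k H _ ((coords b σ _).symm MvPolynomial.X i)

variable {K : Type w} [Field K] [Algebra k K] {d : GAction k H K}

theorem evalHom_gPoint_baseVar {L : Type*} [Field L] [Algebra k L] (d' : GAction k H L)
    (φ : K →ₐ[k] L) {σ : Type*} (x : σ → L) (i : σ) :
    evalHom φ (gPoint b d' x) (baseVar b K i) = x i := by
  rw [baseVar, ← counitH_mapH, mapH_evalHom_gen, coords_symm_gPoint, d'.counitH_apply]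

/-- A tuple is of the form `∂(x)` as soon as it comes from a morphism of `𝔤`-rings on `K{x}`. -/
theorem gPoint_eq_of_isGHom {L : Type*} [Field L] [Algebra k L] {d' : GAction k H L} {σ : Type*}
    {π : MvPolynomial (σ × ι) K →ₐ[k] L} (hπ : IsGHom (polyAction b d σ) d' π) :
    gPoint b d' (fun i => π (baseVar b K i)) = fun p => π (MvPolynomial.X p) := by
  apply (coords b σ L).symm.injective
  funext i
  rw [coords_symm_gPoint, baseVar, ← counitH_mapH, ← counitH_mapH, ← mapH_comp_apply, hπ,
    mapH_comp_apply, polyAction_toAlgHom, mapH_cHom_gen, mapH_mapH_idComul, counitH_idComul,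
    mapH_coords_symm]

/-- The ideal of `W` is a prime `𝔤`-ideal of `K{x}`, so that the generic point of `W` is of the form
`∂(x)` for a tuple `x` in a `𝔤`-field extension. The equations of `W` hold at `∂(a)` for some `a` in
`K`, and `a` lies in `V` because `∂(a)` lies in `∇(V)`. -/
theorem PolyClosed.geometricAxioms (h : PolyClosed b d) : GeometricAxioms b d := by
  have : Module.Finite k H := Module.Finite.of_basis b
  intro n _ V W hV hW hWV hcW
  have hWG : IsGIdeal (polyAction b d (Fin n)) W := by
    intro f hf
    set q := Ideal.Quotient.mkₐ k W
    set φ := q.comp (constHom k K (Fin n × ι))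
    have hq : q = evalHom φ (fun p => q (MvPolynomial.X p)) := eq_evalHom q
    have hx : (fun p => q (MvPolynomial.X p)) ∈ points W φ := by
      rw [mem_points_iff, ← hq]
      exact fun g hg => (RingHom.mem_ker).2 (Ideal.Quotient.eq_zero_iff_mem.2 hg)
    have h1 := hcW _ φ _ hx f hf
    change cHom b d φ _ f = 0 at h1
    rwa [← mapH_evalHom_comp_polyAction, ← hq] at h1
  obtain ⟨L, _, _, d', π, hπ, hker⟩ := exists_gField_of_isPrime _ W hWG
  have hφ : IsGHom d d' (π.comp (constHom k K (Fin n × ι))) := hπ.comp (isGHom_constHom b d)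
  obtain ⟨S, hS⟩ := (isNoetherianRing_iff_ideal_fg (MvPolynomial (Fin n × ι) K)).1 inferInstance W
  obtain ⟨a, ha⟩ := h L d' _ hφ n (fun i => π (baseVar b K i)) S
  have haW : gPoint b d a ∈ points W (AlgHom.id k K) := by
    rw [mem_points_iff, ← hS, Ideal.span_le]
    intro p hp
    refine (ha p hp).2 ?_
    rw [gPoint_eq_of_isGHom b hπ, ← eq_evalHom]
    have : p ∈ RingHom.ker π := hker ▸ hS ▸ Ideal.subset_span hp
    exact this
  refine ⟨a, fun f hf => ?_, haW⟩
  have h1 := hWV K (AlgHom.id k K) haW f hf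
  have h2 : (coords b (Fin n) K).symm (gPoint b d a) = fun i => d.toAlgHom (a i) :=
    funext (coords_symm_gPoint b d a)
  have h3 : twist d (AlgHom.id k K) = d.toAlgHom.comp (AlgHom.id k K) := by
    ext c
    simp [twist]
  rw [h2, h3] at h1
  change evalHom _ _ f = 0 at h1
  rw [← comp_evalHom] at h1
  have h4 := congrArg (counitH k H K) h1
  rwa [AlgHom.comp_apply, d.counitH_apply, map_zero] at h4

/-- The geometric axioms are applied to the locus `V` of `x` and the locus `W` of `∂(x)` over `K`,
after `x` has been extended by the inverse of the product of the nonzero values. -/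
theorem GeometricAxioms.polyClosed (h : GeometricAxioms b d) : PolyClosed b d := by
  classical
  intro L _ _ d' φ hφ n x S
  set e := evalHom φ (gPoint b d' x) with he
  set g : MvPolynomial (Fin n × ι) K := ∏ p ∈ S.filter (fun p => e p ≠ 0), p with hg
  have heg : e g ≠ 0 := by
    rw [hg, map_prod, Finset.prod_ne_zero_iff]
    exact fun p hp => (Finset.mem_filter.1 hp).2
  -- The additional coordinate turns the inequalities into an equation.
  set x' : Fin (n + 1) → L := Fin.snoc x (e g)⁻¹ with hx'
  set e' := evalHom φ (gPoint b d' x') with he'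
  set W := RingHom.ker e' with hW
  set V := RingHom.ker (evalHom φ x') with hV
  have hGe' : IsGHom (polyAction b d (Fin (n + 1))) d' e' := isGHom_evalHom_gPoint b d hφ x'
  let ρ : Fin n × ι → Fin (n + 1) × ι := Prod.map Fin.castSucc id
  have hρ : ∀ {M : Type w} [Field M] [Algebra k M] (dM : GAction k H M) (ψ : K →ₐ[k] M)
      (y : Fin (n + 1) → M) (p : MvPolynomial (Fin n × ι) K),
      evalHom ψ (gPoint b dM y) (MvPolynomial.rename ρ p) =
        evalHom ψ (gPoint b dM (fun i => y i.castSucc)) p := by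
    intro M _ _ dM ψ y p
    rw [evalHom_apply, evalHom_apply, MvPolynomial.eval₂_rename]
    rfl
  have hx'x : (fun i : Fin n => x' i.castSucc) = x := by
    funext i
    simp [hx']
  obtain ⟨a, -, haW⟩ := h (n + 1) n.succ_pos V W (RingHom.ker_isPrime _) (RingHom.ker_isPrime _)
    (by
      intro R _ _ ψ y hy f hf
      change evalHom (twist d ψ) _ f = 0
      set N : MvPolynomial (Fin (n + 1)) K →ₐ[k] MvPolynomial (Fin (n + 1) × ι) K ⊗[k] H :=
        evalHom (twist d (constHom k K _)) ((coords b _ _).symm MvPolynomial.X) with hN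
      have hnat : ∀ {T : Type w} [CommRing T] [Algebra k T] (χ : K →ₐ[k] T)
          (z : Fin (n + 1) × ι → T), mapH H (evalHom χ z) (N f) =
          evalHom (twist d χ) ((coords b _ _).symm z) f := by
        intro T _ _ χ z
        rw [hN, ← AlgHom.comp_apply, comp_evalHom]
        congr 2
        · refine AlgHom.ext fun c => ?_
          rw [AlgHom.comp_apply, mapH_twist]
          congr 2
          ext c
          simp
        · funext i
          rw [mapH_evalHom_gen]
      -- The condition is that the coordinates of `N f` vanish at `y`; they vanish at `∂(x)`.
      rw [← hnat]
      refine mapH_eq_zero_of_ker_le (f := e') (mem_points_iff.1 hy) ?_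
      have h2 : (coords b (Fin (n + 1)) L).symm (gPoint b d' x') =
          fun i => d'.toAlgHom (x' i) := funext (coords_symm_gPoint b d' x')
      rw [he', hnat, h2]
      have h3 : twist d φ = d'.toAlgHom.comp φ := hφ.symm
      rw [h3, ← comp_evalHom, AlgHom.comp_apply, (RingHom.mem_ker).1 hf, map_zero])
    (by
      intro R _ _ ψ y hy f hf
      change cHom b d ψ y f = 0
      rw [← mapH_evalHom_comp_polyAction]
      refine mapH_eq_zero_of_ker_le (f := e') (mem_points_iff.1 hy) ?_
      change mapH H e' ((polyAction b d _).toAlgHom f) = 0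
      rw [← hGe'.apply, (RingHom.mem_ker).1 hf, map_zero])
  rw [mem_points_iff] at haW
  refine ⟨fun i => a i.castSucc, fun p hp => ?_⟩
  constructor
  · contrapose
    intro hpe
    have h1 : baseVar b K (Fin.last n) * MvPolynomial.rename ρ g - 1 ∈ W := by
      rw [hW, RingHom.mem_ker, map_sub, map_mul, he', evalHom_gPoint_baseVar, hρ, hx'x, map_one,
        ← he, hx', Fin.snoc_last, inv_mul_cancel₀ heg, sub_self]
    have h2 := haW h1
    rw [RingHom.mem_ker, map_sub, map_mul, hρ, map_one, sub_eq_zero] at h2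
    have h3 := right_ne_zero_of_mul_eq_one h2
    rw [hg, map_prod, Finset.prod_ne_zero_iff] at h3
    exact h3 p (Finset.mem_filter.2 ⟨hp, hpe⟩)
  · intro hpe
    have h1 : MvPolynomial.rename ρ p ∈ W := by
      rw [hW, RingHom.mem_ker, he', hρ, hx'x, ← he, hpe]
    have h2 := haW h1
    rwa [RingHom.mem_ker, hρ] at h2

end

end Geometric

section Structures

/-! ### Quantifier-free formulas and polynomial conditions -/

open FirstOrder FirstOrder.Language

variable {k : Type u} {H : Type v} [Field k] [CommRing H] [HopfAlgebra k H]

section Operators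

variable {ι : Type*} [Fintype ι] (b : Module.Basis ι k H) {R S : Type*} [CommRing R] [Algebra k R]
  [CommRing S] [Algebra k S]

theorem IsGHom.gOperator_apply {d : GAction k H R} {d' : GAction k H S} {φ : R →ₐ[k] S}
    (h : IsGHom d d' φ) (j : ι) (r : R) :
    gOperator b d' j (φ r) = φ (gOperator b d j r) := by
  have h1 := coords_mapH b φ (fun _ : Unit => d.toAlgHom r) ((), j)
  rw [← h.apply] at h1
  exact h1

theorem isGHom_of_gOperator {d : GAction k H R} {d' : GAction k H S} {φ : R →ₐ[k] S}
    (h : ∀ j r, gOperator b d' j (φ r) = φ (gOperator b d j r)) : IsGHom d d' φ := by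
  refine AlgHom.ext fun r => ?_
  rw [AlgHom.comp_apply, AlgHom.comp_apply, ← sum_gOperator b d', ← sum_gOperator b d, map_sum]
  simp [h]

end Operators

variable {m : ℕ} {b : Module.Basis (Fin (m + 1)) k H}

theorem IsAdapted.gOperator_zero (hb : IsAdapted b) {R : Type*} [CommRing R] [Algebra k R]
    (d : GAction k H R) (r : R) : gOperator b d 0 r = r := by
  have h := d.counitH_apply r
  rw [← sum_gOperator b d, map_sum, Fin.sum_univ_succ] at h
  simpa [hb.1, hb.2] using h

section

variable (b) {α : Type*} {R S : Type*} [CommRing R] [Algebra k R] [CommRing S] [Algebra k S]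

/-- The value of a term in a `𝔤`-ring. -/
def termVal (d : GAction k H R) (t : (gLanguage k m).Term α) (v : α → R) : R :=
  @Term.realize _ R (gStructure b d) _ v t

/-- Satisfaction of a formula in a `𝔤`-ring. -/
def Sat (d : GAction k H R) (ψ : (gLanguage k m).Formula α) (v : α → R) : Prop :=
  @Formula.Realize _ R (gStructure b d) _ ψ v

/-- A morphism of `𝔤`-rings is a homomorphism of `L_𝔤`-structures. -/
def IsGHom.toHom {d : GAction k H R} {d' : GAction k H S} {φ : R →ₐ[k] S} (h : IsGHom d d' φ) :
    @Language.Hom (gLanguage k m) R S (gStructure b d) (gStructure b d') :=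
  letI := gStructure b d
  letI := gStructure b d'
  { toFun := φ
    map_fun' := by
      intro n f x
      cases f with
      | add => exact map_add φ _ _
      | mul => exact map_mul φ _ _
      | neg => exact map_neg φ _
      | zero => exact map_zero φ
      | one => exact map_one φ
      | op i => exact (h.gOperator_apply b i.succ (x 0)).symm
      | const a => exact φ.commutes a
    map_rel' := fun r => r.elim }

variable {b}

theorem IsGHom.termVal_comp {d : GAction k H R} {d' : GAction k H S} {φ : R →ₐ[k] S}
    (h : IsGHom d d' φ) (t : (gLanguage k m).Term α) (v : α → R) :
    termVal b d' t (φ ∘ v) = φ (termVal b d t v) :=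
  letI := gStructure b d
  letI := gStructure b d'
  HomClass.realize_term (h.toHom b)

/-- The truth of a quantifier-free formula at a tuple depends only on the vanishing at `∂(x)` of
finitely many polynomials, namely the differences of the two sides of its atomic subformulas,
evaluated in the `𝔤`-ring `K{x}`. -/
theorem exists_finset_sat_iff_of_isQF {K : Type*} [Field K] [Algebra k K] (d : GAction k H K) {n : ℕ}
    {ψ : (gLanguage k m).BoundedFormula (K ⊕ Fin n) 0} (hψ : ψ.IsQF) :
    ∃ S : Finset (MvPolynomial (Fin n × Fin (m + 1)) K),
      ∀ (R₁ : Type w) [Field R₁] [Algebra k R₁] (d₁ : GAction k H R₁) (φ₁ : K →ₐ[k] R₁)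
        (_ : IsGHom d d₁ φ₁) (x₁ : Fin n → R₁)
        (R₂ : Type w) [Field R₂] [Algebra k R₂] (d₂ : GAction k H R₂) (φ₂ : K →ₐ[k] R₂)
        (_ : IsGHom d d₂ φ₂) (x₂ : Fin n → R₂),
        (∀ p ∈ S, evalHom φ₁ (gPoint b d₁ x₁) p = 0 ↔ evalHom φ₂ (gPoint b d₂ x₂) p = 0) →
        (Sat b d₁ ψ (Sum.elim φ₁ x₁) ↔ Sat b d₂ ψ (Sum.elim φ₂ x₂)) := by
  classical
  induction hψ with
  | falsum => exact ⟨∅, fun _ _ _ _ _ _ _ _ _ _ _ _ _ _ _ => Iff.rfl⟩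
  | imp _ _ ih₁ ih₂ =>
    obtain ⟨S₁, h₁⟩ := ih₁
    obtain ⟨S₂, h₂⟩ := ih₂
    refine ⟨S₁ ∪ S₂, fun R₁ _ _ d₁ φ₁ hφ₁ x₁ R₂ _ _ d₂ φ₂ hφ₂ x₂ h => ?_⟩
    have i₁ := h₁ R₁ d₁ φ₁ hφ₁ x₁ R₂ d₂ φ₂ hφ₂ x₂
      (fun p hp => h p (Finset.mem_union_left _ hp))
    have i₂ := h₂ R₁ d₁ φ₁ hφ₁ x₁ R₂ d₂ φ₂ hφ₂ x₂
      (fun p hp => h p (Finset.mem_union_right _ hp))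
    exact imp_congr i₁ i₂
  | of_isAtomic hat =>
    cases hat with
    | rel R _ => exact R.elim
    | equal t₁ t₂ =>
      let D := polyAction b d (Fin n)
      let P : (K ⊕ Fin n) ⊕ Fin 0 → MvPolynomial (Fin n × Fin (m + 1)) K :=
        Sum.elim (Sum.elim MvPolynomial.C (fun i => baseVar b K i)) Fin.elim0
      refine ⟨{termVal b D t₁ P - termVal b D t₂ P}, ?_⟩
      have key : ∀ (R : Type w) [Field R] [Algebra k R] (d₁ : GAction k H R) (φ : K →ₐ[k] R)
          (_ : IsGHom d d₁ φ) (x : Fin n → R),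
          Sat b d₁ (t₁.bdEqual t₂) (Sum.elim φ x) ↔
          evalHom φ (gPoint b d₁ x) (termVal b D t₁ P - termVal b D t₂ P) = 0 := by
        intro R _ _ d₁ φ hφ x
        have hG := isGHom_evalHom_gPoint b d hφ x
        have hP : Sum.elim (Sum.elim φ x) default = evalHom φ (gPoint b d₁ x) ∘ P := by
          funext i
          rcases i with (c | i) | i
          · simp [P]
          · simp [P, evalHom_gPoint_baseVar]
          · exact i.elim0
        rw [map_sub, ← hG.termVal_comp, ← hG.termVal_comp, ← hP, sub_eq_zero]
        rfl
      intro R₁ _ _ d₁ φ₁ hφ₁ x₁ R₂ _ _ d₂ φ₂ hφ₂ x₂ h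
      rw [key R₁ d₁ φ₁ hφ₁ x₁, key R₂ d₂ φ₂ hφ₂ x₂]
      exact h _ (Finset.mem_singleton_self _)

end

/-- A polynomial in the variables `X_(i,j) = ∂_j(x_i)` is the value of a term. -/
theorem exists_term_eq (hb : IsAdapted b) {K : Type*} [Field K] [Algebra k K] {σ : Type*}
    (p : MvPolynomial (σ × Fin (m + 1)) K) :
    ∃ t : (gLanguage k m).Term (K ⊕ σ), ∀ (R : Type w) [Field R] [Algebra k R]
      (d' : GAction k H R) (φ : K →ₐ[k] R) (x : σ → R),
      termVal b d' t (Sum.elim φ x) = evalHom φ (gPoint b d' x) p := by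
  induction p using MvPolynomial.induction_on with
  | C c =>
    refine ⟨Term.var (Sum.inl c), fun R _ _ d' φ x => ?_⟩
    rw [evalHom_C]
    rfl
  | add p q hp hq =>
    obtain ⟨s, hs⟩ := hp
    obtain ⟨t, ht⟩ := hq
    refine ⟨Term.func (GFunc.add : (gLanguage k m).Functions 2) ![s, t],
      fun R _ _ d' φ x => ?_⟩
    rw [map_add, ← hs, ← ht]
    rfl
  | mul_X p i hp =>
    obtain ⟨s, hs⟩ := hp
    obtain ⟨i, j⟩ := i
    have : ∃ t : (gLanguage k m).Term (K ⊕ σ), ∀ (R : Type w) [Field R] [Algebra k R]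
        (d' : GAction k H R) (φ : K →ₐ[k] R) (x : σ → R),
        termVal b d' t (Sum.elim φ x) = gOperator b d' j (x i) := by
      rcases Fin.eq_zero_or_eq_succ j with rfl | ⟨j, rfl⟩
      · exact ⟨Term.var (Sum.inr i), fun R _ _ d' φ x => (hb.gOperator_zero d' (x i)).symm⟩
      · exact ⟨Term.func (GFunc.op j : (gLanguage k m).Functions 1) ![Term.var (Sum.inr i)],
          fun R _ _ d' φ x => rfl⟩
    obtain ⟨t, ht⟩ := this
    refine ⟨Term.func (GFunc.mul : (gLanguage k m).Functions 2) ![s, t],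
      fun R _ _ d' φ x => ?_⟩
    rw [map_mul, evalHom_X, gPoint_apply, ← hs, ← ht R d' φ x]
    rfl

/-- The vanishing pattern `χ` of the polynomials in the finite set `S` is expressed by a
quantifier-free formula. -/
theorem exists_formula_iff (hb : IsAdapted b) {K : Type*} [Field K] [Algebra k K] {σ : Type*}
    (S : Finset (MvPolynomial (σ × Fin (m + 1)) K))
    (χ : MvPolynomial (σ × Fin (m + 1)) K → Prop) :
    ∃ ψ : (gLanguage k m).Formula (K ⊕ σ), ψ.IsQF ∧ ∀ (R : Type w) [Field R] [Algebra k R]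
      (d' : GAction k H R) (φ : K →ₐ[k] R) (x : σ → R),
      Sat b d' ψ (Sum.elim φ x) ↔ ∀ p ∈ S, evalHom φ (gPoint b d' x) p = 0 ↔ χ p := by
  classical
  induction S using Finset.induction_on with
  | empty =>
    refine ⟨⊤, BoundedFormula.IsQF.top, fun R _ _ d' φ x => ?_⟩
    simp [Sat]
  | insert p S _ ih =>
    obtain ⟨ψ, hψ, h⟩ := ih
    obtain ⟨t, ht⟩ := exists_term_eq.{u, v, w} hb p
    let θ : (gLanguage k m).Formula (K ⊕ σ) :=
      t.equal (Term.func (GFunc.zero : (gLanguage k m).Functions 0) ![])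
    have hθ : θ.IsQF := (BoundedFormula.IsAtomic.equal _ _).isQF
    have hθ' : ∀ (R : Type w) [Field R] [Algebra k R]
        (d' : GAction k H R) (φ : K →ₐ[k] R) (x : σ → R),
        Sat b d' θ (Sum.elim φ x) ↔ evalHom φ (gPoint b d' x) p = 0 := by
      intro R _ _ d' φ x
      rw [← ht]
      let _ := gStructure b d'
      exact Formula.realize_equal
    by_cases hp : χ p
    · refine ⟨θ ⊓ ψ, hθ.inf hψ, fun R _ _ d' φ x => ?_⟩
      have : Sat b d' (θ ⊓ ψ) (Sum.elim φ x) ↔ Sat b d' θ (Sum.elim φ x) ∧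
          Sat b d' ψ (Sum.elim φ x) :=
        letI := gStructure b d'
        Formula.realize_inf
      rw [this, hθ', h]
      simp [hp]
    · refine ⟨θ.not ⊓ ψ, hθ.not.inf hψ, fun R _ _ d' φ x => ?_⟩
      have : Sat b d' (θ.not ⊓ ψ) (Sum.elim φ x) ↔ ¬ Sat b d' θ (Sum.elim φ x) ∧
          Sat b d' ψ (Sum.elim φ x) :=
        letI := gStructure b d'
        Formula.realize_inf
      rw [this, hθ', h]
      simp [hp]

theorem isGHom_id {R : Type*} [CommRing R] [Algebra k R] (d : GAction k H R) :
    IsGHom d d (AlgHom.id k R) := by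
  refine AlgHom.ext fun r => ?_
  change d.toAlgHom r = mapH H (AlgHom.id k R) (d.toAlgHom r)
  rw [mapH_id_apply]

theorem isExistentiallyClosed_iff_polyClosed (hb : IsAdapted b) {K : Type w} [Field K]
    [Algebra k K] (d : GAction k H K) : IsExistentiallyClosed b d ↔ PolyClosed b d := by
  constructor
  · intro h L _ _ d' φ hφ n x S
    obtain ⟨ψ, hψ, h'⟩ := exists_formula_iff.{u, v, w} hb S
      (fun p => evalHom φ (gPoint b d' x) p = 0)
    obtain ⟨a, ha⟩ := h L d' φ hφ n ψ hψ ⟨x, (h' L d' φ x).2 fun _ _ => Iff.rfl⟩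
    exact ⟨a, (h' K d (AlgHom.id k K) a).1 ha⟩
  · rintro h L _ _ d' φ hφ n ψ hψ ⟨x, hx⟩
    obtain ⟨S, hS⟩ := exists_finset_sat_iff_of_isQF (b := b) d hψ
    obtain ⟨a, ha⟩ := h L d' φ hφ n x S
    exact ⟨a, (hS K d (AlgHom.id k K) (isGHom_id d) a L d' φ hφ x ha).2 hx⟩

end Structures

section FieldTheory

/-! ### Points of separable extensions over fields with enough points on hypersurfaces -/

open MvPolynomial IntermediateField

section Generation

variable {F E : Type*} [Field F] [Field E] [Algebra F E]

/-- A finitely generated and separably generated extension `E` of `F` is the function field of a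
hypersurface. -/
theorem exists_hypersurface [Algebra.EssFiniteType F E] (s : Finset E)
    (hs : IsTranscendenceBasis F (Subtype.val : s → E))
    (hsep : Algebra.IsSeparable (adjoin F (s : Set E)) E) :
    ∃ (f : MvPolynomial (Option s) F) (z : Option s → E), f ≠ 0 ∧
      RingHom.ker (aeval z : MvPolynomial (Option s) F →ₐ[F] E) = Ideal.span {f} ∧
      adjoin F (Set.range z) = ⊤ := by
  have : Algebra.EssFiniteType (adjoin F (s : Set E)) E := Algebra.EssFiniteType.of_comp F _ E
  have : FiniteDimensional (adjoin F (s : Set E)) E :=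
    Algebra.finite_of_essFiniteType_of_isAlgebraic
  obtain ⟨θ, hθ⟩ := Field.exists_primitive_element (adjoin F (s : Set E)) E
  let _ : Algebra (MvPolynomial s F) E :=
    (aeval (Subtype.val : s → E) : MvPolynomial s F →ₐ[F] E).toAlgebra
  have hmap : ∀ q : MvPolynomial s F, algebraMap (MvPolynomial s F) E q = aeval Subtype.val q :=
    fun q => rfl
  have hinj : Function.Injective (algebraMap (MvPolynomial s F) E) := hs.1
  have : FaithfulSMul (MvPolynomial s F) E := (faithfulSMul_iff_algebraMap_injective _ _).2 hinj
  have halg : IsAlgebraic (MvPolynomial s F) θ := by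
    have h1 := hs.isAlgebraic.isAlgebraic θ
    exact IsAlgebraic.of_ringHom_of_comp_eq (f := hs.1.aevalEquiv) (g := RingHom.id E) h1
      hs.1.aevalEquiv.surjective Function.injective_id (RingHom.ext fun q => rfl)
  obtain ⟨y, hy, hint⟩ := halg.exists_integral_multiple
  -- An integral multiple of the primitive element: its minimal polynomial has coefficients in the
  -- polynomial ring and generates the ideal of relations.
  set θ' := y • θ with hθ'
  set z : Option s → E := fun o => o.elim θ' Subtype.val with hz
  have haev : ∀ q : MvPolynomial (Option s) F,
      aeval z q = Polynomial.aeval θ' (optionEquivLeft F s q) := by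
    intro q
    induction q using MvPolynomial.induction_on with
    | C c =>
      rw [aeval_C, optionEquivLeft_C, Polynomial.aeval_C, hmap, aeval_C]
    | add p q hp hq => rw [map_add, map_add, map_add, hp, hq]
    | mul_X p i hp =>
      rw [map_mul, map_mul, map_mul, hp, aeval_X]
      cases i with
      | none => rw [optionEquivLeft_X_none, Polynomial.aeval_X]; rfl
      | some i => rw [optionEquivLeft_X_some, Polynomial.aeval_C, hmap, aeval_X]; rfl
  refine ⟨(optionEquivLeft F s).symm (minpoly (MvPolynomial s F) θ'), z, ?_, ?_, ?_⟩
  · rw [Ne, EmbeddingLike.map_eq_zero_iff]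
    exact minpoly.ne_zero hint
  · ext q
    rw [RingHom.mem_ker, haev, minpoly.isIntegrallyClosed_dvd_iff hint, Ideal.mem_span_singleton,
      ← map_dvd_iff (optionEquivLeft F s).symm, AlgEquiv.symm_apply_apply]
  · have h1 : (s : Set E) ⊆ adjoin F (Set.range z) := fun t ht =>
      subset_adjoin _ _ ⟨some ⟨t, ht⟩, rfl⟩
    have h2 : θ' ∈ adjoin F (Set.range z) := subset_adjoin _ _ ⟨none, rfl⟩
    have h3 : algebraMap (MvPolynomial s F) E y ∈ adjoin F (Set.range z) := by
      rw [hmap]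
      have h5 : aeval Subtype.val y ∈ Algebra.adjoin F (Set.range (Subtype.val : s → E)) := by
        rw [Algebra.adjoin_range_eq_range_aeval]
        exact ⟨y, rfl⟩
      refine Algebra.adjoin_le (S := (adjoin F (Set.range z)).toSubalgebra) ?_ h5
      rintro _ ⟨i, rfl⟩
      exact h1 i.2
    have h4 : θ ∈ adjoin F (Set.range z) := by
      have : θ = θ' / algebraMap (MvPolynomial s F) E y := by
        rw [hθ', Algebra.smul_def, mul_div_cancel_left₀]
        rwa [Ne, map_eq_zero_iff _ hinj]
      rw [this]
      exact div_mem h2 h3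
    have h5 : (⊤ : IntermediateField F E) ≤ adjoin F ((s : Set E) ∪ {θ}) := by
      rw [← adjoin_adjoin_left, hθ, restrictScalars_top]
    refine top_le_iff.1 (h5.trans (adjoin_le_iff.2 (Set.union_subset h1 ?_)))
    exact Set.singleton_subset_iff.2 h4

end Generation

section Disjoint

variable {F E K L : Type*} [Field F] [Field E] [Field K] [Field L] [Algebra F E] [Algebra F K]
  [Algebra F L] [Algebra E L] [Algebra K L] [IsScalarTower F E L] [IsScalarTower F K L]
  {ι : Type*} [Fintype ι] (u : Module.Basis ι F K)

/-- If some basis of `K` over `F` is linearly independent over `E`, then all families in `E` which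
are linearly independent over `F` are linearly independent over `K`. -/
theorem linearIndependent_of_basis (hu : LinearIndependent E (fun i => algebraMap K L (u i)))
    {κ : Type*} {y : κ → E} (hy : LinearIndependent F y) :
    LinearIndependent K (fun i => algebraMap E L (y i)) := by
  rw [linearIndependent_iff'] at hy ⊢
  intro s g hg i hi
  rw [Fintype.linearIndependent_iff] at hu
  have h1 : ∑ j, (∑ i ∈ s, u.repr (g i) j • y i) • algebraMap K L (u j) = 0 := by
    rw [← hg]
    simp_rw [Finset.sum_smul]
    rw [Finset.sum_comm]
    refine Finset.sum_congr rfl fun i _ => ?_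
    conv_rhs => rw [← u.sum_repr (g i)]
    rw [Finset.sum_smul]
    refine Finset.sum_congr rfl fun j _ => ?_
    simp only [Algebra.smul_def, map_mul, ← IsScalarTower.algebraMap_apply]
    ring
  have h2 := hu _ h1
  apply u.repr.injective
  ext j
  rw [hy s _ (h2 j) i hi]
  simp

/-- A polynomial over `K` is a combination of basis elements of `K` with polynomials over `F` as
coefficients. -/
theorem exists_eq_sum_basis {σ : Type*} (q : MvPolynomial σ K) :
    ∃ Q : ι → MvPolynomial σ F, q = ∑ i, MvPolynomial.C (u i) * map (algebraMap F K) (Q i) := by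
  induction q using MvPolynomial.induction_on' with
  | monomial e c =>
    refine ⟨fun i => monomial e (u.repr c i), ?_⟩
    conv_lhs => rw [← u.sum_repr c]
    simp [C_mul_monomial, Algebra.smul_def, mul_comm (u _)]
  | add p q hp hq =>
    obtain ⟨P, hP⟩ := hp
    obtain ⟨Q, hQ⟩ := hq
    refine ⟨fun i => P i + Q i, ?_⟩
    simp only [map_add, mul_add, Finset.sum_add_distrib, ← hP, ← hQ]

theorem aeval_map_eq {σ : Type*} (z : σ → E) (q : MvPolynomial σ F) :
    aeval (fun i => algebraMap E L (z i)) (map (algebraMap F K) q) =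
      algebraMap E L (aeval z q) := by
  rw [aeval_map_algebraMap]
  exact (MvPolynomial.aeval_algebraMap_apply (B := L) z q)

/-- The ideal of a point over `K` is generated by its ideal over `F`. -/
theorem ker_aeval_eq_span (hu : LinearIndependent E (fun i => algebraMap K L (u i)))
    {σ : Type*} {z : σ → E} {f : MvPolynomial σ F}
    (hf : RingHom.ker (aeval z : MvPolynomial σ F →ₐ[F] E) = Ideal.span {f}) :
    RingHom.ker (aeval (fun i => algebraMap E L (z i)) : MvPolynomial σ K →ₐ[K] L) =
      Ideal.span {map (algebraMap F K) f} := by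
  apply le_antisymm
  · intro q hq
    obtain ⟨Q, rfl⟩ := exists_eq_sum_basis u q
    rw [RingHom.mem_ker, map_sum] at hq
    have h1 : ∑ i, (aeval z (Q i) : E) • algebraMap K L (u i) = 0 := by
      rw [← hq]
      refine Finset.sum_congr rfl fun i _ => ?_
      rw [map_mul, aeval_C, aeval_map_eq, Algebra.smul_def, mul_comm]
    have h2 := Fintype.linearIndependent_iff.1 hu _ h1
    refine Ideal.sum_mem _ fun i _ => Ideal.mul_mem_left _ _ ?_
    have h3 : Q i ∈ Ideal.span {f} := by
      rw [← hf]
      exact h2 i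
    rw [Ideal.mem_span_singleton] at h3 ⊢
    exact map_dvd (map (algebraMap F K)) h3
  · rw [Ideal.span_singleton_le_iff_mem, RingHom.mem_ker, aeval_map_eq]
    have : f ∈ RingHom.ker (aeval z : MvPolynomial σ F →ₐ[F] E) := by
      rw [hf]
      exact Ideal.mem_span_singleton_self f
    rw [(RingHom.mem_ker).1 this, map_zero]

/-- The generator of the ideal of a point over `F` remains irreducible over `K`, since it generates
the ideal of the same point over `K`. -/
theorem irreducible_map_of_ker_eq_span (hu : LinearIndependent E (fun i => algebraMap K L (u i)))
    {σ : Type*} {z : σ → E} {f : MvPolynomial σ F} (hf0 : f ≠ 0)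
    (hf : RingHom.ker (aeval z : MvPolynomial σ F →ₐ[F] E) = Ideal.span {f}) :
    Irreducible (map (algebraMap F K) f) := by
  have h0 : map (algebraMap F K) f ≠ 0 := by
    rwa [Ne, map_eq_zero_iff _ (map_injective _ (algebraMap F K).injective)]
  have h1 := ker_aeval_eq_span u hu hf
  refine ((Ideal.span_singleton_prime h0).1 ?_).irreducible
  rw [← h1]
  exact RingHom.ker_isPrime _

end Disjoint

section Points

/-- Every hypersurface over `F` which is irreducible over `K` has a point over `F` outside of any
given hypersurface over `F` which does not contain it over `K`. -/
def HasHypersurfacePoints (F K : Type*) [Field F] [Field K] [Algebra F K] : Prop :=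
  ∀ (n : ℕ) (f g : MvPolynomial (Fin n) F), Irreducible (map (algebraMap F K) f) →
    ¬ map (algebraMap F K) f ∣ map (algebraMap F K) g →
    ∃ c : Fin n → F, eval c f = 0 ∧ eval c g ≠ 0

variable {F K : Type*} [Field F] [Field K] [Algebra F K]

theorem HasHypersurfacePoints.of_finite (h : HasHypersurfacePoints F K) {σ : Type*} [Finite σ]
    (f g : MvPolynomial σ F) (hf : Irreducible (map (algebraMap F K) f))
    (hg : ¬ map (algebraMap F K) f ∣ map (algebraMap F K) g) :
    ∃ c : σ → F, eval c f = 0 ∧ eval c g ≠ 0 := by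
  obtain ⟨n, ⟨e⟩⟩ := Finite.exists_equiv_fin σ
  have hr : ∀ p : MvPolynomial σ F, map (algebraMap F K) (rename e p) =
      renameEquiv K e (map (algebraMap F K) p) := fun p => (map_rename _ _ _)
  obtain ⟨c, hc⟩ := h n (rename e f) (rename e g)
    (by rw [hr, MulEquiv.irreducible_iff]; exact hf) (by rw [hr, hr, map_dvd_iff]; exact hg)
  rw [eval_rename, eval_rename] at hc
  exact ⟨c ∘ e, hc⟩

/-- The elements of `F` are `p`-th powers in `K`, since otherwise `X ^ p - a` is irreducible
over `K` but has no zero in `F`. -/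
theorem HasHypersurfacePoints.exists_pow_eq (h : HasHypersurfacePoints F K) {p : ℕ}
    (hp : p.Prime) (a : F) : ∃ c : K, c ^ p = algebraMap F K a := by
  by_contra! hne
  have hirr := X_pow_sub_C_irreducible_of_prime hp hne
  set f : MvPolynomial Unit F := X () ^ p - MvPolynomial.C a
  have hf : map (algebraMap F K) f =
      (uniqueAlgEquiv K Unit).symm (Polynomial.X ^ p - Polynomial.C (algebraMap F K a)) := by
    rw [AlgEquiv.eq_symm_apply]
    simp [f]
  have hfi : Irreducible (map (algebraMap F K) f) := by
    rw [hf, MulEquiv.irreducible_iff]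
    exact hirr
  obtain ⟨c, hc, -⟩ := h.of_finite f 1 hfi (by
    rw [map_one]
    exact fun hd => hfi.not_isUnit (isUnit_of_dvd_one hd))
  apply hne (algebraMap F K (c ()))
  rw [← map_pow]
  congr 1
  simpa [f, sub_eq_zero] using hc

variable {E L : Type*} [Field E] [Field L] [Algebra F E]
  [Algebra F L] [Algebra E L] [Algebra K L] [IsScalarTower F E L] [IsScalarTower F K L]
  {ι : Type*} [Fintype ι] (u : Module.Basis ι F K)

/-- The extension `E` of `F` is separably generated. By MacLane's criterion it is enough that the
`p`-th powers of elements of `E` which are linearly independent over `F` are linearly independent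
over `F`. Coefficients from `F` are `p`-th powers in `K`, and over `K` the given elements are still
linearly independent. -/
theorem HasHypersurfacePoints.exists_separating (h : HasHypersurfacePoints F K)
    (hu : LinearIndependent E (fun i => algebraMap K L (u i)))
    [Algebra.EssFiniteType F E] :
    ∃ s : Finset E, IsTranscendenceBasis F (Subtype.val : s → E) ∧
      Algebra.IsSeparable (adjoin F (s : Set E)) E := by
  obtain _ | ⟨p, hp, hpC⟩ := CharP.exists' F
  · exact exists_isTranscendenceBasis_and_isSeparable_of_perfectField F E
  have : CharP L p := charP_of_injective_algebraMap (algebraMap F L).injective p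
  have : CharP E p := charP_of_injective_algebraMap (algebraMap F E).injective p
  have : ExpChar L p := .prime hp.out
  have : ExpChar E p := .prime hp.out
  refine exists_isTranscendenceBasis_and_isSeparable_of_linearIndepOn_pow_of_essFiniteType
    p hp.out fun s hs => ?_
  have hs' := linearIndependent_of_basis u hu hs
  rw [LinearIndepOn, linearIndependent_iff'] at *
  intro t g hg i hi
  choose r hr using fun i => h.exists_pow_eq hp.out (g i)
  have h1 : (∑ i ∈ t, r i • algebraMap E L (i : E)) ^ p = 0 := by
    rw [← map_zero (algebraMap E L), ← hg, sum_pow_char, map_sum]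
    refine Finset.sum_congr rfl fun i _ => ?_
    rw [Algebra.smul_def, Algebra.smul_def, mul_pow, ← map_pow, hr, map_mul, map_pow,
      ← IsScalarTower.algebraMap_apply, ← IsScalarTower.algebraMap_apply]
  have h2 := hs' t r (pow_eq_zero_iff hp.out.ne_zero |>.1 h1) i hi
  have h3 := hr i
  rw [h2, zero_pow hp.out.ne_zero] at h3
  exact (map_eq_zero_iff _ (algebraMap F K).injective).1 h3.symm

/-- Substituting fractions into a polynomial gives a fraction. -/
theorem exists_subst_fractions {F : Type w} [Field F] {N σ : Type*} (r q : N → MvPolynomial σ F)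
    (Q : MvPolynomial N F) :
    ∃ P U : MvPolynomial σ F, ∀ (M : Type w) [Field M] [Algebra F M] (z : σ → M),
      (∀ i, aeval z (q i) ≠ 0) → aeval z U ≠ 0 ∧
        aeval (fun i => aeval z (r i) / aeval z (q i)) Q = aeval z P / aeval z U := by
  induction Q using MvPolynomial.induction_on with
  | C c => exact ⟨MvPolynomial.C c, 1, fun M _ _ z _ => by simp⟩
  | add Q₁ Q₂ h₁ h₂ =>
    obtain ⟨P₁, U₁, h₁⟩ := h₁
    obtain ⟨P₂, U₂, h₂⟩ := h₂
    refine ⟨P₁ * U₂ + U₁ * P₂, U₁ * U₂, fun M _ _ z hz => ?_⟩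
    obtain ⟨h₁, e₁⟩ := h₁ M z hz
    obtain ⟨h₂, e₂⟩ := h₂ M z hz
    refine ⟨by rw [map_mul]; exact mul_ne_zero h₁ h₂, ?_⟩
    rw [map_add, e₁, e₂, map_add, map_mul, map_mul, map_mul, div_add_div _ _ h₁ h₂]
  | mul_X Q i h =>
    obtain ⟨P, U, h⟩ := h
    refine ⟨P * r i, U * q i, fun M _ _ z hz => ?_⟩
    obtain ⟨h, e⟩ := h M z hz
    refine ⟨by rw [map_mul]; exact mul_ne_zero h (hz i), ?_⟩
    rw [map_mul, e, aeval_X, map_mul, map_mul, div_mul_div_comm]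

/-- A finitely generated extension of `F` which is linearly disjoint from `K` is the function field
of a hypersurface over `F` whose equation is irreducible over `K`. The given tuple `x` consists of
rational functions on this hypersurface, and these are evaluated at a suitable point. -/
theorem HasHypersurfacePoints.exists_point_of_essFiniteType {F K E L : Type w} [Field F] [Field K]
    [Algebra F K] (h : HasHypersurfacePoints F K) [Field E] [Field L] [Algebra F E] [Algebra F L]
    [Algebra E L] [Algebra K L] [IsScalarTower F E L] [IsScalarTower F K L] {ι : Type*} [Fintype ι]
    (u : Module.Basis ι F K) (hu : LinearIndependent E (fun i => algebraMap K L (u i)))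
    [Algebra.EssFiniteType F E] {N : Type*} [Finite N] (x : N → E)
    (S : Finset (MvPolynomial N F)) :
    ∃ c : N → F, ∀ Q ∈ S, eval c Q = 0 ↔ aeval x Q = 0 := by
  classical
  have := Fintype.ofFinite N
  obtain ⟨s, hs, hsep⟩ := h.exists_separating u hu
  obtain ⟨f, z, hf0, hf, hz⟩ := exists_hypersurface s hs hsep
  have hfirr := irreducible_map_of_ker_eq_span u hu hf0 hf
  have hfr : ∀ i, ∃ r q : MvPolynomial (Option s) F, aeval z q ≠ 0 ∧
      x i = aeval z r / aeval z q := by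
    intro i
    obtain ⟨r, q, hrq⟩ := (mem_adjoin_range_iff F z (x i)).1 (hz ▸ mem_top)
    -- With denominator zero the quotient is zero by convention, and is replaced by `0 / 1`.
    by_cases hq : aeval z q = 0
    · exact ⟨0, 1, by simp, by simp [hrq, hq]⟩
    · exact ⟨r, q, hq, hrq⟩
  choose r q hq hx using hfr
  choose P U hPU using fun Q => exists_subst_fractions r q Q
  have hxQ : ∀ Q, aeval x Q = aeval z (P Q) / aeval z (U Q) := fun Q => by
    rw [← (hPU Q E z hq).2]
    congr 2
    exact funext hx
  -- The denominators and the inequalities have to hold at the point.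
  set g : MvPolynomial (Option s) F :=
    (∏ i, q i) * ∏ Q ∈ S.filter (fun Q => aeval x Q ≠ 0), P Q with hg
  have hgz : aeval z g ≠ 0 := by
    rw [hg, map_mul, map_prod, map_prod]
    refine mul_ne_zero (Finset.prod_ne_zero_iff.2 fun i _ => hq i)
      (Finset.prod_ne_zero_iff.2 fun Q hQ => ?_)
    have h1 := (Finset.mem_filter.1 hQ).2
    rw [hxQ] at h1
    exact (div_ne_zero_iff.1 h1).1
  have hker : ∀ p, aeval z p = 0 ↔ f ∣ p := fun p => by
    rw [← Ideal.mem_span_singleton, ← hf, RingHom.mem_ker]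
  obtain ⟨c, hcf, hcg⟩ := h.of_finite f g hfirr (by
    intro hdvd
    have h1 : map (algebraMap F K) g ∈ Ideal.span {map (algebraMap F K) f} :=
      Ideal.mem_span_singleton.2 hdvd
    rw [← ker_aeval_eq_span u hu hf, RingHom.mem_ker, aeval_map_eq,
      map_eq_zero_iff _ (algebraMap E L).injective] at h1
    exact hgz h1)
  rw [hg, map_mul, map_prod, map_prod] at hcg
  have hcq : ∀ i, aeval c (q i) ≠ 0 := fun i =>
    Finset.prod_ne_zero_iff.1 (left_ne_zero_of_mul hcg) i (Finset.mem_univ i)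
  refine ⟨fun i => aeval c (r i) / aeval c (q i), fun Q hQ => ?_⟩
  obtain ⟨hU, e⟩ := hPU Q F c hcq
  obtain ⟨hUz, -⟩ := hPU Q E z hq
  change aeval _ Q = 0 ↔ _
  rw [e, hxQ, div_eq_zero_iff, div_eq_zero_iff, or_iff_left hU, or_iff_left hUz]
  constructor
  · contrapose
    intro hPz
    refine Finset.prod_ne_zero_iff.1 (right_ne_zero_of_mul hcg) Q (Finset.mem_filter.2 ⟨hQ, ?_⟩)
    rw [hxQ]
    exact div_ne_zero hPz hUz
  · intro hPz
    obtain ⟨p, hp⟩ := (hker _).1 hPz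
    change eval c (P Q) = 0
    rw [hp, map_mul, hcf, zero_mul]

/-- If `F` has enough points on hypersurfaces then all tuples in `E` can be specialized to `F`. -/
theorem HasHypersurfacePoints.exists_point {F K E L : Type w} [Field F] [Field K]
    [Algebra F K] (h : HasHypersurfacePoints F K) [Field E] [Field L] [Algebra F E] [Algebra F L]
    [Algebra E L] [Algebra K L] [IsScalarTower F E L] [IsScalarTower F K L] {ι : Type*} [Fintype ι]
    (u : Module.Basis ι F K) (hu : LinearIndependent E (fun i => algebraMap K L (u i)))
    {N : Type*} [Finite N] (x : N → E) (S : Finset (MvPolynomial N F)) :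
    ∃ c : N → F, ∀ Q ∈ S, eval c Q = 0 ↔ aeval x Q = 0 := by
  set E₀ := adjoin F (Set.range x)
  have : Algebra.EssFiniteType F E₀ :=
    essFiniteType_iff.2 (fg_adjoin_of_finite (Set.finite_range x))
  have hu₀ : LinearIndependent E₀ (fun i => algebraMap K L (u i)) :=
    hu.restrict_scalars (R := E₀) (fun a b hab => by
      simpa [Algebra.smul_def] using hab)
  obtain ⟨c, hc⟩ := h.exists_point_of_essFiniteType u hu₀
    (fun i => (⟨x i, subset_adjoin _ _ ⟨i, rfl⟩⟩ : E₀)) S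
  refine ⟨c, fun Q hQ => (hc Q hQ).trans ?_⟩
  rw [← map_eq_zero_iff (algebraMap E₀ E) (algebraMap E₀ E).injective,
    ← aeval_algebraMap_apply]
  rfl

end Points

end FieldTheory

section Constants

/-! ### Constants -/

variable {k : Type u} {H : Type v} [Field k] [CommRing H] [HopfAlgebra k H]

section Ring

variable {R S : Type*} [CommRing R] [Algebra k R] [CommRing S] [Algebra k S]

/-- The constants of a `𝔤`-ring are the elements `r` with `∂(r) = r ⊗ 1`. -/
def IsConst (d : GAction k H R) (r : R) : Prop := d.toAlgHom r = r ⊗ₜ 1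

theorem IsConst.map {d : GAction k H R} {d' : GAction k H S} {φ : R →ₐ[k] S}
    (hφ : IsGHom d d' φ) {r : R} (hr : IsConst d r) : IsConst d' (φ r) := by
  rw [IsConst, hφ.apply, hr]
  simp

theorem isConst_iff {ι : Type*} [Fintype ι] (b : Module.Basis ι k H) (d : GAction k H R) (r : R) :
    IsConst d r ↔ ∀ j, gOperator b d j r = b.repr 1 j • r := by
  rw [IsConst, tmul_eq_sum_basis b, ← sum_gOperator b d r]
  exact ⟨fun h j => eq_of_sum_tmul_basis_eq b h j, fun h => by simp [h]⟩

theorem IsConst.gOperator_mul {ι : Type*} [Fintype ι] (b : Module.Basis ι k H)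
    {d : GAction k H R} {c : R} (hc : IsConst d c) (j : ι) (r : R) :
    gOperator b d j (c * r) = c * gOperator b d j r := by
  have h : d.toAlgHom (c * r) = c • d.toAlgHom r := by
    rw [map_mul, hc]
    exact (Algebra.smul_def c _).symm
  rw [gOperator, h, map_smul]
  rfl

theorem gOperator_sum {ι : Type*} [Fintype ι] (b : Module.Basis ι k H)
    (d : GAction k H R) {κ : Type*} (s : Finset κ) (r : κ → R) (j : ι) :
    gOperator b d j (∑ i ∈ s, r i) = ∑ i ∈ s, gOperator b d j (r i) := by
  rw [gOperator, map_sum, map_sum, Finsupp.finsetSum_apply]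
  rfl

end Ring

variable {K : Type*} [Field K] [Algebra k K]

/-- The field of constants of a `𝔤`-field. -/
def constants (d : GAction k H K) : Subfield K where
  carrier := {r | IsConst d r}
  mul_mem' {r s} hr hs := by
    change d.toAlgHom (r * s) = _
    rw [map_mul, hr, hs]
    simp
  one_mem' := by
    change d.toAlgHom 1 = _
    rw [map_one, Algebra.TensorProduct.one_def]
  add_mem' {r s} hr hs := by
    change d.toAlgHom (r + s) = _
    rw [map_add, hr, hs, TensorProduct.add_tmul]
  zero_mem' := by
    change d.toAlgHom 0 = _
    rw [map_zero, TensorProduct.zero_tmul]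
  neg_mem' {r} hr := by
    change d.toAlgHom (-r) = _
    rw [map_neg, hr, TensorProduct.neg_tmul]
  inv_mem' r hr := by
    change d.toAlgHom r⁻¹ = _
    by_cases h0 : r = 0
    · rw [h0, inv_zero, map_zero, TensorProduct.zero_tmul]
    · have h1 : d.toAlgHom r⁻¹ * (r ⊗ₜ 1) = 1 := by
        rw [← (show d.toAlgHom r = r ⊗ₜ 1 from hr), ← map_mul, inv_mul_cancel₀ h0, map_one]
      have h2 : (r ⊗ₜ[k] (1 : H)) * (r⁻¹ ⊗ₜ[k] (1 : H)) = 1 := by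
        simp [mul_inv_cancel₀ h0, Algebra.TensorProduct.one_def]
      calc d.toAlgHom r⁻¹ = d.toAlgHom r⁻¹ * ((r ⊗ₜ 1) * (r⁻¹ ⊗ₜ 1)) := by rw [h2, mul_one]
        _ = r⁻¹ ⊗ₜ 1 := by rw [← mul_assoc, h1, one_mul]

section Basis

variable {ι : Type*} [Fintype ι] [DecidableEq ι] (b : Module.Basis ι k H) (d : GAction k H K)

/-- The matrix of the elements `∂_j(a_i)`. -/
def opMatrix (a : ι → K) : Matrix ι ι K := Matrix.of fun i j => gOperator b d j (a i)

theorem opMatrix_map {L : Type*} [Field L] [Algebra k L] {d' : GAction k H L} {φ : K →ₐ[k] L}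
    (hφ : IsGHom d d' φ) (a : ι → K) :
    (opMatrix b d' fun i => φ (a i)).det = φ (opMatrix b d a).det := by
  rw [AlgHom.map_det]
  congr 1
  ext i j
  exact hφ.gOperator_apply b j (a i)

variable {b d} {a : ι → K}

/-- If the matrix of the elements `∂_j(a_i)` is invertible then every element is a linear
combination of the `a_i` with constant coefficients. The coefficients are determined by
`∂(y) = ∑ i, c_i ∂(a_i)`, and comparison of `(∂ ⊗ id) ∘ ∂` with `(id ⊗ μ) ∘ ∂` shows that they are
constant. -/
theorem exists_eq_sum_const (ha : (opMatrix b d a).det ≠ 0) (y : K) :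
    ∃ c : ι → K, (∀ i, IsConst d (c i)) ∧ y = ∑ i, c i * a i := by
  set M := opMatrix b d a with hM
  have hMu : IsUnit M.det := isUnit_iff_ne_zero.2 ha
  set c : ι → K := Matrix.vecMul (fun j => gOperator b d j y) M⁻¹ with hc
  have hcM : Matrix.vecMul c M = fun j => gOperator b d j y := by
    rw [hc, Matrix.vecMul_vecMul, Matrix.nonsing_inv_mul _ hMu, Matrix.vecMul_one]
  have hdy : d.toAlgHom y = ∑ i, (c i ⊗ₜ 1) * d.toAlgHom (a i) := by
    rw [← sum_gOperator b d y]
    simp_rw [← congrFun hcM, ← sum_gOperator b d (a _), Finset.mul_sum]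
    rw [Finset.sum_comm]
    refine Finset.sum_congr rfl fun j _ => ?_
    simp [Matrix.vecMul, dotProduct, TensorProduct.sum_tmul, hM, opMatrix]
  refine ⟨c, ?_, ?_⟩
  · set N : Matrix ι ι (K ⊗[k] H) := M.map d.toAlgHom with hN
    have hNu : IsUnit N.det := by
      have : N.det = d.toAlgHom M.det := (AlgHom.map_det d.toAlgHom M).symm
      rw [this]
      exact hMu.map d.toAlgHom
    have h1 : Matrix.vecMul (fun i => d.toAlgHom (c i)) N =
        fun j => d.toAlgHom (gOperator b d j y) := by
      funext j
      rw [← congrFun hcM j]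
      simp [Matrix.vecMul, dotProduct, hN]
    have hexp : ∀ r : K, mapH H d.toAlgHom (d.toAlgHom r) =
        ∑ j, d.toAlgHom (gOperator b d j r) ⊗ₜ[k] b j := fun r => by
      conv_lhs => rw [← sum_gOperator b d r]
      simp
    have h2 : Matrix.vecMul (fun i => c i ⊗ₜ[k] (1 : H)) N =
        fun j => d.toAlgHom (gOperator b d j y) := by
      have h3 : mapH H d.toAlgHom (d.toAlgHom y) =
          ∑ i, ((c i ⊗ₜ 1) ⊗ₜ 1) * mapH H d.toAlgHom (d.toAlgHom (a i)) := by
        simp_rw [d.mapH_apply_apply]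
        rw [hdy, map_sum]
        refine Finset.sum_congr rfl fun i _ => ?_
        rw [map_mul, idComul_tmul]
        simp [Algebra.TensorProduct.one_def]
      have h4 : ∑ j, Matrix.vecMul (fun i => c i ⊗ₜ[k] (1 : H)) N j ⊗ₜ[k] b j =
          ∑ j, d.toAlgHom (gOperator b d j y) ⊗ₜ[k] b j := by
        rw [← hexp, h3]
        simp_rw [hexp, Finset.mul_sum]
        rw [Finset.sum_comm]
        refine Finset.sum_congr rfl fun j _ => ?_
        simp [Matrix.vecMul, dotProduct, TensorProduct.sum_tmul, hN, hM, opMatrix]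
      funext j
      exact eq_of_sum_tmul_basis_eq b h4 j
    have h5 := congrArg (fun v => Matrix.vecMul v N⁻¹) (h1.trans h2.symm)
    simp only [Matrix.vecMul_vecMul, Matrix.mul_nonsing_inv _ hNu, Matrix.vecMul_one] at h5
    exact congrFun h5
  · have h1 := congrArg (counitH k H K) hdy
    rw [d.counitH_apply, map_sum] at h1
    rw [h1]
    refine Finset.sum_congr rfl fun i _ => ?_
    rw [map_mul, d.counitH_apply]
    simp

theorem eq_zero_of_sum_const_eq_zero (ha : (opMatrix b d a).det ≠ 0) {c : ι → K}
    (hc : ∀ i, IsConst d (c i)) (h : ∑ i, c i * a i = 0) : c = 0 := by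
  refine Matrix.eq_zero_of_vecMul_eq_zero ha (funext fun j => ?_)
  have h1 := congrArg (gOperator b d j) h
  rw [gOperator_sum] at h1
  have h2 : gOperator b d j 0 = 0 := by simp [gOperator]
  rw [h2] at h1
  simp_rw [(hc _).gOperator_mul b] at h1
  exact h1

/-- A basis of a `𝔤`-field over its constants. -/
def constBasis (ha : (opMatrix b d a).det ≠ 0) : Module.Basis ι (constants d) K :=
  Module.Basis.mk (v := a)
    (Fintype.linearIndependent_iff.2 fun c hc => by
      have := eq_zero_of_sum_const_eq_zero ha (c := fun i => c i) (fun i => (c i).2) hc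
      exact fun i => Subtype.ext (congrFun this i))
    (fun y _ => by
      obtain ⟨c, hc, rfl⟩ := exists_eq_sum_const ha y
      refine Submodule.sum_mem _ fun i _ => ?_
      exact Submodule.smul_mem _ (⟨c i, hc i⟩ : constants d) (Submodule.subset_span ⟨i, rfl⟩))

@[simp]
theorem constBasis_apply (ha : (opMatrix b d a).det ≠ 0) (i : ι) : constBasis ha i = a i := by
  simp [constBasis]

end Basis

/-! ### Existentially closed `𝔤`-fields in terms of their constants -/

section Axioms

open MvPolynomial

/-- The conditions on a `𝔤`-field `K` which say that `K` has the largest possible degree over its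
field of constants, and that every hypersurface over the constants whose equation is irreducible
over `K` has a constant point outside of any given hypersurface not containing it. They are of first
order, since the degrees of the factors of a polynomial are bounded, and they are equivalent to
existential closedness. -/
structure ConstantAxioms {ι : Type*} [Fintype ι] [DecidableEq ι] (b : Module.Basis ι k H)
    (d : GAction k H K) : Prop where
  exists_det_ne_zero : ∃ a : ι → K, (opMatrix b d a).det ≠ 0
  exists_point : ∀ (n : ℕ) (f g : MvPolynomial (Fin n) K), (∀ e, IsConst d (f.coeff e)) →
    (∀ e, IsConst d (g.coeff e)) → Irreducible f → ¬ f ∣ g →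
    ∃ c : Fin n → K, (∀ i, IsConst d (c i)) ∧ eval c f = 0 ∧ eval c g ≠ 0

variable {d : GAction k H K}

theorem ConstantAxioms.hasHypersurfacePoints {ι : Type*} [Fintype ι] [DecidableEq ι]
    {b : Module.Basis ι k H} (h : ConstantAxioms b d) :
    HasHypersurfacePoints (constants d) K := by
  intro n f g hf hg
  obtain ⟨c, hc, hcf, hcg⟩ := h.exists_point n (map (algebraMap (constants d) K) f)
    (map (algebraMap (constants d) K) g) (fun e => by rw [coeff_map]; exact (f.coeff e).2)
    (fun e => by rw [coeff_map]; exact (g.coeff e).2) hf hg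
  have hmap : ∀ p : MvPolynomial (Fin n) (constants d),
      eval c (map (algebraMap (constants d) K) p) =
      algebraMap (constants d) K (eval (fun i => (⟨c i, hc i⟩ : constants d)) p) := fun p => by
    rw [eval_map]
    exact (eval₂_comp_left (algebraMap (constants d) K) (RingHom.id _)
      (fun i => (⟨c i, hc i⟩ : constants d)) p).symm
  rw [hmap] at hcf hcg
  exact ⟨fun i => ⟨c i, hc i⟩, (map_eq_zero_iff _ (algebraMap (constants d) K).injective).1 hcf,
    fun h0 => hcg (by rw [h0, map_zero])⟩

theorem isConst_evalHom {L σ : Type*} [Field L] [Algebra k L] {d' : GAction k H L} {φ : K →ₐ[k] L}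
    (hφ : IsGHom d d' φ) {e : σ → L} (he : ∀ i, IsConst d' (e i))
    (q : MvPolynomial σ (constants d)) :
    IsConst d' (evalHom φ e (map (algebraMap (constants d) K) q)) := by
  induction q using MvPolynomial.induction_on with
  | C c =>
    rw [map_C, evalHom_C]
    exact IsConst.map hφ c.2
  | add p q hp hq =>
    rw [map_add, map_add]
    exact (constants d').add_mem hp hq
  | mul_X p i hp =>
    rw [map_mul, map_mul, map_X, evalHom_X]
    exact (constants d').mul_mem hp (he i)

/-- If `a` is a basis of `K` over the constants, then every polynomial condition on `∂(x)` can be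
expressed by polynomial conditions over the constants on the coordinates of `x`. -/
theorem exists_const_conditions {ι : Type*} [Fintype ι] [DecidableEq ι] {b : Module.Basis ι k H}
    {a : ι → K} (ha : (opMatrix b d a).det ≠ 0) {σ : Type*} (p : MvPolynomial (σ × ι) K) :
    ∃ Q : ι → MvPolynomial (σ × ι) (constants d),
      ∀ {L : Type*} [Field L] [Algebra k L] {d' : GAction k H L} {φ : K →ₐ[k] L}
        (_ : IsGHom d d' φ) {e : σ × ι → L} (_ : ∀ i, IsConst d' (e i)),
        evalHom φ (gPoint b d' fun i => ∑ l, e (i, l) * φ (a l)) p = 0 ↔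
          ∀ l, evalHom φ e (map (algebraMap (constants d) K) (Q l)) = 0 := by
  obtain ⟨Q, hQ⟩ := exists_eq_sum_basis (constBasis ha) (evalHom (constHom k K (σ × ι))
    (fun q => ∑ l, MvPolynomial.C (gOperator b d q.2 (a l)) * X (q.1, l)) p)
  refine ⟨Q, fun {L} _ _ {d' φ} hφ {e} he => ?_⟩
  have h1 : evalHom φ (gPoint b d' fun i => ∑ l, e (i, l) * φ (a l)) p =
      ∑ l, evalHom φ e (map (algebraMap (constants d) K) (Q l)) * φ (a l) := by
    calc _ = evalHom φ e (evalHom (constHom k K (σ × ι))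
        (fun q => ∑ l, MvPolynomial.C (gOperator b d q.2 (a l)) * X (q.1, l)) p) := by
          rw [← AlgHom.comp_apply, comp_evalHom]
          congr 2
          · ext c
            simp
          · funext q
            obtain ⟨i, j⟩ := q
            rw [gPoint_apply, gOperator_sum, map_sum]
            refine Finset.sum_congr rfl fun l _ => ?_
            rw [(he _).gOperator_mul, hφ.gOperator_apply, map_mul, evalHom_C, evalHom_X, mul_comm]
      _ = _ := by
          rw [hQ, map_sum]
          refine Finset.sum_congr rfl fun l _ => ?_
          rw [map_mul, evalHom_C, constBasis_apply, mul_comm]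
  rw [h1]
  constructor
  · intro h0
    have ha' : (opMatrix b d' fun i => φ (a i)).det ≠ 0 := by
      rw [opMatrix_map b d hφ]
      exact fun h => ha ((map_eq_zero_iff φ φ.injective).1 h)
    exact congrFun (eq_zero_of_sum_const_eq_zero ha' (fun l => isConst_evalHom hφ he (Q l)) h0)
  · intro h0
    simp [h0]

/-- In a `𝔤`-field extension `L` the same elements `a` of `K` form a basis over the constants of `L`.
A polynomial condition on `∂(x)` becomes a condition over the constants of `K` on the coordinates of
`x`, and these coordinates can be specialized to constants of `K`. -/
theorem ConstantAxioms.polyClosed {ι : Type} [Fintype ι] [DecidableEq ι] {b : Module.Basis ι k H}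
    {K : Type w} [Field K] [Algebra k K] {d : GAction k H K} (h : ConstantAxioms b d) :
    PolyClosed b d := by
  classical
  intro L _ _ d' φ hφ n x S
  obtain ⟨a, ha⟩ := h.exists_det_ne_zero
  have ha' : (opMatrix b d' fun i => φ (a i)).det ≠ 0 := by
    rw [opMatrix_map b d hφ]
    exact fun h => ha ((map_eq_zero_iff φ φ.injective).1 h)
  let F := constants d
  let E := constants d'
  choose e he hx using fun i => exists_eq_sum_const ha' (x i)
  choose Q hQ using fun p => exists_const_conditions (σ := Fin n) ha p
  let _ : Algebra K L := (φ : K →+* L).toAlgebra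
  let _ : Algebra F E := (((φ : K →+* L).comp F.subtype).codRestrict E
    (fun c => IsConst.map hφ c.2)).toAlgebra
  have : IsScalarTower F E L := IsScalarTower.of_algebraMap_eq fun c => rfl
  have : IsScalarTower F K L := IsScalarTower.of_algebraMap_eq fun c => rfl
  have hu : LinearIndependent E (fun i => algebraMap K L (constBasis ha i)) := by
    simp_rw [constBasis_apply]
    have := (constBasis ha').linearIndependent
    exact (funext (constBasis_apply ha') ▸ this :)
  obtain ⟨c, hc⟩ := h.hasHypersurfacePoints.exists_point (constBasis ha) hu
    (fun q : Fin n × ι => (⟨e q.1 q.2, he q.1 q.2⟩ : E))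
    (S.biUnion fun p => Finset.univ.image (Q p))
  have hK : ∀ q : MvPolynomial (Fin n × ι) F, evalHom (AlgHom.id k K) (fun i => (c i : K))
      (map (algebraMap F K) q) = algebraMap F K (eval c q) := fun q => by
    rw [evalHom_apply, eval₂_map, eval, coe_eval₂Hom, eval₂_comp_left]
    rfl
  have hL : ∀ q : MvPolynomial (Fin n × ι) F, evalHom φ (fun i => e i.1 i.2)
      (map (algebraMap F K) q) = algebraMap E L
        (aeval (fun q : Fin n × ι => (⟨e q.1 q.2, he q.1 q.2⟩ : E)) q) := fun q => by
    have hcomp : (φ : K →+* L).comp (algebraMap F K) =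
        (algebraMap E L).comp (algebraMap F E) := rfl
    rw [evalHom_apply, eval₂_map, hcomp, aeval_def, eval₂_comp_left]
    rfl
  refine ⟨fun i => ∑ l, (c (i, l) : K) * a l, fun p hp => ?_⟩
  have h1 := hQ p (isGHom_id d) (e := fun i => (c i : K)) (fun i => (c i).2)
  have h2 := hQ p hφ (e := fun i => e i.1 i.2) (fun i => he i.1 i.2)
  have hx' : x = fun i => ∑ l, e i l * φ (a l) := funext hx
  rw [hx']
  refine h1.trans (Iff.trans (forall_congr' fun l => ?_) h2.symm)
  rw [hK, hL, map_eq_zero_iff _ (algebraMap F K).injective,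
    map_eq_zero_iff _ (algebraMap E L).injective]
  exact hc _ (Finset.mem_biUnion.2 ⟨p, hp, Finset.mem_image_of_mem _ (Finset.mem_univ l)⟩)

/-- In a `𝔤`-field which is existentially closed, the determinant of the generic matrix of the
elements `∂_j(x_i)` does not vanish at some point, since it is a nonzero polynomial. -/
theorem PolyClosed.exists_det_ne_zero {m : ℕ} {b : Module.Basis (Fin (m + 1)) k H}
    {K : Type w} [Field K] [Algebra k K] {d : GAction k H K} (h : PolyClosed b d) :
    ∃ a : Fin (m + 1) → K, (opMatrix b d a).det ≠ 0 := by
  have : Module.Finite k H := Module.Finite.of_basis b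
  have hbot : IsGIdeal (polyAction b d (Fin (m + 1))) ⊥ := by
    intro f hf
    rw [Ideal.mem_bot.1 hf, map_zero, map_zero]
  obtain ⟨L, _, _, d', π, hπ, hker⟩ := exists_gField_of_isPrime _ _ hbot
  set φ := π.comp (constHom k K (Fin (m + 1) × Fin (m + 1)))
  have hφ : IsGHom d d' φ := hπ.comp (isGHom_constHom b d)
  set D : MvPolynomial (Fin (m + 1) × Fin (m + 1)) K := (Matrix.mvPolynomialX _ _ K).det
  obtain ⟨a, ha⟩ := h L d' φ hφ (m + 1) (fun i => π (baseVar b K i)) {D}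
  refine ⟨a, fun h0 => ?_⟩
  have h1 : evalHom (AlgHom.id k K) (gPoint b d a) D = (opMatrix b d a).det := by
    rw [AlgHom.map_det]
    congr 1
    ext i j
    simp [opMatrix, gPoint_apply]
  have h2 := (ha D (Finset.mem_singleton_self D)).1 (h1.trans h0)
  rw [gPoint_eq_of_isGHom b hπ, ← eq_evalHom] at h2
  have h3 : D ∈ RingHom.ker π := h2
  rw [hker, Ideal.mem_bot] at h3
  exact Matrix.det_mvPolynomialX_ne_zero _ K h3

/-- A polynomial with constant coefficients is a constant for the action which fixes the
variables. -/
theorem constPolyAction_of_const {σ : Type*} {f : MvPolynomial σ K}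
    (hf : ∀ e, IsConst d (f.coeff e)) : (constPolyAction d σ).toAlgHom f = f ⊗ₜ 1 := by
  have hC : ∀ c, IsConst d c → IsConst (constPolyAction d σ) (MvPolynomial.C c) := fun c hc =>
    IsConst.map (isGHom_constHom_constPolyAction d σ) hc
  have hmon : ∀ e c, IsConst d c → (constPolyAction d σ).toAlgHom (monomial e c) =
      (Algebra.TensorProduct.includeLeft : _ →ₐ[k] MvPolynomial σ K ⊗[k] H) (monomial e c) := by
    intro e c hc
    rw [monomial_eq, map_mul, map_mul, hC c hc, map_finsuppProd, map_finsuppProd]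
    simp [constPolyAction_X]
  rw [f.as_sum, map_sum, Finset.sum_congr rfl fun e _ => hmon e _ (hf e), ← map_sum]
  rfl

/-- The generic point of the hypersurface `f = 0` over `K` generates a `𝔤`-field extension of `K` in
which the coordinates are constants. -/
theorem PolyClosed.exists_point {ι : Type} [Fintype ι] {b : Module.Basis ι k H}
    {K : Type w} [Field K] [Algebra k K] {d : GAction k H K} (h : PolyClosed b d) (n : ℕ)
    (f g : MvPolynomial (Fin n) K) (hf : ∀ e, IsConst d (f.coeff e)) (hirr : Irreducible f)
    (hfg : ¬ f ∣ g) : ∃ c : Fin n → K, (∀ i, IsConst d (c i)) ∧ eval c f = 0 ∧ eval c g ≠ 0 := by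
  classical
  have : Module.Finite k H := Module.Finite.of_basis b
  have hprime : (Ideal.span {f}).IsPrime := (Ideal.span_singleton_prime hirr.ne_zero).2 hirr.prime
  have hG : IsGIdeal (constPolyAction d (Fin n)) (Ideal.span {f}) := by
    intro q hq
    obtain ⟨q, rfl⟩ := Ideal.mem_span_singleton.1 hq
    have h1 : Ideal.Quotient.mkₐ k (Ideal.span {f}) f = 0 :=
      Ideal.Quotient.eq_zero_iff_mem.2 (Ideal.mem_span_singleton_self f)
    rw [map_mul, map_mul, constPolyAction_of_const hf, Algebra.TensorProduct.map_tmul, h1,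
      TensorProduct.zero_tmul, zero_mul]
  obtain ⟨L, _, _, d', π, hπ, hker⟩ := exists_gField_of_isPrime _ _ hG
  set φ := π.comp (constHom k K (Fin n))
  have hφ : IsGHom d d' φ := hπ.comp (isGHom_constHom_constPolyAction d (Fin n))
  set x : Fin n → L := fun i => π (X i) with hx
  have hπe : π = evalHom φ x := eq_evalHom π
  have hxc : ∀ i, IsConst d' (x i) := fun i => IsConst.map hπ (constPolyAction_X d i)
  -- The polynomials `P` express that the coordinates are constants.
  set P : Fin n × ι → MvPolynomial (Fin n × ι) K := fun q =>
    X q - MvPolynomial.C (algebraMap k K (b.repr 1 q.2)) * baseVar b K q.1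
  set sub : MvPolynomial (Fin n) K →ₐ[k] MvPolynomial (Fin n × ι) K :=
    evalHom (constHom k K _) (fun i => baseVar b K i)
  have hsub : ∀ {M : Type w} [Field M] [Algebra k M] (dM : GAction k H M) (ψ : K →ₐ[k] M)
      (y : Fin n → M) (q : MvPolynomial (Fin n) K),
      evalHom ψ (gPoint b dM y) (sub q) = evalHom ψ y q := by
    intro M _ _ dM ψ y q
    rw [← AlgHom.comp_apply, comp_evalHom]
    congr 2
    · ext c
      simp
    · funext i
      rw [evalHom_gPoint_baseVar]
  have hP : ∀ {M : Type w} [Field M] [Algebra k M] (dM : GAction k H M) (ψ : K →ₐ[k] M)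
      (y : Fin n → M) (q : Fin n × ι), evalHom ψ (gPoint b dM y) (P q) = 0 ↔
        gOperator b dM q.2 (y q.1) = b.repr 1 q.2 • y q.1 := by
    intro M _ _ dM ψ y q
    rw [map_sub, map_mul, evalHom_C, evalHom_X, evalHom_gPoint_baseVar, sub_eq_zero,
      AlgHom.commutes, ← Algebra.smul_def]
    rfl
  obtain ⟨a, ha⟩ := h L d' φ hφ n x (Finset.univ.image P ∪ {sub f, sub g})
  refine ⟨a, fun i => (isConst_iff b d (a i)).2 fun j => ?_, ?_, ?_⟩
  · refine (hP d (AlgHom.id k K) a (i, j)).1 ((ha _ ?_).2 ?_)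
    · exact Finset.mem_union_left _ (Finset.mem_image_of_mem _ (Finset.mem_univ _))
    · exact (hP d' φ x (i, j)).2 ((isConst_iff b d' (x i)).1 (hxc i) j)
  · have h1 := (ha (sub f) (by simp)).2 (by
      rw [hsub, ← hπe, ← RingHom.mem_ker, hker]
      exact Ideal.mem_span_singleton_self f)
    rw [hsub] at h1
    exact h1
  · intro h0
    have h1 := (ha (sub g) (by simp)).1 (by rw [hsub]; exact h0)
    rw [hsub, ← hπe, ← RingHom.mem_ker, hker, Ideal.mem_span_singleton] at h1
    exact hfg h1

theorem polyClosed_iff_constantAxioms {m : ℕ} {b : Module.Basis (Fin (m + 1)) k H}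
    {K : Type w} [Field K] [Algebra k K] {d : GAction k H K} :
    PolyClosed b d ↔ ConstantAxioms b d :=
  ⟨fun h => ⟨h.exists_det_ne_zero, fun n f g hf _ => h.exists_point n f g hf⟩, fun h => h.polyClosed⟩

end Axioms

end Constants

section OperatorRings

/-! ### The identities between the operators -/

open FirstOrder FirstOrder.Language

variable {k : Type u} {H : Type v} [Field k] [CommRing H] [HopfAlgebra k H]

section Identities

variable {ι : Type*} [Fintype ι] (b : Module.Basis ι k H) {R : Type*} [CommRing R] [Algebra k R]

theorem sum_tmul_mul_sum_tmul (r s : ι → R) :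
    (∑ p, r p ⊗ₜ[k] b p) * (∑ q, s q ⊗ₜ[k] b q) =
      ∑ j, (∑ p, ∑ q, b.repr (b p * b q) j • (r p * s q)) ⊗ₜ[k] b j := by
  simp_rw [Finset.sum_mul_sum, Algebra.TensorProduct.tmul_mul_tmul, TensorProduct.sum_tmul,
    fun p q => tmul_eq_sum_basis b (r p * s q) (b p * b q)]
  rw [Finset.sum_comm]
  conv_rhs => rw [Finset.sum_comm]; enter [2, p]; rw [Finset.sum_comm]
  rw [Finset.sum_comm]

theorem idComul_sum_tmul (r : ι → R) :
    idComul k H R (∑ i, r i ⊗ₜ[k] b i) =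
      ∑ j, (∑ l, (∑ i, (b.tensorProduct b).repr (Coalgebra.comul (R := k) (b i)) (l, j) • r i)
        ⊗ₜ[k] b l) ⊗ₜ[k] b j := by
  have h : ∀ i, idComul k H R (r i ⊗ₜ[k] b i) = ∑ j, ∑ l,
      (((b.tensorProduct b).repr (Coalgebra.comul (R := k) (b i)) (l, j) • r i)
        ⊗ₜ[k] b l) ⊗ₜ[k] b j := by
    intro i
    rw [idComul_tmul]
    conv_lhs => rw [← (b.tensorProduct b).sum_repr (Coalgebra.comul (R := k) (b i))]
    rw [Fintype.sum_prod_type, Finset.sum_comm, TensorProduct.tmul_sum, map_sum]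
    refine Finset.sum_congr rfl fun j _ => ?_
    rw [TensorProduct.tmul_sum, map_sum]
    refine Finset.sum_congr rfl fun l _ => ?_
    rw [Module.Basis.tensorProduct_apply, TensorProduct.tmul_smul, TensorProduct.smul_tmul',
      Algebra.TensorProduct.assoc_symm_tmul]
  rw [map_sum]
  simp_rw [h, TensorProduct.sum_tmul]
  rw [Finset.sum_comm]
  refine Finset.sum_congr rfl fun j _ => ?_
  rw [Finset.sum_comm]

/-- The identities which say that the operators `D_j` on `R` are the coordinates of a ring
homomorphism `R → R ⊗ H` which satisfies the coassociativity condition. -/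
structure OperatorIdentities (D : ι → R → R) : Prop where
  add : ∀ j x y, D j (x + y) = D j x + D j y
  const : ∀ j (c : k), D j (algebraMap k R c) = (b.repr 1 j * c) • (1 : R)
  mul : ∀ j x y, D j (x * y) = ∑ p, ∑ q, b.repr (b p * b q) j • (D p x * D q y)
  comp : ∀ l j x, D l (D j x) =
    ∑ i, (b.tensorProduct b).repr (Coalgebra.comul (R := k) (b i)) (l, j) • D i x

theorem mapH_coaction (d : GAction k H R) (x : R) : mapH H d.toAlgHom (d.toAlgHom x) =
    ∑ j, (∑ l, gOperator b d l (gOperator b d j x) ⊗ₜ[k] b l) ⊗ₜ[k] b j := by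
  conv_lhs => rw [← sum_gOperator b d x]
  simp_rw [map_sum, sum_gOperator b d]
  rfl

theorem operatorIdentities_gOperator (d : GAction k H R) :
    OperatorIdentities b (gOperator b d) where
  add j x y := by simp [gOperator]
  const j c := by
    refine eq_of_sum_tmul_basis_eq b (r := fun j => gOperator b d j (algebraMap k R c))
      (s := fun j => (b.repr 1 j * c) • (1 : R)) ?_ j
    rw [sum_gOperator, AlgHom.commutes, Algebra.TensorProduct.algebraMap_apply,
      tmul_eq_sum_basis b]
    simp_rw [Algebra.algebraMap_eq_smul_one, smul_smul]
  mul j x y := by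
    refine eq_of_sum_tmul_basis_eq b (r := fun j => gOperator b d j (x * y)) 
      (s := fun j => ∑ p, ∑ q, b.repr (b p * b q) j • (gOperator b d p x * gOperator b d q y)) ?_ j
    rw [sum_gOperator, map_mul, ← sum_gOperator b d x, ← sum_gOperator b d y,
      sum_tmul_mul_sum_tmul]
  comp l j x := by
    have h := d.mapH_apply_apply x
    rw [mapH_coaction b, ← sum_gOperator b d x, idComul_sum_tmul] at h
    exact eq_of_sum_tmul_basis_eq b (eq_of_sum_tmul_basis_eq b h j) l

/-- Operators which satisfy the identities and the counit condition are the operators of an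
action. -/
theorem OperatorIdentities.exists_gAction {D : ι → R → R} (h : OperatorIdentities b D)
    (hc : ∀ x, ∑ j, Coalgebra.counit (R := k) (b j) • D j x = x) :
    ∃ d : GAction k H R, ∀ j, gOperator b d j = D j := by
  have hcomm : ∀ c : k, ∑ j, D j (algebraMap k R c) ⊗ₜ[k] b j = algebraMap k (R ⊗[k] H) c := by
    intro c
    rw [Algebra.TensorProduct.algebraMap_apply, tmul_eq_sum_basis b]
    refine Finset.sum_congr rfl fun j _ => ?_
    rw [h.const, Algebra.algebraMap_eq_smul_one, smul_smul]
  have hz : ∀ j, D j 0 = 0 := fun j => by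
    have := h.add j 0 0
    rw [add_zero] at this
    exact left_eq_add.1 this
  let f : R →ₐ[k] R ⊗[k] H :=
    { toFun := fun x => ∑ j, D j x ⊗ₜ[k] b j
      map_one' := by
        have := hcomm 1
        rwa [map_one, map_one] at this
      map_mul' := fun x y => by
        rw [sum_tmul_mul_sum_tmul]
        simp_rw [h.mul]
      map_zero' := by simp [hz]
      map_add' := fun x y => by
        simp_rw [h.add, TensorProduct.add_tmul, Finset.sum_add_distrib]
      commutes' := hcomm }
  have hf : ∀ x, f x = ∑ j, D j x ⊗ₜ[k] b j := fun x => rfl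
  refine ⟨GAction.ofLaws f (fun x => ?_) (fun x => ?_), fun j => funext fun x => ?_⟩
  · rw [hf, map_sum]
    simp_rw [counitH_tmul]
    exact hc x
  · conv_rhs => rw [hf, idComul_sum_tmul]
    conv_lhs => rw [hf, map_sum]
    refine Finset.sum_congr rfl fun j _ => ?_
    simp_rw [← h.comp]
    rfl
  · exact eq_of_sum_tmul_basis_eq b (r := fun j => gOperator b _ j x) (s := fun j => D j x)
      (sum_gOperator b _ x) j

end Identities

end OperatorRings

section Definability

/-! ### Term functions and definable predicates -/

open FirstOrder FirstOrder.Language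

/-- A commutative `k`-algebra with `m + 1` unary operations, the first of which is the identity. No
compatibility of the operations with the ring structure is asked for, so that the notion applies to
a structure which is yet to be recognised as a `𝔤`-field. -/
structure OpRing (k : Type u) [Field k] (m : ℕ) where
  /-- The underlying type. -/
  carrier : Type w
  [commRing : CommRing carrier]
  [algebra : Algebra k carrier]
  /-- The operations. -/
  op : Fin (m + 1) → carrier → carrier
  op_zero : ∀ x, op 0 x = x

namespace OpRing

variable {k : Type u} [Field k] {m : ℕ}

instance : CoeSort (OpRing.{u, w} k m) (Type w) := ⟨OpRing.carrier⟩

instance (R : OpRing.{u, w} k m) : CommRing R := R.commRing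

instance (R : OpRing.{u, w} k m) : Algebra k R := R.algebra

/-- The `L_𝔤`-structure of a ring with operations. -/
instance instStructure (R : OpRing.{u, w} k m) : (gLanguage k m).Structure R where
  funMap {n} (f : GFunc k m n) := match f with
    | .add => fun x => x 0 + x 1
    | .mul => fun x => x 0 * x 1
    | .neg => fun x => -x 0
    | .zero => fun _ => 0
    | .one => fun _ => 1
    | .op i => fun x => R.op i.succ (x 0)
    | .const a => fun _ => algebraMap k R a
  RelMap r := r.elim

/-- A `𝔤`-ring as a ring with operations. -/
@[reducible]
def ofAction {H : Type v} [CommRing H] [HopfAlgebra k H] {b : Module.Basis (Fin (m + 1)) k H}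
    (hb : IsAdapted b) {R : Type w} [CommRing R] [Algebra k R] (d : GAction k H R) :
    OpRing.{u, w} k m where
  carrier := R
  op := gOperator b d
  op_zero := hb.gOperator_zero d

/-- The predicate which singles out the constants among the elements of a `𝔤`-ring. -/
def IsConst {H : Type v} [CommRing H] [HopfAlgebra k H] (b : Module.Basis (Fin (m + 1)) k H)
    (R : OpRing.{u, w} k m) (r : R) : Prop :=
  ∀ j, R.op j r = b.repr 1 j • r

end OpRing

variable {k : Type u} [Field k] {m : ℕ} {α β : Type*}

/-- A family of functions on the rings with operations which is given by a term. -/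
def IsTermFn (f : ∀ R : OpRing.{u, w} k m, (α → R) → R) : Prop :=
  ∃ t : (gLanguage k m).Term α, ∀ R v, t.realize v = f R v

namespace IsTermFn

variable {f g : ∀ R : OpRing.{u, w} k m, (α → R) → R}

theorem var (i : α) : IsTermFn.{u, w} (k := k) (m := m) fun _ v => v i :=
  ⟨Term.var i, fun _ _ => rfl⟩

theorem const (c : k) : IsTermFn.{u, w} (k := k) (m := m) (α := α) fun R _ => algebraMap k R c :=
  ⟨Term.func (GFunc.const c : (gLanguage k m).Functions 0) ![], fun _ _ => rfl⟩

theorem add (hf : IsTermFn f) (hg : IsTermFn g) : IsTermFn fun R v => f R v + g R v := by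
  obtain ⟨s, hs⟩ := hf
  obtain ⟨t, ht⟩ := hg
  exact ⟨Term.func (GFunc.add : (gLanguage k m).Functions 2) ![s, t],
    fun R v => congrArg₂ (fun x y : R => x + y) (hs R v) (ht R v)⟩

theorem mul (hf : IsTermFn f) (hg : IsTermFn g) : IsTermFn fun R v => f R v * g R v := by
  obtain ⟨s, hs⟩ := hf
  obtain ⟨t, ht⟩ := hg
  exact ⟨Term.func (GFunc.mul : (gLanguage k m).Functions 2) ![s, t],
    fun R v => congrArg₂ (fun x y : R => x * y) (hs R v) (ht R v)⟩

theorem op (j : Fin (m + 1)) (hf : IsTermFn f) : IsTermFn fun R v => R.op j (f R v) := by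
  rcases Fin.eq_zero_or_eq_succ j with rfl | ⟨j, rfl⟩
  · simpa only [OpRing.op_zero] using hf
  · obtain ⟨s, hs⟩ := hf
    exact ⟨Term.func (GFunc.op j : (gLanguage k m).Functions 1) ![s],
      fun R v => congrArg (R.op j.succ) (hs R v)⟩

theorem smul (c : k) (hf : IsTermFn f) : IsTermFn fun R v => c • f R v := by
  simpa only [Algebra.smul_def] using (const c).mul hf

theorem zero : IsTermFn.{u, w} (k := k) (m := m) (α := α) fun _ _ => 0 := by
  simpa only [map_zero] using const (α := α) (m := m) (0 : k)

theorem one : IsTermFn.{u, w} (k := k) (m := m) (α := α) fun _ _ => 1 := by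
  simpa only [map_one] using const (α := α) (m := m) (1 : k)

theorem sum {ι : Type*} (s : Finset ι) {f : ι → ∀ R : OpRing.{u, w} k m, (α → R) → R}
    (hf : ∀ i ∈ s, IsTermFn (f i)) : IsTermFn fun R v => ∑ i ∈ s, f i R v := by
  classical
  induction s using Finset.induction_on with
  | empty => simpa using zero
  | insert i s hi ih =>
    simp only [Finset.sum_insert hi]
    exact (hf i (Finset.mem_insert_self _ _)).add
      (ih fun j hj => hf j (Finset.mem_insert_of_mem hj))

theorem prod {ι : Type*} (s : Finset ι) {f : ι → ∀ R : OpRing.{u, w} k m, (α → R) → R}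
    (hf : ∀ i ∈ s, IsTermFn (f i)) : IsTermFn fun R v => ∏ i ∈ s, f i R v := by
  classical
  induction s using Finset.induction_on with
  | empty => simpa using one
  | insert i s hi ih =>
    simp only [Finset.prod_insert hi]
    exact (hf i (Finset.mem_insert_self _ _)).mul
      (ih fun j hj => hf j (Finset.mem_insert_of_mem hj))

theorem pow (hf : IsTermFn f) (n : ℕ) : IsTermFn fun R v => f R v ^ n := by
  simpa using prod (Finset.range n) fun _ _ => hf

theorem det {n : ℕ} {A : Fin n → Fin n → ∀ R : OpRing.{u, w} k m, (α → R) → R}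
    (hA : ∀ i j, IsTermFn (A i j)) :
    IsTermFn fun R v => (Matrix.of fun i j => A i j R v).det := by
  have h : ∀ (R : OpRing.{u, w} k m) (v : α → R), (Matrix.of fun i j => A i j R v).det =
      ∑ σ : Equiv.Perm (Fin n), algebraMap k R (Equiv.Perm.sign σ : ℤ) *
        ∏ i, A (σ i) i R v := by
    intro R v
    simp [Matrix.det_apply']
  simp only [h]
  exact sum _ fun σ _ => (const _).mul (prod _ fun i _ => hA _ _)

end IsTermFn

/-- A family of predicates on the rings with operations which is given by a formula. -/
def IsDefinable (P : ∀ R : OpRing.{u, w} k m, (α → R) → Prop) : Prop :=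
  ∃ ψ : (gLanguage k m).Formula α, ∀ (R : OpRing.{u, w} k m) (v : α → R), ψ.Realize v ↔ P R v

namespace IsDefinable

variable {P Q : ∀ R : OpRing.{u, w} k m, (α → R) → Prop}

theorem eq {f g : ∀ R : OpRing.{u, w} k m, (α → R) → R} (hf : IsTermFn f) (hg : IsTermFn g) :
    IsDefinable fun R v => f R v = g R v := by
  obtain ⟨s, hs⟩ := hf
  obtain ⟨t, ht⟩ := hg
  refine ⟨s.equal t, fun R v => ?_⟩
  rw [Formula.realize_equal, hs, ht]

theorem not (hP : IsDefinable P) : IsDefinable fun R v => ¬ P R v := by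
  obtain ⟨φ, h⟩ := hP
  exact ⟨φ.not, fun R v => by rw [Formula.realize_not, h]⟩

theorem and (hP : IsDefinable P) (hQ : IsDefinable Q) :
    IsDefinable fun R v => P R v ∧ Q R v := by
  obtain ⟨φ, h⟩ := hP
  obtain ⟨ψ, h'⟩ := hQ
  exact ⟨φ ⊓ ψ, fun R v => by rw [Formula.realize_inf, h, h']⟩

theorem imp (hP : IsDefinable P) (hQ : IsDefinable Q) :
    IsDefinable fun R v => P R v → Q R v := by
  obtain ⟨φ, h⟩ := hP
  obtain ⟨ψ, h'⟩ := hQ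
  exact ⟨φ.imp ψ, fun R v => by rw [Formula.realize_imp, h, h']⟩

theorem or (hP : IsDefinable P) (hQ : IsDefinable Q) :
    IsDefinable fun R v => P R v ∨ Q R v := by
  simpa only [← or_iff_not_imp_left] using hP.not.imp hQ

theorem forall_mem {ι : Type*} (s : Finset ι) {P : ι → ∀ R : OpRing.{u, w} k m, (α → R) → Prop}
    (hP : ∀ i, IsDefinable (P i)) : IsDefinable fun R v => ∀ i ∈ s, P i R v := by
  classical
  induction s using Finset.induction_on with
  | empty => simpa using eq (α := α) (k := k) (m := m) IsTermFn.zero IsTermFn.zero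
  | insert i s hi ih =>
    simp only [Finset.forall_mem_insert]
    exact (hP i).and ih

theorem forall_fintype {ι : Type*} [Fintype ι]
    {P : ι → ∀ R : OpRing.{u, w} k m, (α → R) → Prop}
    (hP : ∀ i, IsDefinable (P i)) : IsDefinable fun R v => ∀ i, P i R v := by
  simpa using forall_mem Finset.univ hP

theorem ex [Finite β] {P : ∀ R : OpRing.{u, w} k m, (α → R) → (β → R) → Prop}
    (hP : IsDefinable fun R (v : α ⊕ β → R) => P R (v ∘ Sum.inl) (v ∘ Sum.inr)) :
    IsDefinable fun R v => ∃ y, P R v y := by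
  obtain ⟨φ, h⟩ := hP
  exact ⟨φ.iExs β, fun R v => by simp only [Formula.realize_iExs, h]; rfl⟩

theorem all [Finite β] {P : ∀ R : OpRing.{u, w} k m, (α → R) → (β → R) → Prop}
    (hP : IsDefinable fun R (v : α ⊕ β → R) => P R (v ∘ Sum.inl) (v ∘ Sum.inr)) :
    IsDefinable fun R v => ∀ y, P R v y := by
  obtain ⟨φ, h⟩ := hP
  exact ⟨φ.iAlls β, fun R v => by simp only [Formula.realize_iAlls, h]; rfl⟩

end IsDefinable

end Definability

section Recognition

/-! ### Recognising `𝔤`-fields among the structures -/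

open FirstOrder FirstOrder.Language

variable {k : Type u} {m : ℕ}

section Operations

variable (k m) {M : Type w} [(gLanguage k m).Structure M]

/-- The addition of an `L_𝔤`-structure. -/
def sAdd (x y : M) : M :=
  Structure.funMap (L := gLanguage k m) (GFunc.add : GFunc k m 2) ![x, y]

/-- The multiplication of an `L_𝔤`-structure. -/
def sMul (x y : M) : M :=
  Structure.funMap (L := gLanguage k m) (GFunc.mul : GFunc k m 2) ![x, y]

/-- The negation of an `L_𝔤`-structure. -/
def sNeg (x : M) : M :=
  Structure.funMap (L := gLanguage k m) (GFunc.neg : GFunc k m 1) ![x]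

variable (M) in
/-- The zero of an `L_𝔤`-structure. -/
def sZero : M := Structure.funMap (L := gLanguage k m) (GFunc.zero : GFunc k m 0) ![]

variable (M) in
/-- The one of an `L_𝔤`-structure. -/
def sOne : M := Structure.funMap (L := gLanguage k m) (GFunc.one : GFunc k m 0) ![]

variable (M) in
/-- The constants from `k` in an `L_𝔤`-structure. -/
def sConst (c : k) : M := Structure.funMap (L := gLanguage k m) (GFunc.const c : GFunc k m 0) ![]

/-- The operators of an `L_𝔤`-structure. The language has no symbol for the first one, which is the
identity in all `𝔤`-fields. -/
def sOp (j : Fin (m + 1)) : M → M :=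
  Fin.cases id
    (fun i x => Structure.funMap (L := gLanguage k m) (GFunc.op i : GFunc k m 1) ![x]) j

variable {k m} {α : Type*}

/-- The sum of two terms. -/
def tAdd (s t : (gLanguage k m).Term α) : (gLanguage k m).Term α :=
  Term.func (GFunc.add : GFunc k m 2) ![s, t]

/-- The product of two terms. -/
def tMul (s t : (gLanguage k m).Term α) : (gLanguage k m).Term α :=
  Term.func (GFunc.mul : GFunc k m 2) ![s, t]

/-- The negative of a term. -/
def tNeg (s : (gLanguage k m).Term α) : (gLanguage k m).Term α :=
  Term.func (GFunc.neg : GFunc k m 1) ![s]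

/-- The zero term. -/
def tZero : (gLanguage k m).Term α := Term.func (GFunc.zero : GFunc k m 0) ![]

/-- The term for a constant from `k`. -/
def tConst (c : k) : (gLanguage k m).Term α := Term.func (GFunc.const c : GFunc k m 0) ![]

/-- The one term. -/
def tOne : (gLanguage k m).Term α := Term.func (GFunc.one : GFunc k m 0) ![]

variable (v : α → M) (s t : (gLanguage k m).Term α)

theorem realize_tAdd : (tAdd s t).realize v = sAdd k m (s.realize v) (t.realize v) :=
  Term.realize_functions_apply₂

theorem realize_tMul : (tMul s t).realize v = sMul k m (s.realize v) (t.realize v) :=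
  Term.realize_functions_apply₂

theorem realize_tNeg : (tNeg s).realize v = sNeg k m (s.realize v) :=
  Term.realize_functions_apply₁

theorem realize_tZero : (tZero : (gLanguage k m).Term α).realize v = sZero k m M :=
  congrArg (Structure.funMap (L := gLanguage k m) (GFunc.zero : GFunc k m 0))
    (Subsingleton.elim _ _)

theorem realize_tOne : (tOne : (gLanguage k m).Term α).realize v = sOne k m M :=
  congrArg (Structure.funMap (L := gLanguage k m) (GFunc.one : GFunc k m 0))
    (Subsingleton.elim _ _)

theorem realize_tConst (c : k) : (tConst c : (gLanguage k m).Term α).realize v = sConst k m M c :=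
  congrArg (Structure.funMap (L := gLanguage k m) (GFunc.const c : GFunc k m 0))
    (Subsingleton.elim _ _)

end Operations

variable {H : Type v} [Field k] [CommRing H] [HopfAlgebra k H] {b : Module.Basis (Fin (m + 1)) k H}

/-- The `L_𝔤`-structure `M` is a `𝔤`-field. -/
def IsGFieldStructure (b : Module.Basis (Fin (m + 1)) k H) (M : Type w)
    [inst : (gLanguage k m).Structure M] : Prop :=
  ∃ (_ : Field M) (_ : Algebra k M) (d : GAction k H M), gStructure b d = inst

/-- The equation `s = t` is an identity in all `𝔤`-fields. -/
def IsIdentity (b : Module.Basis (Fin (m + 1)) k H) {α : Type*} (s t : (gLanguage k m).Term α) :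
    Prop :=
  ∀ (K : Type w) [Field K] [Algebra k K] (d : GAction k H K) (v : α → K),
    termVal b d s v = termVal b d t v

/-- The conditions by which `𝔤`-fields are recognised: a structure is a `𝔤`-field as soon as it
satisfies the identities of all `𝔤`-fields, is non-trivial and has inverses. -/
structure SatisfiesIdentities (b : Module.Basis (Fin (m + 1)) k H) (M : Type w)
    [(gLanguage k m).Structure M] : Prop where
  identity : ∀ {n : ℕ} {s t : (gLanguage k m).Term (Fin n)}, IsIdentity.{u, v, w} b s t →
    ∀ v : Fin n → M, s.realize v = t.realize v
  sZero_ne_sOne : sZero k m M ≠ sOne k m M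
  exists_inv : ∀ x : M, x ≠ sZero k m M → ∃ y, sMul k m x y = sOne k m M

namespace SatisfiesIdentities

variable {M : Type w} [inst : (gLanguage k m).Structure M]

/-- The ring structure on a structure which satisfies the identities of all `𝔤`-fields. -/
@[reducible]
def commRing (h : SatisfiesIdentities b M) : CommRing M := by
  let X : (gLanguage k m).Term (Fin 3) := Term.var 0
  let Y : (gLanguage k m).Term (Fin 3) := Term.var 1
  let W : (gLanguage k m).Term (Fin 3) := Term.var 2
  have i1 := h.identity (s := tAdd (tAdd X Y) W) (t := tAdd X (tAdd Y W))
    (fun K _ _ d v => add_assoc (v 0) (v 1) (v 2))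
  have i2 := h.identity (s := tAdd tZero X) (t := X) (fun K _ _ d v => zero_add (v 0))
  have i3 := h.identity (s := tAdd X Y) (t := tAdd Y X) (fun K _ _ d v => add_comm (v 0) (v 1))
  have i4 := h.identity (s := tAdd (tNeg X) X) (t := tZero)
    (fun K _ _ d v => neg_add_cancel (v 0))
  have i5 := h.identity (s := tMul (tMul X Y) W) (t := tMul X (tMul Y W))
    (fun K _ _ d v => mul_assoc (v 0) (v 1) (v 2))
  have i6 := h.identity (s := tMul tOne X) (t := X) (fun K _ _ d v => one_mul (v 0))
  have i7 := h.identity (s := tMul X Y) (t := tMul Y X) (fun K _ _ d v => mul_comm (v 0) (v 1))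
  have i8 := h.identity (s := tMul X (tAdd Y W)) (t := tAdd (tMul X Y) (tMul X W))
    (fun K _ _ d v => mul_add (v 0) (v 1) (v 2))
  have i9 := h.identity (s := tMul tZero X) (t := tZero) (fun K _ _ d v => zero_mul (v 0))
  simp only [realize_tAdd, realize_tMul, realize_tNeg, realize_tZero, realize_tOne, X, Y,
    W, Term.realize_var] at i1 i2 i3 i4 i5 i6 i7 i8 i9
  letI : Add M := ⟨sAdd k m⟩
  letI : Mul M := ⟨sMul k m⟩
  letI : Neg M := ⟨sNeg k m⟩
  letI : Zero M := ⟨sZero k m M⟩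
  letI : One M := ⟨sOne k m M⟩
  exact
    { add_assoc := fun x y z => i1 ![x, y, z]
      zero_add := fun x => i2 ![x, x, x]
      add_zero := fun x => (i3 ![x, 0, x]).trans (i2 ![x, x, x])
      add_comm := fun x y => i3 ![x, y, x]
      neg_add_cancel := fun x => i4 ![x, x, x]
      mul_assoc := fun x y z => i5 ![x, y, z]
      one_mul := fun x => i6 ![x, x, x]
      mul_one := fun x => (i7 ![x, 1, x]).trans (i6 ![x, x, x])
      mul_comm := fun x y => i7 ![x, y, x]
      left_distrib := fun x y z => i8 ![x, y, z]
      right_distrib := fun x y z => (i7 ![x + y, z, z]).trans ((i8 ![z, x, y]).trans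
        (congrArg₂ (fun s t : M => s + t) (i7 ![z, x, x]) (i7 ![z, y, y])))
      zero_mul := fun x => i9 ![x, x, x]
      mul_zero := fun x => (i7 ![x, 0, x]).trans (i9 ![x, x, x])
      nsmul := nsmulRec
      zsmul := zsmulRec }

/-- The structure map from `k` to a structure which satisfies the identities of all `𝔤`-fields. -/
def constRingHom (h : SatisfiesIdentities b M) : letI := h.commRing; k →+* M := by
  letI := h.commRing
  have j1 : ∀ c e : k, sConst k m M (c + e) = sConst k m M c + sConst k m M e := fun c e => by
    have := h.identity (n := 0) (s := tConst (c + e)) (t := tAdd (tConst c) (tConst e))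
      (fun K _ _ d v => map_add (algebraMap k K) c e) Fin.elim0
    rwa [realize_tAdd, realize_tConst, realize_tConst, realize_tConst] at this
  have j2 : ∀ c e : k, sConst k m M (c * e) = sConst k m M c * sConst k m M e := fun c e => by
    have := h.identity (n := 0) (s := tConst (c * e)) (t := tMul (tConst c) (tConst e))
      (fun K _ _ d v => map_mul (algebraMap k K) c e) Fin.elim0
    rwa [realize_tMul, realize_tConst, realize_tConst, realize_tConst] at this
  have j3 : sConst k m M 0 = 0 := by
    have := h.identity (n := 0) (s := tConst 0) (t := tZero)
      (fun K _ _ d v => map_zero (algebraMap k K)) Fin.elim0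
    rwa [realize_tZero, realize_tConst] at this
  have j4 : sConst k m M 1 = 1 := by
    have := h.identity (n := 0) (s := tConst 1) (t := tOne)
      (fun K _ _ d v => map_one (algebraMap k K)) Fin.elim0
    rwa [realize_tOne, realize_tConst] at this
  exact
    { toFun := sConst k m M
      map_zero' := j3
      map_one' := j4
      map_add' := j1
      map_mul' := j2 }

/-- The ring with operations underlying a structure which satisfies the identities of all
`𝔤`-fields. -/
def opRing (h : SatisfiesIdentities b M) : OpRing.{u, w} k m :=
  letI := h.commRing
  letI := h.constRingHom.toAlgebra
  { carrier := M
    op := sOp k m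
    op_zero := fun _ => rfl }

theorem opRing_structure (h : SatisfiesIdentities b M) :
    h.opRing.instStructure = inst := by
  refine Structure.ext (funext fun n => funext fun f => funext fun x => ?_)
    (funext fun n => funext fun r => r.elim)
  cases f with
  | add =>
    exact congrArg (inst.funMap (GFunc.add : GFunc k m 2))
      (funext fun i => by fin_cases i <;> rfl)
  | mul =>
    exact congrArg (inst.funMap (GFunc.mul : GFunc k m 2))
      (funext fun i => by fin_cases i <;> rfl)
  | neg =>
    exact congrArg (inst.funMap (GFunc.neg : GFunc k m 1))
      (funext fun i => by fin_cases i; rfl)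
  | zero =>
    exact congrArg (inst.funMap (GFunc.zero : GFunc k m 0))
      (Subsingleton.elim _ _)
  | one =>
    exact congrArg (inst.funMap (GFunc.one : GFunc k m 0))
      (Subsingleton.elim _ _)
  | op i =>
    exact congrArg (inst.funMap (GFunc.op i : GFunc k m 1))
      (funext fun i => by fin_cases i; rfl)
  | const c =>
    exact congrArg (inst.funMap (GFunc.const c : GFunc k m 0))
      (Subsingleton.elim _ _)

/-- Equations between families of functions which are given by terms carry over from `𝔤`-fields. -/
theorem eq_of_isTermFn (hb : IsAdapted b) (h : SatisfiesIdentities b M) {n : ℕ}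
    {f g : ∀ R : OpRing.{u, w} k m, (Fin n → R) → R} (hf : IsTermFn f) (hg : IsTermFn g)
    (hfg : ∀ (K : Type w) [Field K] [Algebra k K] (d : GAction k H K) (v : Fin n → K),
      f (OpRing.ofAction hb d) v = g (OpRing.ofAction hb d) v) (v : Fin n → M) :
    f h.opRing v = g h.opRing v := by
  obtain ⟨s, hs⟩ := hf
  obtain ⟨t, ht⟩ := hg
  rw [← hs h.opRing v, ← ht h.opRing v, h.opRing_structure]
  refine h.identity (fun K _ _ d v => ?_) v
  exact (hs (OpRing.ofAction hb d) v).trans ((hfg K d v).trans (ht (OpRing.ofAction hb d) v).symm)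

/-- That the operators are the coordinates of a coaction is expressed by identities, so that it
holds in every structure which satisfies the identities of all `𝔤`-fields. -/
theorem isGFieldStructure (hb : IsAdapted b) (h : SatisfiesIdentities b M) :
    IsGFieldStructure b M := by
  let R := h.opRing
  have hid : OperatorIdentities b R.op :=
    { add := fun j x y => h.eq_of_isTermFn hb (((IsTermFn.var 0).add (IsTermFn.var 1)).op j)
        (((IsTermFn.var 0).op j).add ((IsTermFn.var 1).op j))
        (fun K _ _ d v => (operatorIdentities_gOperator b d).add j _ _) ![x, y]
      const := fun j c => h.eq_of_isTermFn hb (n := 0) ((IsTermFn.const c).op j)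
        (IsTermFn.one.smul _) (fun K _ _ d v => (operatorIdentities_gOperator b d).const j c) ![]
      mul := fun j x y => h.eq_of_isTermFn hb (((IsTermFn.var 0).mul (IsTermFn.var 1)).op j)
        (IsTermFn.sum Finset.univ fun p _ => IsTermFn.sum Finset.univ fun q _ =>
          ((((IsTermFn.var 0).op p).mul ((IsTermFn.var 1).op q)).smul (b.repr (b p * b q) j)))
        (fun K _ _ d v => (operatorIdentities_gOperator b d).mul j _ _) ![x, y]
      comp := fun l j x => h.eq_of_isTermFn hb (((IsTermFn.var 0).op j).op l)
        (IsTermFn.sum Finset.univ fun i _ => ((IsTermFn.var 0).op i).smul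
          ((b.tensorProduct b).repr (Coalgebra.comul (R := k) (b i)) (l, j)))
        (fun K _ _ d v => (operatorIdentities_gOperator b d).comp l j _) ![x] }
  obtain ⟨d, hd⟩ := hid.exists_gAction b (fun x => by
    rw [Fin.sum_univ_succ]
    simp [hb.1, hb.2, R.op_zero])
  classical
  have hinv : ∀ x : R, x ≠ 0 → ∃ y, x * y = 1 := h.exists_inv
  choose! inv hinv using hinv
  let F : Field M :=
    { R.commRing with
      inv := fun x => if x = (0 : R) then (0 : R) else inv x
      exists_pair_ne := ⟨_, _, h.sZero_ne_sOne⟩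
      mul_inv_cancel := fun x hx =>
        (congrArg (fun y : R => @HMul.hMul R R R _ x y) (if_neg hx)).trans (hinv x hx)
      inv_zero := if_pos rfl
      nnqsmul := _
      nnqsmul_def := fun _ _ => rfl
      qsmul := _
      qsmul_def := fun _ _ => rfl }
  refine ⟨F, R.algebra, d, ?_⟩
  rw [← h.opRing_structure]
  refine Structure.ext (funext fun n => funext fun f => funext fun x => ?_) rfl
  cases f with
  | op i => exact congrFun (hd i.succ) (x 0)
  | _ => rfl

end SatisfiesIdentities

end Recognition

section AxiomScheme

/-! ### The axioms on constants are of first order -/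

open FirstOrder FirstOrder.Language MvPolynomial

section BoundedDegree

variable {n : ℕ} (d : Fin n →₀ ℕ)

/-- The polynomial with given coefficients at the exponents below `d`. -/
def boxPoly {R : Type*} [CommSemiring R] (y : Finset.Iic d → R) : MvPolynomial (Fin n) R :=
  ∑ e : Finset.Iic d, monomial (e : Fin n →₀ ℕ) (y e)

variable {d}

theorem coeff_boxPoly {R : Type*} [CommSemiring R] (y : Finset.Iic d → R) (e : Fin n →₀ ℕ) :
    (boxPoly d y).coeff e = if h : e ≤ d then y ⟨e, Finset.mem_Iic.2 h⟩ else 0 := by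
  classical
  simp only [boxPoly, coeff_sum, coeff_monomial]
  split_ifs with h
  · rw [Finset.sum_eq_single ⟨e, Finset.mem_Iic.2 h⟩]
    · simp
    · rintro ⟨e', h'⟩ _ hne
      rw [if_neg]
      rintro rfl
      exact hne rfl
    · simp
  · refine Finset.sum_eq_zero fun e' _ => if_neg ?_
    rintro rfl
    exact h (Finset.mem_Iic.1 e'.2)

theorem support_boxPoly {R : Type*} [CommSemiring R] (y : Finset.Iic d → R) :
    (boxPoly d y).support ⊆ Finset.Iic d := by
  intro e he
  by_contra h
  rw [mem_support_iff, coeff_boxPoly, dif_neg (fun h' => h (Finset.mem_Iic.2 h'))] at he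
  exact he rfl

theorem boxPoly_coeff {R : Type*} [CommSemiring R] {p : MvPolynomial (Fin n) R}
    (hp : p.support ⊆ Finset.Iic d) : boxPoly d (fun e => p.coeff e) = p := by
  ext e
  rw [coeff_boxPoly]
  split_ifs with h
  · rfl
  · by_contra hne
    exact h (Finset.mem_Iic.1 (hp (mem_support_iff.2 (Ne.symm hne))))

variable {K : Type*} [Field K] {p q : MvPolynomial (Fin n) K}

/-- The exponents of a factor of a nonzero polynomial over a field are bounded by the exponents of
the polynomial. -/
theorem support_subset_of_mul (hq : q ≠ 0) (hp : p ≠ 0)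
    (h : (p * q).support ⊆ Finset.Iic d) : q.support ⊆ Finset.Iic d := by
  intro e he
  rw [Finset.mem_Iic]
  intro i
  have h1 : degreeOf i (p * q) ≤ d i :=
    degreeOf_le_iff.2 fun e' he' => Finset.mem_Iic.1 (h he') i
  rw [degreeOf_mul_eq hp hq] at h1
  exact (degreeOf_le_iff.1 le_rfl e he).trans ((Nat.le_add_left _ _).trans h1)

theorem dvd_iff_exists_boxPoly (hq : q.support ⊆ Finset.Iic d) :
    p ∣ q ↔ ∃ y, q = p * boxPoly d y := by
  refine ⟨?_, fun ⟨y, hy⟩ => ⟨_, hy⟩⟩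
  rintro ⟨r, rfl⟩
  by_cases h : p * r = 0
  · exact ⟨0, by simp [h, boxPoly]⟩
  · exact ⟨_, by rw [boxPoly_coeff (support_subset_of_mul (right_ne_zero_of_mul h)
      (left_ne_zero_of_mul h) hq)]⟩

theorem isUnit_iff_exists_boxPoly : IsUnit p ↔ ∃ y, 1 = p * boxPoly d y := by
  rw [isUnit_iff_dvd_one, dvd_iff_exists_boxPoly]
  intro e he
  have : e = 0 := by
    by_contra h
    rw [mem_support_iff, coeff_one, if_neg (Ne.symm h)] at he
    exact he rfl
  rw [Finset.mem_Iic, this]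
  exact zero_le

theorem irreducible_iff_boxPoly (hp : p.support ⊆ Finset.Iic d) :
    Irreducible p ↔ ¬ IsUnit p ∧
      ∀ y z, p = boxPoly d y * boxPoly d z → IsUnit (boxPoly d y) ∨ IsUnit (boxPoly d z) := by
  rw [irreducible_iff]
  refine and_congr_right fun _ => ⟨fun h y z hyz => h hyz, fun h r s hrs => ?_⟩
  -- For `p = 0` the factors need not be bounded, but neither side holds because of `0 = 0 * 0`.
  by_cases h0 : p = 0
  · have := h 0 0 (by simp [h0, boxPoly])
    simp [boxPoly] at this
  · have hr : r ≠ 0 := fun h => h0 (by rw [hrs, h, zero_mul])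
    have hs : s ≠ 0 := fun h => h0 (by rw [hrs, h, mul_zero])
    have h1 := boxPoly_coeff (support_subset_of_mul hs hr (hrs ▸ hp))
    have h2 := boxPoly_coeff (support_subset_of_mul hr hs (by rwa [mul_comm, ← hrs]))
    have := h (fun e => r.coeff e) (fun e => s.coeff e) (by rw [h2, h1]; exact hrs)
    rwa [h2, h1] at this

end BoundedDegree

variable {k : Type u} [Field k] {m n : ℕ} {α : Type*}

/-- A family of polynomials over the rings with operations whose coefficients are given by terms and
whose support is bounded. -/
def IsPolyFn (F : ∀ R : OpRing.{u, w} k m, (α → R) → MvPolynomial (Fin n) R) : Prop :=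
  (∃ E : Finset (Fin n →₀ ℕ), ∀ R v, (F R v).support ⊆ E) ∧
    ∀ e, IsTermFn fun R v => (F R v).coeff e

namespace IsPolyFn

variable {F G : ∀ R : OpRing.{u, w} k m, (α → R) → MvPolynomial (Fin n) R}

theorem box {d : Fin n →₀ ℕ} {y : ∀ R : OpRing.{u, w} k m, (α → R) → Finset.Iic d → R}
    (hy : ∀ e, IsTermFn fun R v => y R v e) : IsPolyFn fun R v => boxPoly d (y R v) := by
  refine ⟨⟨Finset.Iic d, fun R v => support_boxPoly _⟩, fun e => ?_⟩
  simp only [coeff_boxPoly]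
  split_ifs with h
  · exact hy _
  · exact IsTermFn.zero

theorem one : IsPolyFn.{u, w} (k := k) (m := m) (n := n) (α := α) fun _ _ => 1 := by
  classical
  refine ⟨⟨{0}, fun R v e he => ?_⟩, fun e => ?_⟩
  · by_contra h
    rw [mem_support_iff, coeff_one, if_neg (fun h' => h (by simp [← h']))] at he
    exact he rfl
  · simp only [coeff_one]
    split_ifs
    · exact IsTermFn.one
    · exact IsTermFn.zero

open scoped Pointwise in
theorem mul (hF : IsPolyFn F) (hG : IsPolyFn G) : IsPolyFn fun R v => F R v * G R v := by
  classical
  obtain ⟨⟨E, hE⟩, hF⟩ := hF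
  obtain ⟨⟨E', hE'⟩, hG⟩ := hG
  refine ⟨⟨E + E', fun R v => (support_mul _ _).trans (Finset.add_subset_add (hE R v) (hE' R v))⟩,
    fun e => ?_⟩
  simp only [coeff_mul]
  exact IsTermFn.sum _ fun x _ => (hF _).mul (hG _)

theorem eval (hF : IsPolyFn F) {c : ∀ R : OpRing.{u, w} k m, (α → R) → Fin n → R}
    (hc : ∀ i, IsTermFn fun R v => c R v i) :
    IsTermFn fun R v => MvPolynomial.eval (c R v) (F R v) := by
  obtain ⟨⟨E, hE⟩, hF⟩ := hF
  have h : ∀ R v, MvPolynomial.eval (c R v) (F R v) =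
      ∑ e ∈ E, (F R v).coeff e * ∏ i, c R v i ^ e i := by
    intro R v
    rw [eval_eq']
    refine Finset.sum_subset (hE R v) fun e _ he => ?_
    rw [notMem_support_iff.1 he, zero_mul]
  simp only [h]
  exact IsTermFn.sum _ fun e _ => (hF e).mul (IsTermFn.prod _ fun i _ => (hc i).pow _)

theorem isDefinable_eq (hF : IsPolyFn F) (hG : IsPolyFn G) :
    IsDefinable fun R v => F R v = G R v := by
  classical
  obtain ⟨⟨E, hE⟩, hF⟩ := hF
  obtain ⟨⟨E', hE'⟩, hG⟩ := hG
  have h : ∀ R v, F R v = G R v ↔ ∀ e ∈ E ∪ E', (F R v).coeff e = (G R v).coeff e := by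
    intro R v
    refine ⟨fun h e _ => by rw [h], fun h => MvPolynomial.ext _ _ fun e => ?_⟩
    by_cases he : e ∈ E ∪ E'
    · exact h e he
    · rw [Finset.mem_union, not_or] at he
      rw [notMem_support_iff.1 fun h' => he.1 (hE R v h'),
        notMem_support_iff.1 fun h' => he.2 (hE' R v h')]
  simp only [h]
  exact IsDefinable.forall_mem _ fun e => IsDefinable.eq (hF e) (hG e)

theorem comp_inl {β : Type*} (hF : IsPolyFn F) :
    IsPolyFn fun R (v : α ⊕ β → R) => F R (v ∘ Sum.inl) := by
  obtain ⟨⟨E, hE⟩, hF⟩ := hF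
  refine ⟨⟨E, fun R v => hE R _⟩, fun e => ?_⟩
  obtain ⟨t, ht⟩ := hF e
  exact ⟨t.relabel Sum.inl, fun R v => by rw [Term.realize_relabel, ht]⟩

theorem isDefinable_exists_mul_box (d : Fin n →₀ ℕ) (hF : IsPolyFn F) (hG : IsPolyFn G) :
    IsDefinable fun R v => ∃ y, G R v = F R v * boxPoly d y :=
  IsDefinable.ex (hG.comp_inl.isDefinable_eq
    (hF.comp_inl.mul (IsPolyFn.box fun e => IsTermFn.var (Sum.inr e))))

theorem isDefinable_irreducible (d : Fin n →₀ ℕ) (hF : IsPolyFn F) :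
    IsDefinable fun R v => (¬ ∃ y, 1 = F R v * boxPoly d y) ∧
      ∀ y z, F R v = boxPoly d y * boxPoly d z →
        (∃ s, 1 = boxPoly d y * boxPoly d s) ∨ ∃ s, 1 = boxPoly d z * boxPoly d s := by
  have hy : IsPolyFn fun (R : OpRing.{u, w} k m) (v : (α ⊕ Finset.Iic d) ⊕ Finset.Iic d → R) =>
      boxPoly d ((v ∘ Sum.inl) ∘ Sum.inr) :=
    IsPolyFn.box fun e => IsTermFn.var (Sum.inl (Sum.inr e))
  have hz : IsPolyFn fun (R : OpRing.{u, w} k m) (v : (α ⊕ Finset.Iic d) ⊕ Finset.Iic d → R) =>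
      boxPoly d (v ∘ Sum.inr) :=
    IsPolyFn.box fun e => IsTermFn.var (Sum.inr e)
  exact (hF.isDefinable_exists_mul_box d one).not.and (IsDefinable.all (IsDefinable.all
    ((hF.comp_inl.comp_inl.isDefinable_eq (hy.mul hz)).imp
      ((hy.isDefinable_exists_mul_box d one).or (hz.isDefinable_exists_mul_box d one)))))

end IsPolyFn

variable {H : Type v} [CommRing H] [HopfAlgebra k H] (b : Module.Basis (Fin (m + 1)) k H)

theorem isDefinable_isConst {f : ∀ R : OpRing.{u, w} k m, (α → R) → R} (hf : IsTermFn f) :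
    IsDefinable fun R v => R.IsConst b (f R v) :=
  IsDefinable.forall_fintype fun j => IsDefinable.eq (hf.op j) (hf.smul _)

/-- The first axiom on constants. -/
theorem isDefinable_det : IsDefinable fun (R : OpRing.{u, w} k m) (_ : Empty → R) =>
    ∃ a : Fin (m + 1) → R, ¬ (Matrix.of fun i j => R.op j (a i)).det = 0 :=
  IsDefinable.ex (IsDefinable.eq (IsTermFn.det fun i j => (IsTermFn.var (Sum.inr i)).op j)
    IsTermFn.zero).not

/-- The second axiom on constants, for polynomials with exponents below `d`. Units, irreducible
polynomials and divisibility are expressed by means of polynomials with exponents below `d`. -/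
theorem isDefinable_points (d : Fin n →₀ ℕ) :
    IsDefinable fun (R : OpRing.{u, w} k m) (_ : Empty → R) =>
      ∀ y z : Finset.Iic d → R, (∀ e, R.IsConst b (y e)) → (∀ e, R.IsConst b (z e)) →
        ((¬ ∃ s, 1 = boxPoly d y * boxPoly d s) ∧
          ∀ s t, boxPoly d y = boxPoly d s * boxPoly d t →
            (∃ r, 1 = boxPoly d s * boxPoly d r) ∨ ∃ r, 1 = boxPoly d t * boxPoly d r) →
        (¬ ∃ s, boxPoly d z = boxPoly d y * boxPoly d s) →
        ∃ c : Fin n → R, (∀ i, R.IsConst b (c i)) ∧ MvPolynomial.eval c (boxPoly d y) = 0 ∧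
          ¬ MvPolynomial.eval c (boxPoly d z) = 0 := by
  have hy : IsPolyFn fun (R : OpRing.{u, w} k m) (v : (Empty ⊕ Finset.Iic d) ⊕ Finset.Iic d → R) =>
      boxPoly d ((v ∘ Sum.inl) ∘ Sum.inr) :=
    IsPolyFn.box fun e => IsTermFn.var (Sum.inl (Sum.inr e))
  have hz : IsPolyFn fun (R : OpRing.{u, w} k m) (v : (Empty ⊕ Finset.Iic d) ⊕ Finset.Iic d → R) =>
      boxPoly d (v ∘ Sum.inr) :=
    IsPolyFn.box fun e => IsTermFn.var (Sum.inr e)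
  refine IsDefinable.all (IsDefinable.all (IsDefinable.imp
    (IsDefinable.forall_fintype fun e => isDefinable_isConst b (IsTermFn.var (Sum.inl (Sum.inr e))))
    (IsDefinable.imp
      (IsDefinable.forall_fintype fun e => isDefinable_isConst b (IsTermFn.var (Sum.inr e)))
      ((hy.isDefinable_irreducible d).imp ((hy.isDefinable_exists_mul_box d hz).not.imp
        (IsDefinable.ex ((IsDefinable.forall_fintype fun i =>
          isDefinable_isConst b (IsTermFn.var (Sum.inr i))).and
          ((IsDefinable.eq (hy.comp_inl.eval fun i => IsTermFn.var (Sum.inr i)) IsTermFn.zero).and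
            (IsDefinable.eq (hz.comp_inl.eval fun i => IsTermFn.var (Sum.inr i))
              IsTermFn.zero).not))))))))

theorem exists_support_subset_Iic {R : Type*} [CommSemiring R] (p q : MvPolynomial (Fin n) R) :
    ∃ d : Fin n →₀ ℕ, p.support ⊆ Finset.Iic d ∧ q.support ⊆ Finset.Iic d := by
  classical
  obtain ⟨d, hd⟩ := (p.support ∪ q.support).bddAbove
  exact ⟨d, fun e he => Finset.mem_Iic.2 (hd (Finset.mem_union_left _ he)),
    fun e he => Finset.mem_Iic.2 (hd (Finset.mem_union_right _ he))⟩

/-- The axioms on constants are expressed by a set of sentences. -/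
theorem exists_theory_constantAxioms (hb : IsAdapted b) : ∃ T : (gLanguage k m).Theory,
    ∀ (K : Type w) [Field K] [Algebra k K] (d : GAction k H K),
      (∀ φ ∈ T, @Sentence.Realize _ K (gStructure b d) φ) ↔ ConstantAxioms b d := by
  obtain ⟨θ, hθ⟩ := isDefinable_det.{u, w} (k := k) (m := m)
  choose ψ hψ using fun (n : ℕ) (d : Fin n →₀ ℕ) => isDefinable_points.{u, v, w} b d
  refine ⟨insert θ {φ | ∃ n d, φ = ψ n d}, fun K _ _ δ => ?_⟩
  have hθ := hθ (OpRing.ofAction hb δ) default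
  have hψ := fun n d => hψ n d (OpRing.ofAction hb δ) default
  have hconst : ∀ r : K, (OpRing.ofAction hb δ).IsConst b r ↔ IsConst δ r :=
    fun r => (isConst_iff b δ r).symm
  constructor
  · intro h
    refine ⟨hθ.1 (h θ (Set.mem_insert _ _)), fun n f g hf hg hirr hdvd => ?_⟩
    obtain ⟨d, hfd, hgd⟩ := exists_support_subset_Iic f g
    have := (hψ n d).1 (h (ψ n d) (Set.mem_insert_of_mem _ ⟨n, d, rfl⟩))
      (fun e => f.coeff e) (fun e => g.coeff e)
      (fun e => (hconst _).2 (hf e)) (fun e => (hconst _).2 (hg e))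
    simp only [hconst] at this
    rw [boxPoly_coeff hfd, boxPoly_coeff hgd, ← dvd_iff_exists_boxPoly hgd] at this
    simp only [← isUnit_iff_exists_boxPoly] at this
    exact this ((irreducible_iff_boxPoly hfd).1 hirr) hdvd
  · rintro ⟨h1, h2⟩ φ (rfl | ⟨n, d, rfl⟩)
    · exact hθ.2 h1
    · refine (hψ n d).2 fun y z hy hz hirr hdvd => ?_
      simp only [hconst] at hy hz ⊢
      refine h2 n (boxPoly d y) (boxPoly d z) (fun e => ?_) (fun e => ?_) ?_ ?_
      · rw [coeff_boxPoly]
        split_ifs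
        · exact hy _
        · exact (constants δ).zero_mem
      · rw [coeff_boxPoly]
        split_ifs
        · exact hz _
        · exact (constants δ).zero_mem
      · rw [irreducible_iff_boxPoly (support_boxPoly y)]
        simp only [isUnit_iff_exists_boxPoly (d := d)]
        exact hirr
      · rw [dvd_iff_exists_boxPoly (support_boxPoly z)]
        exact hdvd

end AxiomScheme

section ModelTheory

/-! ### Existentially closed structures in a class -/

open FirstOrder FirstOrder.Language CategoryTheory

variable {L : FirstOrder.Language.{u, 0}}

section Formulas

/-- The truth of a formula depends only on the values of its free variables. -/
theorem realize_congr_of_freeVar {α M : Type*} [L.Structure M] [DecidableEq α] (φ : L.Formula α)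
    {v v' : α → M} (h : ∀ a ∈ φ.freeVarFinset, v a = v' a) : φ.Realize v ↔ φ.Realize v' := by
  have h1 := BoundedFormula.realize_restrictFreeVar (φ := φ) (f := fun a => (a : α)) (v := v)
    (xs := default) v fun _ => rfl
  have h2 := BoundedFormula.realize_restrictFreeVar (φ := φ) (f := fun a => a) (v := fun a => v a)
    (xs := default) v fun _ => rfl
  have h3 := BoundedFormula.realize_restrictFreeVar (φ := φ) (f := fun a => a) (v := fun a => v a)
    (xs := default) v' fun a => h a a.2
  exact h2.symm.trans h3

theorem realize_embedding_of_isQF {α M N : Type*} [L.Structure M] [L.Structure N] (f : M ↪[L] N)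
    {φ : L.Formula α} (hφ : φ.IsQF) (v : α → M) : φ.Realize (f ∘ v) ↔ φ.Realize v := by
  have := hφ.realize_embedding f (v := v) (xs := default)
  rwa [Subsingleton.elim (f ∘ default) (default : Fin 0 → N)] at this

/-- A map which preserves the quantifier-free formulas is an embedding. -/
theorem exists_embedding {M N : Type*} [L.Structure M] [L.Structure N] (s : M → N)
    (h : ∀ φ : L.Formula M, φ.IsQF → φ.Realize (id : M → M) → φ.Realize s) :
    ∃ f : M ↪[L] N, ⇑f = s := by
  have hinj : Function.Injective s := by
    intro x y hxy
    by_contra hne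
    have := h (Term.equal (Term.var x) (Term.var y)).not
      (BoundedFormula.IsAtomic.equal _ _).isQF.not (by simpa using hne)
    rw [Formula.realize_not, Formula.realize_equal] at this
    exact this hxy
  refine ⟨⟨⟨s, hinj⟩, fun {n} F x => ?_, fun {n} r x => ?_⟩, rfl⟩
  · have := h (Term.equal (Term.var (Structure.funMap F x)) (Term.func F fun i => Term.var (x i)))
      (BoundedFormula.IsAtomic.equal _ _).isQF (by rw [Formula.realize_equal]; rfl)
    rw [Formula.realize_equal] at this
    exact this
  · have hr : (r.formula fun i => Term.var (x i)).IsQF :=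
      (BoundedFormula.IsAtomic.rel _ _).isQF
    have h1 := h _ hr
    have h2 := h _ hr.not
    rw [Formula.realize_not, Formula.realize_not] at h2
    rw [Formula.realize_rel, Formula.realize_rel] at h1 h2
    exact ⟨fun hs => not_not.1 fun hn => h2 hn hs, h1⟩

theorem exists_conj {α : Type*} (Δ : Finset (L.Formula α)) (hΔ : ∀ φ ∈ Δ, φ.IsQF) :
    ∃ θ : L.Formula α, θ.IsQF ∧ ∀ (M : Type w) [L.Structure M] (v : α → M),
      θ.Realize v ↔ ∀ φ ∈ Δ, φ.Realize v := by
  classical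
  induction Δ using Finset.induction_on with
  | empty => exact ⟨⊤, BoundedFormula.IsQF.top, fun M _ v => by simp⟩
  | insert φ Δ _ ih =>
    obtain ⟨θ, hθ, h⟩ := ih fun φ hφ => hΔ φ (Finset.mem_insert_of_mem hφ)
    refine ⟨φ ⊓ θ, (hΔ φ (Finset.mem_insert_self _ _)).inf hθ, fun M _ v => ?_⟩
    rw [Formula.realize_inf, h, Finset.forall_mem_insert]

end Formulas

/-- The structure `M` is existentially closed for the class `𝒞`: every quantifier-free formula with
parameters from `M` which is realised in an extension of `M` in `𝒞` is realised in `M`. -/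
def IsECIn (𝒞 : Set (Bundled.{w} L.Structure)) (M : Bundled.{w} L.Structure) : Prop :=
  ∀ N ∈ 𝒞, ∀ (f : M ↪[L] N) (n : ℕ) (ψ : L.Formula (M ⊕ Fin n)), ψ.IsQF →
    (∃ x : Fin n → N, ψ.Realize (Sum.elim f x)) → ∃ a : Fin n → M, ψ.Realize (Sum.elim id a)

/-- The class `𝒞` is closed under ultraproducts. -/
def ClosedUnderUltraproducts (𝒞 : Set (Bundled.{w} L.Structure)) : Prop :=
  ∀ (I : Type w) (U : Ultrafilter I) (N : I → Bundled.{w} L.Structure), (∀ i, N i ∈ 𝒞) →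
    (⟨(U : Filter I).Product fun i => N i, Ultraproduct.structure⟩ : Bundled.{w} L.Structure) ∈ 𝒞

/-- The class `𝒞` is closed under unions of countable chains. -/
def ClosedUnderChains (𝒞 : Set (Bundled.{w} L.Structure)) : Prop :=
  ∀ (G : ℕ → Bundled.{w} L.Structure) (f : ∀ n, G n ↪[L] G (n + 1)), (∀ n, G n ∈ 𝒞) →
    (⟨Language.DirectLimit (fun n => G n) fun i j h => DirectedSystem.natLERec f i j h,
      DirectLimit.instStructureDirectLimit _ _⟩ : Bundled.{w} L.Structure) ∈ 𝒞

variable {𝒞 : Set (Bundled.{w} L.Structure)}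

/-- Given finitely many quantifier-free formulas which hold in an extension `N` of `M`, the elements
of `N` can be replaced by elements of `M`. Only finitely many elements of `N` occur. -/
theorem IsECIn.exists_map {M N : Bundled.{w} L.Structure} (hM : IsECIn 𝒞 M) [Nonempty M]
    (hN : N ∈ 𝒞) (f : M ↪[L] N) (Δ : Finset (L.Formula (M ⊕ N))) (hΔ : ∀ φ ∈ Δ, φ.IsQF)
    (h : ∀ φ ∈ Δ, φ.Realize (Sum.elim f id)) :
    ∃ s : N → M, ∀ φ ∈ Δ, φ.Realize (Sum.elim id s) := by
  classical
  obtain ⟨θ, hθ, hΔθ⟩ := exists_conj.{u, w} Δ hΔ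
  rw [← hΔθ] at h
  let F : Finset N := θ.freeVarFinset.toRight
  let e := F.equivFin
  let g : N → M ⊕ Fin F.card := fun y =>
    if hy : y ∈ F then Sum.inr (e ⟨y, hy⟩) else Sum.inl (Classical.arbitrary M)
  have hg : (θ.relabel (Sum.elim Sum.inl g)).Realize (Sum.elim f fun i => (e.symm i : N)) := by
    rw [Formula.realize_relabel, realize_congr_of_freeVar θ (v' := Sum.elim f id)]
    · exact h
    · rintro (x | y) hy
      · rfl
      · have hy : y ∈ F := Finset.mem_toRight.2 hy
        simp [g, hy]
  obtain ⟨a, ha⟩ := hM N hN f _ (θ.relabel (Sum.elim Sum.inl g)) (hθ.relabel _) ⟨_, hg⟩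
  rw [Formula.realize_relabel] at ha
  refine ⟨Sum.elim id a ∘ g, (hΔθ M _).1 ?_⟩
  convert ha using 1
  funext x
  rcases x with x | y <;> rfl

/-- Maps which preserve each quantifier-free formula almost everywhere give an embedding into the
ultraproduct. -/
theorem exists_embedding_ultraproduct {M : Type*} [L.Structure M] {I : Type*} (U : Ultrafilter I)
    (N : I → Type*) [∀ i, L.Structure (N i)] [∀ i, Nonempty (N i)] (s : ∀ i, M → N i)
    (h : ∀ φ : L.Formula M, φ.IsQF → φ.Realize (id : M → M) → ∀ᶠ i in (U : Filter I),
      φ.Realize (s i)) :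
    ∃ f : M ↪[L] (U : Filter I).Product N, ∀ x,
      f x = ((fun i => s i x : ∀ i, N i) : (U : Filter I).Product N) := by
  obtain ⟨f, hf⟩ := exists_embedding (L := L)
    (fun x => ((fun i => s i x : ∀ i, N i) : (U : Filter I).Product N))
    (fun φ hφ hx => (Ultraproduct.realize_formula_cast φ fun x i => s i x).2 (h φ hφ hx))
  exact ⟨f, fun x => congrFun hf x⟩

/-- Every extension of an existentially closed structure `M` in the class embeds over `M` into an
ultrapower of `M`. The index set consists of the finite sets of quantifier-free formulas with
parameters which hold in the extension. -/
theorem IsECIn.exists_ultrapower {M N : Bundled.{max u w} L.Structure}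
    {𝒞 : Set (Bundled.{max u w} L.Structure)} (hM : IsECIn 𝒞 M)
    [Nonempty M] (hN : N ∈ 𝒞) (f : M ↪[L] N) :
    ∃ (I : Type (max u w)) (U : Ultrafilter I) (g : N ↪[L] (U : Filter I).Product fun _ => M),
      ∀ x, g (f x) = ((fun _ => x : I → M) : (U : Filter I).Product fun _ => M) := by
  classical
  let A := {φ : L.Formula (M ⊕ N) // φ.IsQF ∧ φ.Realize (Sum.elim f id)}
  choose s hs using fun Δ : Finset A => hM.exists_map hN f (Δ.map (Function.Embedding.subtype _))
    (by simp only [Finset.mem_map]; rintro φ ⟨ψ, -, rfl⟩; exact ψ.2.1)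
    (by simp only [Finset.mem_map]; rintro φ ⟨ψ, -, rfl⟩; exact ψ.2.2)
  let U : Ultrafilter (Finset A) := Ultrafilter.of Filter.atTop
  have key : ∀ φ : A, ∀ᶠ Δ in (U : Filter (Finset A)), φ.1.Realize (Sum.elim id (s Δ)) := by
    intro φ
    refine Ultrafilter.of_le _ ((Filter.eventually_ge_atTop {φ}).mono fun Δ hΔ => hs Δ φ.1 ?_)
    exact Finset.mem_map.2 ⟨φ, hΔ (Finset.mem_singleton_self _), rfl⟩
  obtain ⟨g, hg⟩ := exists_embedding_ultraproduct (L := L) U (fun _ => M) s fun φ hφ hx => by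
    have := key ⟨φ.relabel Sum.inr, hφ.relabel _, by rw [Formula.realize_relabel]; exact hx⟩
    simp only [Formula.realize_relabel] at this
    exact this
  refine ⟨Finset A, U, g, fun x => ?_⟩
  rw [hg]
  refine Quotient.sound' ?_
  have := key ⟨Term.equal (Term.var (Sum.inl x)) (Term.var (Sum.inr (f x))),
    (BoundedFormula.IsAtomic.equal _ _).isQF, by rw [Formula.realize_equal]; rfl⟩
  refine this.mono fun Δ hΔ => ?_
  rw [Formula.realize_equal] at hΔ
  exact hΔ.symm

/-- Robinson's criterion: embeddings between the models of a theory are elementary if all models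
are existentially closed in a class which contains them. In the step from `M` to its extension `N`,
for a universal quantifier, `N` is embedded over `M` into an ultrapower of `M`, and the induction
hypothesis is applied to this embedding. -/
theorem isModelComplete_of_isECIn {T : L.Theory} {𝒞 : Set (Bundled.{max u w} L.Structure)}
    (hT : ∀ M : Bundled.{max u w} L.Structure, M ⊨ T → Nonempty M ∧ M ∈ 𝒞 ∧ IsECIn 𝒞 M) :
    IsModelComplete.{u, w} T := by
  have key : ∀ {α : Type} {n : ℕ} (φ : L.BoundedFormula α n)
      (M N : Bundled.{max u w} L.Structure), M ⊨ T → N ⊨ T → ∀ (f : M ↪[L] N) (v : α → M)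
      (xs : Fin n → M), φ.Realize (f ∘ v) (f ∘ xs) ↔ φ.Realize v xs := by
    intro α n φ
    induction φ with
    | falsum => intros; rfl
    | equal t₁ t₂ =>
      intro M N _ _ f v xs
      exact (BoundedFormula.IsAtomic.equal t₁ t₂).isQF.realize_embedding f
    | rel R ts =>
      intro M N _ _ f v xs
      exact (BoundedFormula.IsAtomic.rel R ts).isQF.realize_embedding f
    | imp φ ψ ih₁ ih₂ =>
      intro M N hM hN f v xs
      exact imp_congr (ih₁ M N hM hN f v xs) (ih₂ M N hM hN f v xs)
    | @all n φ ih =>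
      intro M N hM hN f v xs
      constructor
      · intro h x
        rw [← ih M N hM hN f v, Fin.comp_snoc]
        exact h (f x)
      · intro h y
        obtain ⟨hne, -, hec⟩ := hT M hM
        obtain ⟨I, U, g, hg⟩ := hec.exists_ultrapower (hT N hN).2.1 f
        let P : Bundled.{max u w} L.Structure := Bundled.of ((U : Filter I).Product fun _ => M)
        have hP : P ⊨ T := Theory.model_iff _ |>.2 fun σ hσ =>
          (Ultraproduct.sentence_realize σ).2 (Filter.Eventually.of_forall fun _ =>
            (Theory.model_iff _).1 hM σ hσ)
        rw [← ih N P hN hP g, Fin.comp_snoc]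
        have h1 := (Ultraproduct.boundedFormula_realize_cast (u := U) (M := fun _ => M) φ.all
          (fun a _ => v a) (fun i _ => xs i)).2 (Filter.Eventually.of_forall fun _ => h)
        have h2 := h1 (g y)
        convert! h2 using 1
        · funext a; exact hg _
        · congr 1
          funext a; exact hg _
  intro M N _ _ hM hN f n φ x
  exact (Iff.of_eq (congrArg (BoundedFormula.Realize φ (f ∘ x)) (Subsingleton.elim _ _))).trans
    (key φ (Bundled.of M) (Bundled.of N) hM hN f x default)

/-- A quantifier-free condition with parameters from `M`. -/
abbrev Task (M : Type*) [L.Structure M] : Type _ :=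
  Σ n : ℕ, {ψ : L.Formula (M ⊕ Fin n) // ψ.IsQF}

/-- The quantifier-free condition `t` with parameters from `M` is realised in the extension `N` of
`M`. -/
def Task.RealizedIn {M N : Type*} [L.Structure M] [L.Structure N] (t : Task (L := L) M)
    (f : M → N) : Prop :=
  ∃ x : Fin t.1 → N, t.2.1.Realize (Sum.elim f x)

theorem Task.RealizedIn.comp {M N P : Type*} [L.Structure M] [L.Structure N] [L.Structure P]
    {t : Task (L := L) M} {f : M → N} (h : t.RealizedIn f) (g : N ↪[L] P) :
    t.RealizedIn (g ∘ f) := by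
  obtain ⟨x, hx⟩ := h
  refine ⟨g ∘ x, ?_⟩
  rw [← Sum.comp_elim]
  exact (realize_embedding_of_isQF g t.2.2 _).2 hx

/-- Every structure in the class has an extension in which all those quantifier-free conditions with
parameters from the structure are realised which are realised in a further extension. By
compactness, in the form of ultraproducts, the sets of conditions which are realised together in some
extension form a family of finite character, so that there is a maximal one. -/
theorem exists_extension_realizing {𝒞 : Set (Bundled.{max u w} L.Structure)}
    (hne : ∀ N ∈ 𝒞, Nonempty N) (hU : ClosedUnderUltraproducts 𝒞)
    {M : Bundled.{max u w} L.Structure} (hM : M ∈ 𝒞) :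
    ∃ M' ∈ 𝒞, ∃ f : M ↪[L] M', ∀ N ∈ 𝒞, ∀ (g : M' ↪[L] N) (t : Task (L := L) M),
      t.RealizedIn (g ∘ f) → t.RealizedIn f := by
  classical
  let F : Set (Set (Task (L := L) M)) :=
    {A | ∃ N ∈ 𝒞, ∃ f : M ↪[L] N, ∀ t ∈ A, t.RealizedIn f}
  have hF : Order.IsOfFiniteCharacter F := by
    intro A
    constructor
    · rintro ⟨N, hN, f, h⟩ B hB -
      exact ⟨N, hN, f, fun t ht => h t (hB ht)⟩
    · intro h
      choose N hN f hf using fun Δ : Finset A =>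
        h (Δ.map (Function.Embedding.subtype _) : Finset (Task (L := L) M))
          (by intro t; simp only [Finset.coe_map]; rintro ⟨s, -, rfl⟩; exact s.2)
          (Finset.finite_toSet _)
      have : ∀ Δ, Nonempty (N Δ) := fun Δ => hne _ (hN Δ)
      let U : Ultrafilter (Finset A) := Ultrafilter.of Filter.atTop
      obtain ⟨g, hg⟩ := exists_embedding_ultraproduct (L := L) U (fun Δ => N Δ) (fun Δ => f Δ)
        fun φ hφ hx => Filter.Eventually.of_forall fun Δ =>
          (realize_embedding_of_isQF (f Δ) hφ id).2 hx
      refine ⟨_, hU _ U N hN, g, fun t ht => ?_⟩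
      have key : ∀ᶠ Δ in (U : Filter (Finset A)), t.RealizedIn (f Δ) := by
        refine Ultrafilter.of_le _ ((Filter.eventually_ge_atTop {⟨t, ht⟩}).mono fun Δ hΔ =>
          hf Δ t ?_)
        exact Finset.mem_coe.2
          (Finset.mem_map.2 ⟨⟨t, ht⟩, hΔ (Finset.mem_singleton_self _), rfl⟩)
      have hex : ∀ Δ, ∃ x : Fin t.1 → N Δ,
          t.RealizedIn (f Δ) → t.2.1.Realize (Sum.elim (f Δ) x) := fun Δ => by
        by_cases h : t.RealizedIn (f Δ)
        · exact ⟨h.choose, fun _ => h.choose_spec⟩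
        · exact ⟨fun _ => Classical.arbitrary _, fun h' => (h h').elim⟩
      choose x hx using hex
      refine ⟨fun i => ((fun Δ => x Δ i : ∀ Δ, N Δ) : (U : Filter _).Product fun Δ => N Δ), ?_⟩
      have := (Ultraproduct.realize_formula_cast (u := U) t.2.1
        (fun a Δ => Sum.elim (f Δ) (x Δ) a)).2 (key.mono fun Δ hΔ => hx Δ hΔ)
      convert! this using 1
      funext a
      rcases a with a | i
      · exact hg a
      · rfl
  obtain ⟨A, -, hA⟩ := hF.exists_maximal (x := ∅)
    ⟨M, hM, Embedding.refl L M, fun t ht => ht.elim⟩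
  obtain ⟨M', hM', f, hf⟩ := hA.prop
  refine ⟨M', hM', f, fun N hN g t ht => hf t ?_⟩
  refine hA.le_of_ge (y := insert t A) ⟨N, hN, g.comp f, ?_⟩ (Set.subset_insert _ _)
    (Set.mem_insert _ _)
  rintro s (rfl | hs)
  · exact ht
  · exact (hf s hs).comp g

/-- Every structure in the class has an existentially closed extension in the class, namely the
union of a chain in which each step realises the conditions over the previous structure. -/
theorem exists_isECIn_extension {𝒞 : Set (Bundled.{max u w} L.Structure)}
    (hne : ∀ N ∈ 𝒞, Nonempty N) (hU : ClosedUnderUltraproducts 𝒞) (hC : ClosedUnderChains 𝒞)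
    {M : Bundled.{max u w} L.Structure} (hM : M ∈ 𝒞) :
    ∃ N ∈ 𝒞, IsECIn 𝒞 N ∧ Nonempty (M ↪[L] N) := by
  classical
  choose next hnext emb hemb using fun M : 𝒞 => exists_extension_realizing hne hU M.2
  let G : ℕ → 𝒞 := fun n => Nat.rec ⟨M, hM⟩ (fun _ M => ⟨next M, hnext M⟩) n
  let f : ∀ n, (G n).1 ↪[L] (G (n + 1)).1 := fun n => emb (G n)
  let F : ∀ i j : ℕ, i ≤ j → (G i).1 ↪[L] (G j).1 := fun i j h =>
    DirectedSystem.natLERec (G' := fun n => (G n).1) f i j h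
  let D : Bundled.{max u w} L.Structure :=
    ⟨Language.DirectLimit (fun n => (G n).1) F, DirectLimit.instStructureDirectLimit _ _⟩
  have hD : D ∈ 𝒞 := hC (fun n => (G n).1) f fun n => (G n).2
  let o : ∀ i, (G i).1 ↪[L] D := fun i => DirectLimit.of L ℕ (fun n => (G n).1) F i
  have ho : ∀ i x, o (i + 1) (f i x) = o i x := fun i x => by
    have h1 : F i (i + 1) (Nat.le_succ i) x = f i x := by
      change DirectedSystem.natLERec (G' := fun n => (G n).1) f i (i + 1) (Nat.le_succ i) x = f i x
      rw [DirectedSystem.coe_natLERec]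
      exact Nat.leRecOn_succ' (C := fun n => (G n).1) x
    rw [← h1]
    exact DirectLimit.of_f
  refine ⟨D, hD, ?_, ⟨o 0⟩⟩
  rintro N hN g n ψ hψ ⟨x, hx⟩
  let S : Finset D := BoundedFormula.freeVarFinset ψ |>.toLeft
  obtain ⟨i, y, hy⟩ := DirectLimit.exists_quotient_mk'_sigma_mk'_eq (fun n => (G n).1) F
    (fun p : S => (p : Language.DirectLimit (fun n => (G n).1) F))
  have hy : ∀ p : S, o i (y p) = p := fun p => (congrFun hy p).symm
  have : Nonempty (G i).1 := hne _ (G i).2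
  let s : D → (G i).1 := fun p => if h : p ∈ S then y ⟨p, h⟩ else Classical.arbitrary _
  have hs : ∀ p ∈ S, o i (s p) = p := fun p hp => by
    simp only [s, dif_pos hp]
    exact hy ⟨p, hp⟩
  let t : Task (L := L) (G i).1 := ⟨n, ψ.relabel (Sum.map s id), hψ.relabel _⟩
  have ht : t.RealizedIn ((g.comp (o (i + 1))) ∘ f i) := by
    refine ⟨x, ?_⟩
    rw [Formula.realize_relabel, realize_congr_of_freeVar ψ (v' := Sum.elim g x)]
    · exact hx
    · rintro (p | j) hp
      · exact congrArg g ((ho i (s p)).trans (hs p (Finset.mem_toLeft.2 hp)))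
      · rfl
  obtain ⟨a, ha⟩ := (hemb (G i) N hN (g.comp (o (i + 1))) t ht).comp (o (i + 1))
  refine ⟨a, ?_⟩
  rw [Formula.realize_relabel] at ha
  rw [realize_congr_of_freeVar ψ (v' := Sum.elim ((o (i + 1)) ∘ f i) a ∘ Sum.map s id)]
  · exact ha
  · rintro (p | j) hp
    · exact ((ho i (s p)).trans (hs p (Finset.mem_toLeft.2 hp))).symm
    · rfl

end ModelTheory

section Class

/-! ### The class of `𝔤`-fields -/

open FirstOrder FirstOrder.Language CategoryTheory

variable {k : Type u} {H : Type v} [Field k] [CommRing H] [HopfAlgebra k H] {m : ℕ}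
  {b : Module.Basis (Fin (m + 1)) k H}

/-- The conditions by which `𝔤`-fields are recognised are of first order. -/
theorem SatisfiesIdentities.of_models {M : Type (max u w)} [(gLanguage k m).Structure M]
    (h : M ⊨ gDF.{u, v, w} b) : SatisfiesIdentities b M := by
  have hM : ∀ φ : (gLanguage k m).Sentence,
      (∀ (K : Type (max u w)) [Field K] [Algebra k K] (d : GAction k H K),
        @Sentence.Realize _ K (gStructure b d) φ) → M ⊨ φ :=
    fun φ hφ => (Theory.model_iff _).1 h φ hφ
  refine ⟨fun {n s t} hst v => ?_, ?_, ?_⟩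
  · let φ : (gLanguage k m).Formula (Empty ⊕ Fin n) := (s.equal t).relabel Sum.inr
    have := hM (φ.iAlls (Fin n)) fun K _ _ d => by
      let _ := gStructure b d
      rw [Sentence.Realize, Formula.realize_iAlls]
      intro v
      rw [Formula.realize_relabel, Formula.realize_equal]
      exact hst K d v
    rw [Sentence.Realize, Formula.realize_iAlls] at this
    have := this v
    rwa [Formula.realize_relabel, Formula.realize_equal] at this
  · let φ : (gLanguage k m).Formula Empty := (tZero.equal tOne).not
    have := hM φ fun K _ _ d => by
      let _ := gStructure b d
      rw [Sentence.Realize, Formula.realize_not, Formula.realize_equal]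
      exact zero_ne_one (α := K)
    rwa [Sentence.Realize, Formula.realize_not, Formula.realize_equal, realize_tZero,
      realize_tOne] at this
  · let x : (gLanguage k m).Term (Empty ⊕ Fin 1) := Term.var (Sum.inr 0)
    let x' : (gLanguage k m).Term ((Empty ⊕ Fin 1) ⊕ Fin 1) := Term.var (Sum.inl (Sum.inr 0))
    let y : (gLanguage k m).Term ((Empty ⊕ Fin 1) ⊕ Fin 1) := Term.var (Sum.inr 0)
    let φ : (gLanguage k m).Formula (Empty ⊕ Fin 1) :=
      (x.equal tZero).not.imp (((tMul x' y).equal tOne).iExs (Fin 1))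
    have := hM (φ.iAlls (Fin 1)) fun K _ _ d => by
      let _ := gStructure b d
      rw [Sentence.Realize, Formula.realize_iAlls]
      intro v
      rw [Formula.realize_imp, Formula.realize_not, Formula.realize_equal, Formula.realize_iExs]
      intro hv
      have hv : v 0 ≠ 0 := hv
      refine ⟨fun _ => (v 0)⁻¹, ?_⟩
      rw [Formula.realize_equal]
      exact mul_inv_cancel₀ hv
    rw [Sentence.Realize, Formula.realize_iAlls] at this
    intro z hz
    have := this fun _ => z
    rw [Formula.realize_imp, Formula.realize_not, Formula.realize_equal, Formula.realize_iExs,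
      realize_tZero] at this
    obtain ⟨i, hi⟩ := this hz
    rw [Formula.realize_equal, realize_tMul, realize_tOne] at hi
    exact ⟨i 0, hi⟩

theorem IsGFieldStructure.models {M : Type (max u w)} [inst : (gLanguage k m).Structure M]
    (h : IsGFieldStructure b M) : M ⊨ gDF.{u, v, w} b := by
  obtain ⟨_, _, d, rfl⟩ := h
  let _ := gStructure b d
  exact (Theory.model_iff _).2 fun φ hφ => hφ M d

theorem IsGFieldStructure.satisfiesIdentities {M : Type w} [inst : (gLanguage k m).Structure M]
    (h : IsGFieldStructure b M) : SatisfiesIdentities b M := by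
  obtain ⟨_, _, d, rfl⟩ := h
  let _ := gStructure b d
  exact ⟨fun {n s t} hst v => hst M d v, zero_ne_one (α := M),
    fun x hx => ⟨x⁻¹, mul_inv_cancel₀ (G₀ := M) hx⟩⟩

/-- The class of `𝔤`-fields, as structures. -/
def gFieldClass (b : Module.Basis (Fin (m + 1)) k H) : Set (Bundled.{w} (gLanguage k m).Structure) :=
  {M | IsGFieldStructure b M}

theorem nonempty_of_mem_gFieldClass (M : Bundled.{w} (gLanguage k m).Structure)
    (hM : M ∈ gFieldClass b) : Nonempty M := by
  obtain ⟨_, -, -, -⟩ := hM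
  exact ⟨0⟩

theorem closedUnderUltraproducts_gFieldClass (hb : IsAdapted b) :
    ClosedUnderUltraproducts (gFieldClass.{u, v, max u w} b) := by
  intro I U N hN
  have : ∀ i, Nonempty (N i) := fun i => nonempty_of_mem_gFieldClass _ (hN i)
  refine (SatisfiesIdentities.of_models.{u, v, w}
    ((Theory.model_iff _).2 fun φ hφ => ?_)).isGFieldStructure hb
  exact (Ultraproduct.sentence_realize φ).2 (Filter.Eventually.of_forall fun i =>
    (Theory.model_iff _).1 (IsGFieldStructure.models (hN i)) φ hφ)

/-- Identities, and the conditions on inverses, are preserved under unions of chains. -/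
theorem closedUnderChains_gFieldClass (hb : IsAdapted b) :
    ClosedUnderChains (gFieldClass.{u, v, w} b) := by
  intro G f hG
  let D := Language.DirectLimit (fun n => G n) fun i j h => DirectedSystem.natLERec f i j h
  let o : ∀ i, G i ↪[gLanguage k m] D := fun i => DirectLimit.of _ ℕ (fun n => G n)
    (fun i j h => DirectedSystem.natLERec f i j h) i
  have hI : ∀ i, SatisfiesIdentities b (G i) := fun i => IsGFieldStructure.satisfiesIdentities (hG i)
  have hmap : ∀ i {n : ℕ} (F : GFunc k m n) (x : Fin n → G i),
      o i (Structure.funMap (L := gLanguage k m) F x) =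
        Structure.funMap (L := gLanguage k m) F (o i ∘ x) := fun i n F x =>
    Language.Embedding.map_fun (o i) F x
  have h0 : ∀ i, o i (sZero k m (G i)) = sZero k m D := fun i =>
    (hmap i _ _).trans (congrArg _ (Subsingleton.elim _ _))
  have h1 : ∀ i, o i (sOne k m (G i)) = sOne k m D := fun i =>
    (hmap i _ _).trans (congrArg _ (Subsingleton.elim _ _))
  have hmul : ∀ i (x y : G i), o i (sMul k m x y) = sMul k m (o i x) (o i y) := fun i x y =>
    (hmap i _ _).trans (congrArg _ (funext fun j => by fin_cases j <;> rfl))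
  have hD : SatisfiesIdentities b D := by
    refine ⟨fun {n s t} hst v => ?_, ?_, fun x hx => ?_⟩
    · obtain ⟨i, y, hy⟩ := DirectLimit.exists_quotient_mk'_sigma_mk'_eq _ _ v
      have hv : v = o i ∘ y := hy
      rw [hv, HomClass.realize_term, HomClass.realize_term, (hI i).identity hst]
    · rw [← h0 0, ← h1 0]
      exact (o 0).injective.ne (hI 0).sZero_ne_sOne
    · obtain ⟨i, y, hy⟩ := DirectLimit.exists_of x
      have hy : o i y = x := hy
      obtain ⟨z, hz⟩ := (hI i).exists_inv y (by rintro rfl; exact hx (hy.symm.trans (h0 i)))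
      exact ⟨o i z, by rw [← hy, ← hmul, hz, h1]⟩
  exact hD.isGFieldStructure hb

/-- A morphism of `𝔤`-fields is an embedding of structures. -/
def IsGHom.toEmbedding {K L : Type*} [Field K] [Algebra k K] [Field L] [Algebra k L]
    {d : GAction k H K} {d' : GAction k H L} {φ : K →ₐ[k] L} (h : IsGHom d d' φ) :
    @Language.Embedding (gLanguage k m) K L (gStructure b d) (gStructure b d') :=
  letI := gStructure b d
  letI := gStructure b d'
  { toFun := φ
    inj' := φ.injective
    map_fun' := (h.toHom b).map_fun'
    map_rel' := fun r => r.elim }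

/-- An embedding of `𝔤`-fields as structures is a morphism of `𝔤`-fields. -/
theorem exists_isGHom_of_embedding (hb : IsAdapted b) {K L : Type*} [Field K] [Algebra k K]
    [Field L] [Algebra k L] {d : GAction k H K} {d' : GAction k H L}
    (f : @Language.Embedding (gLanguage k m) K L (gStructure b d) (gStructure b d')) :
    ∃ φ : K →ₐ[k] L, IsGHom d d' φ ∧ ∀ x, φ x = f.toFun x := by
  let _ := gStructure b d
  let _ := gStructure b d'
  have h0 : f.toFun 0 = 0 := f.map_fun' (GFunc.zero : GFunc k m 0) ![]
  have h1 : f.toFun 1 = 1 := f.map_fun' (GFunc.one : GFunc k m 0) ![]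
  have ha : ∀ x y, f.toFun (x + y) = f.toFun x + f.toFun y := fun x y =>
    f.map_fun' (GFunc.add : GFunc k m 2) ![x, y]
  have hm : ∀ x y, f.toFun (x * y) = f.toFun x * f.toFun y := fun x y =>
    f.map_fun' (GFunc.mul : GFunc k m 2) ![x, y]
  have hc : ∀ c, f.toFun (algebraMap k K c) = algebraMap k L c := fun c =>
    f.map_fun' (GFunc.const c : GFunc k m 0) ![]
  have ho : ∀ (j : Fin m) x, f.toFun (gOperator b d j.succ x) = gOperator b d' j.succ (f.toFun x) :=
    fun j x => f.map_fun' (GFunc.op j : GFunc k m 1) ![x]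
  refine ⟨{ toFun := f.toFun, map_one' := h1, map_mul' := hm, map_zero' := h0, map_add' := ha,
            commutes' := hc }, isGHom_of_gOperator b fun j x => ?_, fun x => rfl⟩
  rcases Fin.eq_zero_or_eq_succ j with rfl | ⟨j, rfl⟩
  · rw [hb.gOperator_zero, hb.gOperator_zero]
  · exact (ho j x).symm

theorem isECIn_iff_isExistentiallyClosed (hb : IsAdapted b) {K : Type w} [Field K] [Algebra k K]
    (d : GAction k H K) :
    IsECIn (gFieldClass b) (⟨K, gStructure b d⟩ : Bundled.{w} (gLanguage k m).Structure) ↔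
      IsExistentiallyClosed b d := by
  constructor
  · intro h L _ _ d' φ hφ n ψ hψ hx
    exact h ⟨L, gStructure b d'⟩ ⟨_, _, d', rfl⟩ hφ.toEmbedding n ψ hψ hx
  · rintro h ⟨N, inst⟩ hN f n ψ hψ ⟨x, hx⟩
    obtain ⟨_, _, d', rfl⟩ : IsGFieldStructure b N := hN
    obtain ⟨φ, hφ, hf⟩ := exists_isGHom_of_embedding hb (d := d) (d' := d') f
    refine h N d' φ hφ n ψ hψ ⟨x, ?_⟩
    have : (φ : K → N) = f := funext hf
    rw [this]
    exact hx

/-- Existential closedness is a matter of polynomial conditions on `∂(x)`, and these are what the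
geometric axioms are about. -/
theorem isExistentiallyClosed_iff_geometricAxioms (hb : IsAdapted b) {K : Type w} [Field K]
    [Algebra k K] (d : GAction k H K) : IsExistentiallyClosed b d ↔ GeometricAxioms b d :=
  (isExistentiallyClosed_iff_polyClosed hb d).trans
    ⟨fun h => h.geometricAxioms, fun h => h.polyClosed⟩

/-- The theory of the geometric axioms exists and is a model companion of the theory of `𝔤`-fields. -/
theorem exists_isModelCompanion_gDF (hb : IsAdapted b) :
    ∃ T : (gLanguage k m).Theory,
      (∀ (M : Type (max u w)) [(gLanguage k m).Structure M],
        M ⊨ T ↔ ∃ (K : Type (max u w)) (_ : Field K) (_ : Algebra k K)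
          (d : GAction k H K),
          Nonempty (@FirstOrder.Language.Equiv (gLanguage k m) M K _
            (gStructure b d)) ∧
          GeometricAxioms b d) ∧
      IsModelCompanion.{u, w} (gDF.{u, v, w} b) T := by
  obtain ⟨T, hT⟩ := exists_theory_constantAxioms.{u, v, max u w} b hb
  have hgeo : ∀ (K : Type (max u w)) [Field K] [Algebra k K] (d : GAction k H K),
      @Theory.Model (gLanguage k m) K (gStructure b d) (gDF.{u, v, w} b ∪ T) ↔
        GeometricAxioms b d := by
    intro K _ _ d
    let _ := gStructure b d
    rw [← isExistentiallyClosed_iff_geometricAxioms hb, isExistentiallyClosed_iff_polyClosed hb,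
      polyClosed_iff_constantAxioms, ← hT, Theory.model_union_iff]
    exact ⟨fun h => (Theory.model_iff _).1 h.2, fun h => ⟨(Theory.model_iff _).2 fun φ hφ => hφ K d,
      (Theory.model_iff _).2 h⟩⟩
  have hmodel : ∀ (M : Type (max u w)) [inst : (gLanguage k m).Structure M],
      M ⊨ gDF.{u, v, w} b ∪ T ↔ ∃ (_ : Field M) (_ : Algebra k M) (d : GAction k H M),
        gStructure b d = inst ∧ GeometricAxioms b d := by
    intro M inst
    constructor
    · intro h
      obtain ⟨_, _, d, rfl⟩ := (SatisfiesIdentities.of_models.{u, v, w} (b := b)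
        (Theory.model_union_iff.1 h).1).isGFieldStructure hb
      exact ⟨_, _, d, rfl, (hgeo M d).1 h⟩
    · rintro ⟨_, _, d, rfl, h⟩
      exact (hgeo M d).2 h
  have hec : ∀ M : Bundled.{max u w} (gLanguage k m).Structure, M ⊨ gDF.{u, v, w} b ∪ T ↔
      M ∈ gFieldClass b ∧ IsECIn (gFieldClass b) M := by
    rintro ⟨M, inst⟩
    refine (hmodel M).trans ⟨?_, ?_⟩
    · rintro ⟨_, _, d, rfl, h⟩
      exact ⟨⟨_, _, d, rfl⟩, (isECIn_iff_isExistentiallyClosed hb d).2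
        ((isExistentiallyClosed_iff_geometricAxioms hb d).2 h)⟩
    · rintro ⟨hM, h⟩
      obtain ⟨_, _, d, rfl⟩ : IsGFieldStructure b M := hM
      exact ⟨_, _, d, rfl, (isExistentiallyClosed_iff_geometricAxioms hb d).1
        ((isECIn_iff_isExistentiallyClosed hb d).1 h)⟩
  refine ⟨gDF.{u, v, w} b ∪ T, fun M inst => ⟨fun h => ?_, ?_⟩, ?_, ?_, ?_⟩
  · obtain ⟨F, A, d, rfl, hd⟩ := (hmodel M).1 h
    let _ := gStructure b d
    exact ⟨M, F, A, d, ⟨Language.Equiv.refl _ M⟩, hd⟩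
  · rintro ⟨K, _, _, d, ⟨e⟩, h⟩
    let _ := gStructure b d
    have := (hgeo K d).2 h
    exact StrongHomClass.theory_model e.symm
  · intro M _ hM
    obtain ⟨N, hN, hN', ⟨f⟩⟩ := exists_isECIn_extension.{u, w}
      (𝒞 := gFieldClass.{u, v, max u w} b) nonempty_of_mem_gFieldClass
      (closedUnderUltraproducts_gFieldClass.{u, v, w} hb) (closedUnderChains_gFieldClass hb)
      (M := Bundled.of M) ((SatisfiesIdentities.of_models.{u, v, w} hM).isGFieldStructure hb)
    exact ⟨N, _, (hec N).2 ⟨hN, hN'⟩, ⟨f⟩⟩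
  · intro M _ hM
    exact ⟨M, _, (Theory.model_union_iff.1 hM).1, ⟨Language.Embedding.refl _ M⟩⟩
  · exact isModelComplete_of_isECIn.{u, w} fun M hM =>
      ⟨nonempty_of_mem_gFieldClass M ((hec M).1 hM).1, (hec M).1 hM⟩

end Class

end

end GroupSchemeAction

theorem theorem3p5 {k : Type u} {H : Type v} [Field k] [CommRing H] [HopfAlgebra k H] {m : ℕ}
    (b : Module.Basis (Fin (m + 1)) k H) (hb : GroupSchemeAction.IsAdapted b) :
    (∀ (K : Type (max u w)) [Field K] [Algebra k K] (d : GroupSchemeAction.GAction k H K),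
      GroupSchemeAction.IsExistentiallyClosed b d ↔ GroupSchemeAction.GeometricAxioms b d) ∧
    ∃ T : (GroupSchemeAction.gLanguage k m).Theory,
      (∀ (M : Type (max u w)) [(GroupSchemeAction.gLanguage k m).Structure M],
        M ⊨ T ↔ ∃ (K : Type (max u w)) (_ : Field K) (_ : Algebra k K)
          (d : GroupSchemeAction.GAction k H K),
          Nonempty (@FirstOrder.Language.Equiv (GroupSchemeAction.gLanguage k m) M K _
            (GroupSchemeAction.gStructure b d)) ∧
          GroupSchemeAction.GeometricAxioms b d) ∧
      GroupSchemeAction.IsModelCompanion.{u, w} (GroupSchemeAction.gDF.{u, v, w} b) T :=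
  ⟨fun _ _ _ d => GroupSchemeAction.isExistentiallyClosed_iff_geometricAxioms hb d,
    GroupSchemeAction.exists_isModelCompanion_gDF hb⟩
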